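/- **Definitions.** A matching of length $n$ is a partition of $\{1,\dots,2n\}$ into $n$ blocks of size two (arcs) $[a,b]$, $a<b$, with opener $a$ and closer $b$. It is a *Stoimenow matching* if it has no two nested arcs whose openers are neighbouring integers and no two nested arcs whose closers are neighbouring integers. A matching contains a pattern if removing some arcs (and relabelling the remaining points in order) gives that pattern. Let $\mathcal M(P)$ be the set of all Stoimenow matchings (of any length $|M|\ge 0$) avoiding $P$, and let $$P_1=\{[1,3],[2,7],[4,5],[6,8]\},\qquad P_2=\{[1,3],[2,5],[4,7],[6,8]\}.$$ A *crossing* is a nonempty set of arcs $[a_1,b_1],\dots,[a_k,b_k]$ with $a_1<\dots<a_k<b_1<\dots<b_k$; it is maximal if it is not properly contained in another crossing. Let $\mathsf{mcr}(M)$ be the number of maximal crossings of $M$; $\mathsf{fcr}(M)$ the size of the first maximal crossing, i.e. the one containing the arc with opener $1$ ($0$ for the empty matching); and $\mathsf{bl}(M)$ the number of irreducible blocks of $M$, where $M$ is cut after every prefix $\{1,\dots,2i\}$ that contains as many openers as closers. Let $\mathcal P(\mathbf{3+1})$ and $\mathcal P(\mathbf N)$ be the sets of finite posets, up to isomorphism,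 having no induced subposet isomorphic to $\mathbf{2+2}$ and none isomorphic to $\mathbf{3+1}$, respectively $\mathbf N$. Here $\mathbf{2+2}$ and $\mathbf{3+1}$ are disjoint unions of chains of the indicated sizes, and $\mathbf N$ is the poset on $\{a,b,c,d\}$ with relations $a<c$, $a<d$, $b<d$. For a poset $P$ with $|P|$ elements let $\mathsf{mag}(P)$ be the number of distinct strict down-sets $\{y: y<x\}$, $x\in P$; $\mathsf{min}(P)$ the number of minimal elements; $\mathsf{ssd}(P)$ the number of components in the decomposition of $P$ as an ordinal sum of nonempty posets, none of which is an ordinal sum of two nonempty posets; and $\mathsf{smc}(P)$ the size of a shortest maximal chain. An *ascent sequence* is a finite integer sequence $(\alpha_1,\dots,\alpha_n)$ with $\alpha_1=0$ and $0\le\alpha_i\le 1+\#\{j: 1\le j<i-1,\ \alpha_j<\alpha_{j+1}\}$ for $2\le i\le n$; $\mathcal A(101)$ is the set of those with no $i<j<k$ such that $\alpha_j<\alpha_i=\alpha_k$. A *Fishburn permutation* is a permutation $\pi_1\cdots\pi_n$ with no $i,j$ such that $j>i+1$ and $\pi_j+1=\pi_i<\pi_{i+1}$; $\mathcal F(3142)$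 is the set of those avoiding the classical pattern $3142$. In both cases $|\cdot|$ is the length $n\ge0$, $\mathsf{lmax}$ is the number of (strict) left-to-right maxima, and $\mathsf{rmin}$ is the number of (strict) right-to-left minima. Further, $\mathsf{zero}(\alpha)$ is the number of zeros of $\alpha$, and $\mathsf{idr}(\pi)$ is the length of the initial descending run of $\pi$. Let $N(x,t)=1+\sum_{n\ge1}\sum_{k=1}^{n}\frac1n\binom nk\binom n{k-1}x^k\,t^n$ be the Narayana generating function, and let $R=\sqrt{1+t^2(1-x)^2-2t(1+x)}$ be the formal power series square root with constant term $1$. **Theorem.** As formal power series in $x,y,z,t$, $$\begin{aligned} &\sum_{M\in\mathcal M(P_1)}x^{\mathsf{mcr}(M)}y^{\mathsf{fcr}(M)}z^{\mathsf{bl}(M)}t^{|M|} =\sum_{M\in\mathcal M(P_2)}x^{\mathsf{mcr}(M)}y^{\mathsf{fcr}(M)}z^{\mathsf{bl}(M)}t^{|M|}\\ ={}&\sum_{P\in\mathcal P(\mathbf{3+1})}x^{\mathsf{mag}(P)}y^{\mathsf{min}(P)}z^{\mathsf{ssd}(P)}t^{|P|} =\sum_{P\in\mathcal P(\mathbf N)}x^{\mathsf{mag}(P)}y^{\mathsf{min}(P)}z^{\mathsf{smc}(P)}t^{|P|}\\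 ={}&\sum_{\alpha\in\mathcal A(101)}x^{\mathsf{lmax}(\alpha)}y^{\mathsf{zero}(\alpha)}z^{\mathsf{rmin}(\alpha)}t^{|\alpha|} =\sum_{\pi\in\mathcal F(3142)}x^{\mathsf{rmin}(\pi)}y^{\mathsf{idr}(\pi)}z^{\mathsf{lmax}(\pi)}t^{|\pi|}\\ ={}&1+\frac{xyzt\left(1-y+t(x+y+xy-1)+(1-y)R\right)}{\left(1+y(xt+yt-t-1)\right)\left(1+t(x-2xz-1)+R\right)}\\ ={}&1+\frac{xyzt}{\left(1-ytN(x,t)\right)\left(1-zt(N(x,t)+x-1)\right)}. \end{aligned}$$ -/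

import Mathlib

namespace CatalanFishburn

/-! ### Matchings -/

/-- A matching on `2n` points: a partition of the points into blocks of size two, given by the
map that sends every point to the other point of its block. The points `1, …, 2n` are the elements
`0, …, 2n - 1` of `Fin (2 * n)`. -/
@[ext]
structure Matching (n : ℕ) where
  partner : Fin (2 * n) → Fin (2 * n)
  involutive : Function.Involutive partner
  partner_ne : ∀ i, partner i ≠ i

namespace Matching

variable {n : ℕ}

/-- `a` is an opener: it is the left end of its arc `[a, partner a]`. An arc is often identified
with its opener. -/
def IsOpener (M : Matching n) (a : Fin (2 * n)) : Prop := a < M.partner a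

/-- `b` is a closer: it is the right end of its arc `[partner b, b]`. -/
def IsCloser (M : Matching n) (b : Fin (2 * n)) : Prop := M.partner b < b

/-- A Type I occurrence: neighbouring openers `i`, `i + 1` whose arcs are nested. -/
def HasTypeI (M : Matching n) : Prop :=
  ∃ i i' : Fin (2 * n), (i' : ℕ) = i + 1 ∧ M.IsOpener i ∧ M.IsOpener i' ∧
    M.partner i' < M.partner i

/-- A Type II occurrence: neighbouring closers `j`, `j + 1` whose arcs are nested. -/
def HasTypeII (M : Matching n) : Prop :=
  ∃ j j' : Fin (2 * n), (j' : ℕ) = j + 1 ∧ M.IsCloser j ∧ M.IsCloser j' ∧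
    M.partner j' < M.partner j

/-- Stoimenow matchings. -/
def IsStoimenow (M : Matching n) : Prop := ¬ M.HasTypeI ∧ ¬ M.HasTypeII

/-- `M` contains the pattern `Q`: removing some arcs of `M` leaves a matching that is isomorphic
to `Q`, the remaining points being the image of the order embedding `f`. -/
def Contains {k : ℕ} (M : Matching n) (Q : Matching k) : Prop :=
  ∃ f : Fin (2 * k) ↪o Fin (2 * n), ∀ i, M.partner (f i) = f (Q.partner i)

/-- A crossing, as the set of the openers of its arcs: a nonempty set of arcs
`[a₁, b₁], …, [aₖ, bₖ]` with `a₁ < ⋯ < aₖ < b₁ < ⋯ < bₖ`, that is, any two of them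
satisfy `a < a' < b < b'`. -/
def IsCrossing (M : Matching n) (S : Finset (Fin (2 * n))) : Prop :=
  S.Nonempty ∧ (∀ a ∈ S, M.IsOpener a) ∧
    ∀ a ∈ S, ∀ a' ∈ S, a < a' → a' < M.partner a ∧ M.partner a < M.partner a'

/-- A maximal crossing: a crossing that is not properly contained in another crossing. -/
def IsMaximalCrossing (M : Matching n) (S : Finset (Fin (2 * n))) : Prop :=
  Maximal M.IsCrossing S

/-- The number of maximal crossings. -/
noncomputable def mcr (M : Matching n) : ℕ :=
  {S : Finset (Fin (2 * n)) | M.IsMaximalCrossing S}.ncard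

/-- The first (leftmost) maximal crossing: the one that contains the arc whose opener is the first
point. A Stoimenow matching with at least one arc has exactly one, see
`existsUnique_isFirstMaximalCrossing` below. -/
def IsFirstMaximalCrossing (M : Matching n) (S : Finset (Fin (2 * n))) : Prop :=
  M.IsMaximalCrossing S ∧ ∃ a ∈ S, (a : ℕ) = 0

/-- The size of the first maximal crossing (`0` for the empty matching). -/
noncomputable def fcr (M : Matching n) : ℕ :=
  sSup {k : ℕ | ∃ S, M.IsFirstMaximalCrossing S ∧ S.card = k}

/-- The first `2i` points contain as many openers as closers. -/
def IsBalanced (M : Matching n) (i : ℕ) : Prop :=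
  {a : Fin (2 * n) | (a : ℕ) < 2 * i ∧ M.IsOpener a}.ncard =
    {b : Fin (2 * n) | (b : ℕ) < 2 * i ∧ M.IsCloser b}.ncard

/-- The points `2i + 1, …, 2j` (in the numbering `1, …, 2n`) form an irreducible block: they carry
a nonempty submatching of `M`, which is irreducible. -/
def IsIrreducibleBlock (M : Matching n) (i j : ℕ) : Prop :=
  i < j ∧ j ≤ n ∧ M.IsBalanced i ∧ M.IsBalanced j ∧ ∀ k, i < k → k < j → ¬ M.IsBalanced k

/-- The number of irreducible blocks. -/
noncomputable def bl (M : Matching n) : ℕ :=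
  {p : ℕ × ℕ | M.IsIrreducibleBlock p.1 p.2}.ncard

theorem existsUnique_isFirstMaximalCrossing (M : Matching n) (hM : M.IsStoimenow) (hn : 0 < n) :
    ∃! S, M.IsFirstMaximalCrossing S := by
  have h0 : 0 < 2 * n := by omega
  let z : Fin (2 * n) := ⟨0, h0⟩
  have hzle : ∀ c : Fin (2 * n), z ≤ c := fun c => Fin.le_def.2 (Nat.zero_le _)
  have hz : M.IsOpener z := lt_of_le_of_ne (hzle _) (fun h => M.partner_ne z h.symm)
  have key : ∀ a : Fin (2 * n), a < M.partner z →
      M.IsOpener a ∧ ∀ c, c < a → M.partner c < M.partner a := by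
    intro a
    induction a using WellFoundedLT.induction with
    | ind a ih =>
      intro haz
      rcases (hzle a).eq_or_lt with rfl | hza
      · exact ⟨hz, fun c hc => absurd hc (not_lt.2 (hzle c))⟩
      have hao : M.IsOpener a := by
        by_contra hno
        have hp : M.partner a < a := lt_of_le_of_ne (not_lt.1 hno) (M.partner_ne a)
        rcases (hzle (M.partner a)).eq_or_lt with h | h
        · rw [h, M.involutive a] at haz
          exact lt_irrefl _ haz
        · have h2 := (ih _ hp (hp.trans haz)).2 z h
          rw [M.involutive a] at h2
          exact lt_asymm h2 haz
      have hapos : 0 < (a : ℕ) := Fin.lt_def.1 hza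
      let a' : Fin (2 * n) := ⟨(a : ℕ) - 1, by have := a.2; omega⟩
      have ha' : (a : ℕ) = (a' : ℕ) + 1 := by simp only [a']; omega
      have haa' : a' < a := Fin.lt_def.2 (by omega)
      obtain ⟨ho', hc'⟩ := ih a' haa' (haa'.trans haz)
      have hstep : M.partner a' < M.partner a := by
        rcases lt_trichotomy (M.partner a') (M.partner a) with h | h | h
        · exact h
        · exact absurd (M.involutive.injective h) haa'.ne
        · exact absurd ⟨a', a, ha', ho', hao, h⟩ hM.1
      refine ⟨hao, fun c hc => ?_⟩
      have hca' : c ≤ a' := Fin.le_def.2 (by have := Fin.lt_def.1 hc; omega)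
      rcases hca'.eq_or_lt with rfl | h
      · exact hstep
      · exact (hc' c h).trans hstep
  have hcr : M.IsCrossing (Finset.Iio (M.partner z)) := by
    refine ⟨⟨z, Finset.mem_Iio.2 hz⟩, fun a ha => (key a (Finset.mem_Iio.1 ha)).1, ?_⟩
    intro a ha a' ha' hlt
    rw [Finset.mem_Iio] at ha ha'
    refine ⟨lt_of_lt_of_le ha' ?_, (key a' ha').2 a hlt⟩
    rcases (hzle a).eq_or_lt with h | h
    · rw [← h]
    · exact ((key a ha).2 z h).le
  have hsub : ∀ T, M.IsCrossing T → z ∈ T → T ⊆ Finset.Iio (M.partner z) := by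
    intro T hT hzT a ha
    rw [Finset.mem_Iio]
    rcases (hzle a).eq_or_lt with h | h
    · rw [← h]; exact hz
    · exact (hT.2.2 z hzT a ha h).1
  refine ⟨Finset.Iio (M.partner z),
    ⟨⟨hcr, fun T hT hle => hsub T hT (hle (Finset.mem_Iio.2 hz))⟩, z, Finset.mem_Iio.2 hz, rfl⟩, ?_⟩
  rintro S ⟨hS, a, haS, ha⟩
  have haz : a = z := Fin.ext ha
  subst haz
  exact le_antisymm (hsub S hS.1 haS) (hS.2 hcr (hsub S hS.1 haS))

end Matching

/-- The pattern `P₁ = {[1,3], [2,7], [4,5], [6,8]}`. -/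
def patternP1 : Matching 4 where
  partner := ![2, 6, 0, 4, 3, 7, 1, 5]
  involutive := by unfold Function.Involutive; decide
  partner_ne := by decide

/-- The pattern `P₂ = {[1,3], [2,5], [4,7], [6,8]}`. -/
def patternP2 : Matching 4 where
  partner := ![2, 4, 0, 6, 1, 7, 3, 5]
  involutive := by unfold Function.Involutive; decide
  partner_ne := by decide

/-- The Stoimenow matchings with `n` arcs that avoid the pattern `Q`. -/
def StoimenowAvoiding {k : ℕ} (Q : Matching k) (n : ℕ) : Type :=
  {M : Matching n // M.IsStoimenow ∧ ¬ M.Contains Q}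

/-! ### Posets -/

section Posets

variable {X Y : Type} [PartialOrder X] [PartialOrder Y]

/-- The magnitude: the number of distinct strict down-sets `D(x) = {y | y < x}`. -/
noncomputable def posetMag (X : Type) [PartialOrder X] : ℕ :=
  (Set.range fun x : X => Set.Iio x).ncard

/-- The number of minimal elements. -/
noncomputable def posetMin (X : Type) [PartialOrder X] : ℕ :=
  {x : X | IsMin x}.ncard

/-- The size of a shortest maximal chain. -/
noncomputable def posetSmc (X : Type) [PartialOrder X] : ℕ :=
  sInf {k : ℕ | ∃ c : Set X, IsMaxChain (· ≤ ·) c ∧ c.ncard = k}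

/-- The subposet on `s` is the ordinal sum of the subposets on `A` and `B`. -/
def IsOrdinalSum (s A B : Set X) : Prop :=
  A ∪ B = s ∧ ∀ a ∈ A, ∀ b ∈ B, a < b

/-- The subposet on `s` is not the ordinal sum of two nonempty posets. -/
def IsOrdinallyIrreducible (s : Set X) : Prop :=
  ¬ ∃ A B : Set X, A.Nonempty ∧ B.Nonempty ∧ IsOrdinalSum s A B

/-- The fibres of `f` over `0, …, k - 1`, in this order, are the components of the decomposition
of `X` as an ordinal sum of nonempty irreducible posets. -/
def IsOrdinalDecomposition {k : ℕ} (f : X → Fin k) : Prop :=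
  Function.Surjective f ∧ (∀ a b, f a < f b → a < b) ∧
    ∀ i, IsOrdinallyIrreducible (f ⁻¹' {i})

/-- The number of components of the ordinal sum decomposition. (Every finite poset has exactly one
decomposition, so the set below has exactly one element.) -/
noncomputable def posetSsd (X : Type) [PartialOrder X] : ℕ :=
  sSup {k : ℕ | ∃ f : X → Fin k, IsOrdinalDecomposition f}

/-- `X` has no induced subposet isomorphic to `Q`. -/
def PosetAvoids (Q X : Type) [PartialOrder Q] [PartialOrder X] : Prop := IsEmpty (Q ↪o X)

theorem posetMag_congr (e : X ≃o Y) : posetMag X = posetMag Y := by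
  unfold posetMag
  have : (Set.range fun y : Y => Set.Iio y) =
      (fun s => e '' s) '' (Set.range fun x : X => Set.Iio x) := by
    ext s
    constructor
    · rintro ⟨y, rfl⟩
      exact ⟨_, ⟨e.symm y, rfl⟩, by simp [OrderIso.image_Iio]⟩
    · rintro ⟨_, ⟨x, rfl⟩, rfl⟩
      exact ⟨e x, by simp [OrderIso.image_Iio]⟩
  rw [this, Set.ncard_image_of_injective _ e.injective.image_injective]

theorem posetMin_congr (e : X ≃o Y) : posetMin X = posetMin Y := by
  unfold posetMin
  have : {y : Y | IsMin y} = e '' {x : X | IsMin x} := by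
    ext y
    constructor
    · intro hy
      exact ⟨e.symm y, e.symm.isMin_apply.2 hy, by simp⟩
    · rintro ⟨x, hx, rfl⟩
      exact e.isMin_apply.2 hx
  rw [this, Set.ncard_image_of_injective _ e.injective]

theorem posetSmc_congr (e : X ≃o Y) : posetSmc X = posetSmc Y := by
  have key : ∀ {X Y : Type} [PartialOrder X] [PartialOrder Y] (_ : X ≃o Y) (k : ℕ),
      (∃ c : Set X, IsMaxChain (· ≤ ·) c ∧ c.ncard = k) →
      ∃ c : Set Y, IsMaxChain (· ≤ ·) c ∧ c.ncard = k := by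
    rintro X Y _ _ e k ⟨c, hc, rfl⟩
    exact ⟨e '' c, hc.image e, Set.ncard_image_of_injective _ e.injective⟩
  unfold posetSmc
  congr 1
  ext k
  exact ⟨key e k, key e.symm k⟩

theorem posetSsd_congr (e : X ≃o Y) : posetSsd X = posetSsd Y := by
  have key : ∀ {X Y : Type} [PartialOrder X] [PartialOrder Y] (_ : X ≃o Y) (k : ℕ),
      (∃ f : X → Fin k, IsOrdinalDecomposition f) →
      ∃ f : Y → Fin k, IsOrdinalDecomposition f := by
    rintro X Y _ _ e k ⟨f, hs, hlt, hirr⟩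
    refine ⟨f ∘ e.symm, hs.comp e.symm.surjective,
      fun a b h => e.symm.lt_iff_lt.1 (hlt _ _ h), ?_⟩
    rintro i ⟨A, B, hA, hB, hAB, hl⟩
    refine hirr i ⟨e.symm '' A, e.symm '' B, hA.image _, hB.image _, ?_, ?_⟩
    · rw [← Set.image_union, hAB]
      ext x
      constructor
      · rintro ⟨y, hy, rfl⟩
        exact hy
      · intro hx
        exact ⟨e x, by simpa using hx, by simp⟩
    · rintro _ ⟨a, ha, rfl⟩ _ ⟨b, hb, rfl⟩
      exact e.symm.lt_iff_lt.2 (hl a ha b hb)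
  unfold posetSsd
  congr 1
  ext k
  exact ⟨key e k, key e.symm k⟩

theorem posetAvoids_congr (Q : Type) [PartialOrder Q] (e : X ≃o Y) :
    PosetAvoids Q X ↔ PosetAvoids Q Y :=
  ⟨fun h => ⟨fun g => h.false (g.trans e.symm.toOrderEmbedding)⟩,
    fun h => ⟨fun g => h.false (g.trans e.toOrderEmbedding)⟩⟩

end Posets

/-- Isomorphism of partial orders on the set `Fin n`. -/
instance posetSetoid (n : ℕ) : Setoid (PartialOrder (Fin n)) where
  r p q := Nonempty (@OrderIso (Fin n) (Fin n) p.toLE q.toLE)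
  iseqv :=
    { refl := fun p => ⟨@OrderIso.refl (Fin n) p.toLE⟩
      symm := fun {p q} ⟨e⟩ => ⟨@OrderIso.symm (Fin n) (Fin n) p.toLE q.toLE e⟩
      trans := fun {p q r} ⟨e⟩ ⟨f⟩ =>
        ⟨@OrderIso.trans (Fin n) (Fin n) (Fin n) p.toLE q.toLE r.toLE e f⟩ }

/-- Posets with `n` elements, up to isomorphism. -/
def UnlabeledPoset (n : ℕ) : Type := Quotient (posetSetoid n)

namespace UnlabeledPoset

variable {n : ℕ}

/-- The magnitude of an unlabeled poset. -/
noncomputable def mag (P : UnlabeledPoset n) : ℕ :=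
  Quotient.lift (s := posetSetoid n) (fun p => @posetMag (Fin n) p)
    (fun p q h => Nonempty.elim h fun e => @posetMag_congr (Fin n) (Fin n) p q e) P

/-- The number of minimal elements of an unlabeled poset. -/
noncomputable def min (P : UnlabeledPoset n) : ℕ :=
  Quotient.lift (s := posetSetoid n) (fun p => @posetMin (Fin n) p)
    (fun p q h => Nonempty.elim h fun e => @posetMin_congr (Fin n) (Fin n) p q e) P

/-- The size of a shortest maximal chain of an unlabeled poset. -/
noncomputable def smc (P : UnlabeledPoset n) : ℕ :=
  Quotient.lift (s := posetSetoid n) (fun p => @posetSmc (Fin n) p)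
    (fun p q h => Nonempty.elim h fun e => @posetSmc_congr (Fin n) (Fin n) p q e) P

/-- The number of components of the ordinal sum decomposition of an unlabeled poset. -/
noncomputable def ssd (P : UnlabeledPoset n) : ℕ :=
  Quotient.lift (s := posetSetoid n) (fun p => @posetSsd (Fin n) p)
    (fun p q h => Nonempty.elim h fun e => @posetSsd_congr (Fin n) (Fin n) p q e) P

/-- The unlabeled poset has no induced subposet isomorphic to `Q`. -/
def Avoids (Q : Type) [PartialOrder Q] (P : UnlabeledPoset n) : Prop :=
  Quotient.lift (s := posetSetoid n) (fun p => @PosetAvoids Q (Fin n) _ p)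
    (fun p q h => Nonempty.elim h fun e => propext (@posetAvoids_congr (Fin n) (Fin n) p q Q _ e)) P

end UnlabeledPoset

/-- The poset `2+2`: the disjoint union of two chains with two elements each. -/
abbrev TwoPlusTwo : Type := Fin 2 ⊕ Fin 2

/-- The poset `3+1`: the disjoint union of a chain with three elements and a single element. -/
abbrev ThreePlusOne : Type := Fin 3 ⊕ Fin 1

/-- The elements of the poset `N`. -/
inductive PosetN : Type
  | a | b | c | d

/-- The poset `N`, with the relations `a < c`, `a < d` and `b < d`. -/
instance : PartialOrder PosetN where
  le u v := u = v ∨ (u = .a ∧ v = .c) ∨ (u = .a ∧ v = .d) ∨ (u = .b ∧ v = .d)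
  le_refl u := Or.inl rfl
  le_trans u v w := by cases u <;> cases v <;> cases w <;> simp
  le_antisymm u v := by cases u <;> cases v <;> simp

/-- The posets with `n` elements, up to isomorphism, that avoid both `2+2` and `Q`. -/
def PosetsAvoiding (Q : Type) [PartialOrder Q] (n : ℕ) : Type :=
  {P : UnlabeledPoset n // P.Avoids TwoPlusTwo ∧ P.Avoids Q}

/-! ### Words, ascent sequences and permutations -/

section Words

variable {n : ℕ} {β : Type} [Preorder β]

/-- The word `w` contains the word `p` as a pattern: some subsequence of `w` is order isomorphic
to `p` (equal letters of `p` corresponding to equal letters of `w`). -/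
def ContainsPattern {k : ℕ} (w : Fin n → β) (p : Fin k → ℕ) : Prop :=
  ∃ f : Fin k ↪o Fin n, ∀ i j, w (f i) ≤ w (f j) ↔ p i ≤ p j

/-- The number of left-to-right maxima. -/
noncomputable def wordLmax (w : Fin n → β) : ℕ :=
  {i : Fin n | ∀ j, j < i → w j < w i}.ncard

/-- The number of right-to-left minima. -/
noncomputable def wordRmin (w : Fin n → β) : ℕ :=
  {i : Fin n | ∀ j, i < j → w i < w j}.ncard

/-- The length of the initial descending run: the largest `k` such that the first `k` letters are
strictly decreasing. -/
noncomputable def wordIdr (w : Fin n → β) : ℕ :=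
  sSup {k : ℕ | k ≤ n ∧ ∀ i j : Fin n, i < j → (j : ℕ) < k → w j < w i}

/-- The number of ascents of the prefix of `w` that consists of the letters before position `i`. -/
noncomputable def ascBefore (w : Fin n → β) (i : Fin n) : ℕ :=
  {j : Fin n | ∃ j' : Fin n, (j' : ℕ) = j + 1 ∧ j' < i ∧ w j < w j'}.ncard

end Words

/-- Ascent sequences: the first letter is `0`, and every later letter is at most one more than the
number of ascents before it. -/
def IsAscentSequence {n : ℕ} (α : Fin n → ℕ) : Prop :=
  (∀ i : Fin n, (i : ℕ) = 0 → α i = 0) ∧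
    ∀ i : Fin n, 0 < (i : ℕ) → α i ≤ 1 + ascBefore α i

/-- The number of zeros. -/
noncomputable def wordZero {n : ℕ} (α : Fin n → ℕ) : ℕ := {i : Fin n | α i = 0}.ncard

/-- The ascent sequences of length `n` that avoid the pattern `p`. -/
def AscentAvoiding {k : ℕ} (p : Fin k → ℕ) (n : ℕ) : Type :=
  {α : Fin n → ℕ // IsAscentSequence α ∧ ¬ ContainsPattern α p}

/-- Fishburn permutations: there are no positions `i`, `i + 1`, `j` with `j > i + 1` and
`π j + 1 = π i < π (i + 1)`. -/
def IsFishburn {n : ℕ} (π : Equiv.Perm (Fin n)) : Prop :=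
  ¬ ∃ i i' j : Fin n, (i' : ℕ) = i + 1 ∧ i' < j ∧ (π j : ℕ) + 1 = π i ∧ π i < π i'

/-- The Fishburn permutations of length `n` that avoid the pattern `p`. -/
def FishburnAvoiding {k : ℕ} (p : Fin k → ℕ) (n : ℕ) : Type :=
  {π : Equiv.Perm (Fin n) // IsFishburn π ∧ ¬ ContainsPattern π p}

/-! ### Generating functions -/

/-- The generating function `∑ x ^ s₁ a * y ^ s₂ a * z ^ s₃ a * t ^ n`, summed over all `n` and all
`a` in the finite set `A n`, as a formal power series in the variables `x, y, z, t` (numbered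
`0, 1, 2, 3`): the coefficient of `x ^ i * y ^ j * z ^ k * t ^ n` is the number of `a` in `A n` with
`(s₁ a, s₂ a, s₃ a) = (i, j, k)`. -/
noncomputable def genFun (A : ℕ → Type) (s₁ s₂ s₃ : ∀ {n : ℕ}, A n → ℕ) :
    MvPowerSeries (Fin 4) ℚ :=
  fun m => (Nat.card {a : A (m 3) // s₁ a = m 0 ∧ s₂ a = m 1 ∧ s₃ a = m 2} : ℚ)

/-- The Narayana polynomial `N_n`. -/
noncomputable def narayanaPoly (n : ℕ) : Polynomial ℚ :=
  ∑ k ∈ Finset.Icc 1 n,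
    Polynomial.monomial k ((1 / (n : ℚ)) * (n.choose k : ℚ) * (n.choose (k - 1) : ℚ))

/-- The series `∑_{n ≥ 1} N_n(x) t ^ n`. -/
noncomputable def narayanaTail : MvPowerSeries (Fin 4) ℚ :=
  fun m => if m 1 = 0 ∧ m 2 = 0 ∧ 1 ≤ m 3 then (narayanaPoly (m 3)).coeff (m 0) else 0

/-- The Narayana generating function `N(x, t) = 1 + ∑_{n ≥ 1} N_n(x) t ^ n`. -/
noncomputable def narayanaGF : MvPowerSeries (Fin 4) ℚ := 1 + narayanaTail

end CatalanFishburn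

open CatalanFishburn

open CatalanFishburn

/-! ### Power series in four variables -/

namespace CatalanFishburn

/-! All six generating functions are shown to equal one series, `catalanGF`. The common model is the
Catalan family of staircase sequences (weakly increasing `d` with `d i ≤ i`), counted by distinct
letters, zeros and fixed points.

Matchings and posets. A matching is a pair `(d, τ)`: `d i` counts the closers to the left of the
`i`-th opener, and `τ` assigns closers to openers (`HasCode`). It is Stoimenow exactly when arcs
with openers in one run, or with closers in one run, never nest (`isStoimenow_iff`). A poset without
`2+2` is an interval order and has such a pair too (`exists_stoimenowPair`); its isomorphism class
determines `d`, the sorted list of the sizes of the strict down-sets. Avoiding `P₁` or `3+1` means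
`τ = 1` (`eq_one`, `eq_one_iff`). Avoiding `P₂` or `N` means `NoRunCrossing` (`noRunCrossing_iff`,
`hasN_iff`), and every `d` has exactly one such `τ` (`exists_noRunCrossing`, `eq_of_noRunCrossing`).
So each of these four classes is in bijection with the staircase sequences, and its three statistics
depend on `d` alone.

Generating trees. Staircase sequences, ascent sequences avoiding 101 and Fishburn permutations
avoiding 3142 all grow by the Catalan rule: state `k` has children of states `1, …, k + 1`. The
series of the objects of state `k + 1` is geometric, `B * q ^ k` (`stateGF_closed_form`). Beyond
size one, the statistic marked by `x` increases exactly when the state does not grow in the first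
tree, and exactly when it grows in the other two. This gives `q = tN` and `q = t(N + x - 1)`
respectively; since `y` and `z` exchange their roles as well, the results coincide.

The algebra rests on `N = 1 + tN(N + x - 1)` (`narayanaGF_eq`), which comes from an explicit formula
for the coefficients of all powers of `N`. Solving this quadratic gives `R = 1 + t(1 - x) - 2tN` and
with it the algebraic form. -/

theorem coeff_X_mul_eq (s : Fin 4) (f : MvPowerSeries (Fin 4) ℚ) (m : Fin 4 →₀ ℕ) :
    MvPowerSeries.coeff m (MvPowerSeries.X s * f) =
      if 1 ≤ m s then MvPowerSeries.coeff (m - Finsupp.single s 1) f else 0 := by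
  classical
  rw [MvPowerSeries.X, MvPowerSeries.coeff_monomial_mul]
  simp [Finsupp.single_le_iff]

theorem coeff_X_pow_mul_eq (s : Fin 4) (k : ℕ) (f : MvPowerSeries (Fin 4) ℚ) (m : Fin 4 →₀ ℕ) :
    MvPowerSeries.coeff m (MvPowerSeries.X s ^ k * f) =
      if k ≤ m s then MvPowerSeries.coeff (m - Finsupp.single s k) f else 0 := by
  classical
  rw [MvPowerSeries.X_pow_eq, MvPowerSeries.coeff_monomial_mul]
  simp [Finsupp.single_le_iff]

theorem eq_zero_of_forall_X_pow_dvd {s : Fin 4} {f : MvPowerSeries (Fin 4) ℚ}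
    (h : ∀ n, MvPowerSeries.X s ^ n ∣ f) : f = 0 := by
  ext m
  rw [map_zero]
  exact MvPowerSeries.X_pow_dvd_iff.1 (h (m s + 1)) m (Nat.lt_succ_self _)

/-! ### The Narayana series -/

/-- The coefficient of `x ^ a * t ^ n` in the `k`-th power of the Narayana series. -/
noncomputable def narayanaPowCoeff (k : ℕ) : ℕ → ℕ → ℚ
  | 0, 0 => 1
  | 0, _ + 1 => 0
  | _ + 1, 0 => 0
  | n + 1, a + 1 => k / (n + 1) * (n + 1).choose (a + 1) * (n + k).choose a

theorem cast_choose_succ_mul (n k : ℕ) :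
    (n.choose (k + 1) : ℚ) * (k + 1) = n.choose k * (n - k) := by
  rcases le_or_gt k n with h | h
  · have := Nat.choose_succ_right_eq n k
    rw [← Nat.cast_sub h]
    exact_mod_cast this
  · rw [Nat.choose_eq_zero_of_lt h, Nat.choose_eq_zero_of_lt (by omega)]
    simp

theorem cast_choose_succ_succ_mul (n k : ℕ) :
    ((n + 1).choose (k + 1) : ℚ) * (k + 1) = (n + 1) * n.choose k := by
  have := Nat.add_one_mul_choose_eq n k
  exact_mod_cast this.symm

/-- This is the coefficient form of `N ^ k` times the quadratic equation of `N`. The closed form is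
the one suggested by Lagrange inversion; all binomials are rewritten as rational multiples of two of
them, and a polynomial identity remains. -/
theorem narayanaPowCoeff_succ_succ (k n a : ℕ) :
    narayanaPowCoeff (k + 1) (n + 1) (a + 1) = narayanaPowCoeff k (n + 1) (a + 1) +
      narayanaPowCoeff (k + 2) n (a + 1) + narayanaPowCoeff (k + 1) n a -
      narayanaPowCoeff (k + 1) n (a + 1) := by
  rcases n with _ | n
  · rcases a with _ | a
    · simp [narayanaPowCoeff]
    · simp [narayanaPowCoeff, Nat.choose_eq_zero_of_lt (show 1 < a + 1 + 1 by omega)]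
  rcases a with _ | a
  · simp [narayanaPowCoeff]
    field_simp
    ring
  have hA : (a : ℚ) + 1 ≠ 0 := by positivity
  have hA' : (a : ℚ) + 2 ≠ 0 := by positivity
  have h1 : ((n + 1 + k).choose (a + 1) : ℚ) =
      (n + 1 + k).choose a * (n + 1 + k - a) / (a + 1) := by
    rw [eq_div_iff hA, cast_choose_succ_mul]; push_cast; ring
  have h2 : ((n + 1 + (k + 1)).choose (a + 1) : ℚ) =
      (n + 2 + k) * (n + 1 + k).choose a / (a + 1) := by
    rw [eq_div_iff hA, ← add_assoc, cast_choose_succ_succ_mul]; push_cast; ring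
  have h3 : ((n + 1).choose (a + 1 + 1) : ℚ) = (n + 1).choose (a + 1) * (n - a) / (a + 2) := by
    rw [eq_div_iff hA']
    have := cast_choose_succ_mul (n + 1) (a + 1)
    push_cast at this
    linear_combination this
  have h4 : ((n + 1 + 1).choose (a + 1 + 1) : ℚ) = (n + 2) * (n + 1).choose (a + 1) / (a + 2) := by
    rw [eq_div_iff hA']
    have := cast_choose_succ_succ_mul (n + 1) (a + 1)
    push_cast at this
    linear_combination this
  have h5 : n + (k + 2) = n + 1 + (k + 1) := by ring
  have h6 : n + (k + 1) = n + 1 + k := by ring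
  simp only [narayanaPowCoeff, h5, h6, h1, h2, h3, h4]
  push_cast
  field_simp
  ring

theorem narayanaPowCoeff_succ_zero (k n : ℕ) :
    narayanaPowCoeff (k + 1) (n + 1) 0 = narayanaPowCoeff k (n + 1) 0 +
      narayanaPowCoeff (k + 2) n 0 - narayanaPowCoeff (k + 1) n 0 := by
  rcases n with _ | n <;> simp [narayanaPowCoeff]

/-- The powers of the Narayana series, by their coefficients. -/
noncomputable def narayanaPow (k : ℕ) : MvPowerSeries (Fin 4) ℚ :=
  fun m => if m 1 = 0 ∧ m 2 = 0 then narayanaPowCoeff k (m 3) (m 0) else 0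

theorem coeff_narayanaPow (k : ℕ) (m : Fin 4 →₀ ℕ) :
    MvPowerSeries.coeff m (narayanaPow k) =
      if m 1 = 0 ∧ m 2 = 0 then narayanaPowCoeff k (m 3) (m 0) else 0 := rfl

theorem finsupp_fin_four_eq_zero_iff (m : Fin 4 →₀ ℕ) :
    m = 0 ↔ m 0 = 0 ∧ m 1 = 0 ∧ m 2 = 0 ∧ m 3 = 0 := by
  constructor
  · rintro rfl
    simp
  · rintro ⟨h0, h1, h2, h3⟩
    ext i
    fin_cases i <;> assumption

theorem narayanaPow_zero : narayanaPow 0 = 1 := by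
  classical
  ext m
  rw [coeff_narayanaPow, MvPowerSeries.coeff_one]
  simp only [finsupp_fin_four_eq_zero_iff]
  rcases h3 : m 3 with _ | n <;> rcases h0 : m 0 with _ | a <;> simp [narayanaPowCoeff]

theorem narayanaPow_one : narayanaPow 1 = narayanaGF := by
  classical
  ext m
  rw [coeff_narayanaPow, narayanaGF, map_add, MvPowerSeries.coeff_one]
  have : MvPowerSeries.coeff m narayanaTail =
    if m 1 = 0 ∧ m 2 = 0 ∧ 1 ≤ m 3 then (narayanaPoly (m 3)).coeff (m 0) else 0 := rfl
  rw [this]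
  simp only [finsupp_fin_four_eq_zero_iff]
  by_cases h12 : m 1 = 0 ∧ m 2 = 0
  · rcases h3 : m 3 with _ | n
    · rcases h0 : m 0 with _ | a <;> simp [narayanaPowCoeff, h12]
    · rcases h0 : m 0 with _ | a
      · simp [narayanaPowCoeff, h12, narayanaPoly, Polynomial.coeff_monomial]
      · simp [narayanaPowCoeff, h12, narayanaPoly, Polynomial.coeff_monomial]
        intro h
        exact Or.inl (Or.inr (Nat.choose_eq_zero_of_lt (show n + 1 < a + 1 by omega)))
  · have : ¬ (m 1 = 0 ∧ m 2 = 0 ∧ 1 ≤ m 3) := fun h => h12 ⟨h.1, h.2.1⟩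
    have h' : ¬ (m 0 = 0 ∧ m 1 = 0 ∧ m 2 = 0 ∧ m 3 = 0) := fun h => h12 ⟨h.2.1, h.2.2.1⟩
    simp [h12, this, h']

theorem narayanaPow_succ (k : ℕ) :
    narayanaPow (k + 1) = narayanaPow k + MvPowerSeries.X 3 *
      (narayanaPow (k + 2) + (MvPowerSeries.X 0 - 1) * narayanaPow (k + 1)) := by
  ext m
  rw [sub_mul, one_mul]
  simp only [map_add, map_sub, coeff_X_mul_eq, coeff_narayanaPow]
  rcases h3 : m 3 with _ | n
  · rcases h0 : m 0 with _ | a <;> simp [narayanaPowCoeff]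
  · rcases h0 : m 0 with _ | a
    · by_cases h12 : m 1 = 0 ∧ m 2 = 0
      · simp [h12, h3, h0, narayanaPowCoeff_succ_zero]
        ring
      · have h12' : ¬ (m 1 = 0 ∧ m 2 = 0) := h12
        simp [h12', h0]
    · by_cases h12 : m 1 = 0 ∧ m 2 = 0
      · simp [h12, h3, h0, narayanaPowCoeff_succ_succ]
        ring
      · have h12' : ¬ (m 1 = 0 ∧ m 2 = 0) := h12
        simp [h12', h0]

/-- The recurrence and the value at `k = 0` determine the sequence. If `t ^ n` divides every `D k`,
then consecutive terms agree modulo `t ^ (n + 1)`, and `D 0 = 0` starts the induction on `k`. -/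
theorem eq_zero_of_narayana_recurrence (D : ℕ → MvPowerSeries (Fin 4) ℚ) (h0 : D 0 = 0)
    (h : ∀ k, D (k + 1) = D k + MvPowerSeries.X 3 *
      (D (k + 2) + (MvPowerSeries.X 0 - 1) * D (k + 1))) (k : ℕ) : D k = 0 := by
  refine eq_zero_of_forall_X_pow_dvd (s := 3) fun n => ?_
  induction n generalizing k with
  | zero => simp
  | succ n ih =>
    induction k with
    | zero => simp [h0]
    | succ k ihk =>
      rw [h k, pow_succ']
      exact dvd_add (pow_succ' (MvPowerSeries.X 3 : MvPowerSeries (Fin 4) ℚ) n ▸ ihk)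
        (mul_dvd_mul_left _ (dvd_add (ih _) ((ih _).mul_left _)))

/-- As sequences in `k`, both sides satisfy the same linear recurrence and agree at `k = 0`. So the
explicit coefficients really belong to powers of one series, without any convolution identity for
binomials. -/
theorem narayanaPow_add (j k : ℕ) : narayanaPow (j + k) = narayanaPow j * narayanaPow k := by
  rw [← sub_eq_zero]
  refine eq_zero_of_narayana_recurrence (fun k => narayanaPow (j + k) - narayanaPow j * narayanaPow k)
    (by simp [narayanaPow_zero]) (fun k => ?_) k
  have h1 := narayanaPow_succ (j + k)
  have h2 := narayanaPow_succ k
  simp only [← add_assoc]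
  linear_combination h1 - narayanaPow j * h2

/-- The linear recurrence at `k = 0` involves the first and second powers only; multiplicativity
turns it into the quadratic equation. -/
theorem narayanaGF_eq : narayanaGF = 1 + MvPowerSeries.X 3 * narayanaGF *
    (narayanaGF + MvPowerSeries.X 0 - 1) := by
  have h1 := narayanaPow_succ 0
  have h2 := narayanaPow_add 1 1
  simp only [zero_add, narayanaPow_zero, narayanaPow_one] at h1
  simp only [narayanaPow_one] at h2
  have h3 : narayanaPow 2 = narayanaGF * narayanaGF := h2
  rw [h3] at h1
  linear_combination h1

end CatalanFishburn

/-! ### Catalan generating trees -/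

namespace CatalanFishburn

/-- A generating tree: the objects of size `n + 1` are obtained from those of size `n`, and an
object of state `k` has one child of each of the states `1, …, k + 1`. The statistic `s₂` counts
the ancestors of state `1`. The statistic `s₁` grows by `u` if the state grows, and by `v`
otherwise; it is `1` for the objects of size one. -/
structure CatalanTree (A : ℕ → Type) (s₁ s₂ st : ∀ n, A n → ℕ) (u v : ℕ) where
  nonempty_zero : Nonempty (A 0)
  subsingleton_zero : Subsingleton (A 0)
  zero : ∀ a : A 0, s₁ 0 a = 0 ∧ s₂ 0 a = 0 ∧ st 0 a = 0
  parent : ∀ n, A (n + 1) → A n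
  st_pos : ∀ n c, 1 ≤ st (n + 1) c
  st_le : ∀ n c, st (n + 1) c ≤ st n (parent n c) + 1
  exists_child : ∀ n a j, 1 ≤ j → j ≤ st n a + 1 → ∃ c, parent n c = a ∧ st (n + 1) c = j
  child_unique : ∀ n c c', parent n c = parent n c' → st (n + 1) c = st (n + 1) c' → c = c'
  s₁_eq : ∀ n c, s₁ (n + 1) c = s₁ n (parent n c) +
    if n = 0 then 1 else if st (n + 1) c = st n (parent n c) + 1 then u else v
  s₂_eq : ∀ n c, s₂ (n + 1) c = s₂ n (parent n c) + if st (n + 1) c = 1 then 1 else 0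

namespace CatalanTree

variable {A : ℕ → Type} {s₁ s₂ st : ∀ n, A n → ℕ} {u v : ℕ}

theorem finite (h : CatalanTree A s₁ s₂ st u v) (n : ℕ) : Finite (A n) := by
  induction n with
  | zero => have := h.subsingleton_zero; infer_instance
  | succ n ih =>
    refine Finite.of_injective (β := Σ a : A n, Fin (st n a + 2))
      (fun c => ⟨h.parent n c, st (n + 1) c, Nat.lt_succ_of_le (h.st_le n c)⟩) fun c c' hc => ?_
    have h1 : h.parent n c = h.parent n c' := congrArg Sigma.fst hc
    refine h.child_unique n c c' h1 ?_
    have := congrArg (fun p : Σ a : A n, Fin (st n a + 2) => (p.2 : ℕ)) hc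
    exact this

theorem st_le_size (h : CatalanTree A s₁ s₂ st u v) (n : ℕ) (a : A n) : st n a ≤ n := by
  induction n with
  | zero => exact (h.zero a).2.2.le
  | succ n ih => exact (h.st_le n a).trans (Nat.succ_le_succ (ih _))

theorem ncard_image_parent (h : CatalanTree A s₁ s₂ st u v) {n j : ℕ} {S : Set (A (n + 1))}
    (hS : ∀ c ∈ S, st (n + 1) c = j) : (h.parent n '' S).ncard = S.ncard :=
  Set.InjOn.ncard_image fun c hc c' hc' e =>
    h.child_unique n c c' e ((hS c hc).trans (hS c' hc').symm)

/-- Children of one fixed state are counted by their parents, since a parent has at most one child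
of that state. The child grew if the parent has state `k` and did not if the parent's state is
larger. As `k + 1 ≠ 1`, the statistic `s₂` is inherited; `n ≠ 0` excludes the special first step. -/
theorem ncard_state_succ (h : CatalanTree A s₁ s₂ st u v) {n k : ℕ} (hn : n ≠ 0) (hk : 1 ≤ k)
    (i j : ℕ) :
    {c | s₁ (n + 1) c = i ∧ s₂ (n + 1) c = j ∧ st (n + 1) c = k + 1}.ncard =
      {a | s₁ n a + u = i ∧ s₂ n a = j ∧ st n a = k}.ncard +
        {a | s₁ n a + v = i ∧ s₂ n a = j ∧ k + 1 ≤ st n a}.ncard := by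
  have := h.finite n
  rw [← h.ncard_image_parent (j := k + 1) fun c hc => hc.2.2, ← Set.ncard_union_eq]
  · congr 1
    ext a
    constructor
    · rintro ⟨c, ⟨rfl, rfl, hc⟩, rfl⟩
      have h1 := h.s₁_eq n c
      have h2 := h.s₂_eq n c
      have h3 := h.st_le n c
      rw [if_neg hn, hc] at h1
      rw [if_neg (by omega)] at h2
      rcases Nat.lt_or_ge k (st n (h.parent n c)) with hlt | hge
      · rw [if_neg (by omega)] at h1
        exact Or.inr ⟨h1.symm, h2.symm, hlt⟩
      · rw [if_pos (by omega)] at h1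
        exact Or.inl ⟨h1.symm, h2.symm, by omega⟩
    · intro ha
      have hle : k + 1 ≤ st n a + 1 := by
        rcases ha with ha | ha
        · exact ha.2.2.symm.le |> Nat.succ_le_succ
        · exact ha.2.2.trans (Nat.le_succ _)
      obtain ⟨c, rfl, hc⟩ := h.exists_child n a (k + 1) (by omega) hle
      have h1 := h.s₁_eq n c
      have h2 := h.s₂_eq n c
      rw [if_neg hn, hc] at h1
      rw [if_neg (by omega)] at h2
      refine ⟨c, ⟨?_, ?_, hc⟩, rfl⟩
      · rcases ha with ⟨ha1, -, ha3⟩ | ⟨ha1, -, ha3⟩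
        · rw [h1, if_pos (by omega), ha1]
        · rw [h1, if_neg (by omega), ha1]
      · rcases ha with ⟨-, ha2, -⟩ | ⟨-, ha2, -⟩ <;> rw [h2, ← ha2, add_zero]
  · rw [Set.disjoint_left]
    rintro a ⟨-, -, ha⟩ ⟨-, -, ha'⟩
    omega

/-- For `n ≠ 0` the parent has state at least `1`, so a child of state `1` never grew: only the
increment `v` occurs. -/
theorem ncard_state_one (h : CatalanTree A s₁ s₂ st u v) {n : ℕ} (hn : n ≠ 0) (i j : ℕ) :
    {c | s₁ (n + 1) c = i ∧ s₂ (n + 1) c = j ∧ st (n + 1) c = 1}.ncard =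
      {a | s₁ n a + v = i ∧ s₂ n a + 1 = j ∧ 1 ≤ st n a}.ncard := by
  have hpos : ∀ a : A n, 1 ≤ st n a := by
    obtain ⟨k, rfl⟩ := Nat.exists_eq_succ_of_ne_zero hn
    exact h.st_pos k
  rw [← h.ncard_image_parent (j := 1) fun c hc => hc.2.2]
  congr 1
  ext a
  have ha := hpos a
  constructor
  · rintro ⟨c, ⟨rfl, rfl, hc⟩, rfl⟩
    have h1 := h.s₁_eq n c
    have h2 := h.s₂_eq n c
    rw [if_neg hn, if_neg (by omega)] at h1
    rw [if_pos hc] at h2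
    exact ⟨h1.symm, h2.symm, ha⟩
  · rintro ⟨ha1, ha2, -⟩
    obtain ⟨c, rfl, hc⟩ := h.exists_child n a 1 le_rfl (by omega)
    have h1 := h.s₁_eq n c
    have h2 := h.s₂_eq n c
    rw [if_neg hn, if_neg (by omega)] at h1
    rw [if_pos hc] at h2
    exact ⟨c, ⟨h1.trans ha1, h2.trans ha2, hc⟩, rfl⟩

theorem ncard_size_zero (h : CatalanTree A s₁ s₂ st u v) (i j k : ℕ) :
    {a | s₁ 0 a = i ∧ s₂ 0 a = j ∧ st 0 a = k}.ncard =
      if i = 0 ∧ j = 0 ∧ k = 0 then 1 else 0 := by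
  obtain ⟨a⟩ := h.nonempty_zero
  have := h.subsingleton_zero
  split_ifs with hc
  · obtain ⟨rfl, rfl, rfl⟩ := hc
    rw [Set.ncard_eq_one]
    exact ⟨a, Set.eq_singleton_iff_unique_mem.2 ⟨h.zero a, fun b _ => Subsingleton.elim _ _⟩⟩
  · rw [Set.ncard_eq_zero]
    refine Set.eq_empty_of_forall_notMem fun b hb => hc ?_
    have := h.zero b
    have := hb.1
    have := hb.2.1
    have := hb.2.2
    omega

theorem ncard_size_one (h : CatalanTree A s₁ s₂ st u v) (i j k : ℕ) :
    {a | s₁ 1 a = i ∧ s₂ 1 a = j ∧ st 1 a = k}.ncard =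
      if i = 1 ∧ j = 1 ∧ k = 1 then 1 else 0 := by
  obtain ⟨a⟩ := h.nonempty_zero
  have := h.subsingleton_zero
  have hst : ∀ c : A 1, st 1 c = 1 := fun c => by
    have h1 := h.st_pos 0 c
    have h2 := h.st_le 0 c
    rw [(h.zero (h.parent 0 c)).2.2] at h2
    exact le_antisymm h2 h1
  have hs : ∀ c : A 1, s₁ 1 c = 1 ∧ s₂ 1 c = 1 ∧ st 1 c = 1 := fun c => by
    have h1 := h.s₁_eq 0 c
    have h2 := h.s₂_eq 0 c
    have h0 := h.zero (h.parent 0 c)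
    rw [if_pos rfl, h0.1] at h1
    rw [if_pos (hst c), h0.2.1] at h2
    exact ⟨h1, h2, hst c⟩
  obtain ⟨c, -, -⟩ := h.exists_child 0 a 1 le_rfl (by omega)
  split_ifs with hc
  · obtain ⟨rfl, rfl, rfl⟩ := hc
    rw [Set.ncard_eq_one]
    exact ⟨c, Set.eq_singleton_iff_unique_mem.2 ⟨hs c, fun b _ =>
      h.child_unique 0 b c (Subsingleton.elim _ _) ((hst b).trans (hst c).symm)⟩⟩
  · have := h.finite 1
    rw [Set.ncard_eq_zero]
    refine Set.eq_empty_of_forall_notMem fun b hb => hc ?_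
    have := hs b
    have := hb.1
    have := hb.2.1
    have := hb.2.2
    omega

end CatalanTree

/-- The number of objects of size `n` whose state satisfies `P`, with given statistics. -/
noncomputable def treeCount {A : ℕ → Type} (s₁ s₂ st : ∀ n, A n → ℕ) (P : ℕ → Prop)
    (n i j : ℕ) : ℚ :=
  ({a | s₁ n a = i ∧ s₂ n a = j ∧ P (st n a)}.ncard : ℚ)

/-- The objects whose state satisfies `P`, counted by the variables `X 0`, `X o` and `X 3`; the
variable `X e` does not occur. -/
noncomputable def stateGF {A : ℕ → Type} (s₁ s₂ st : ∀ n, A n → ℕ) (o e : Fin 4) (P : ℕ → Prop) :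
    MvPowerSeries (Fin 4) ℚ :=
  fun m => if m e = 0 then treeCount s₁ s₂ st P (m 3) (m 0) (m o) else 0

section StateGF

variable {A : ℕ → Type} {s₁ s₂ st : ∀ n, A n → ℕ} {u v : ℕ} {o e : Fin 4}

theorem coeff_stateGF (P : ℕ → Prop) (m : Fin 4 →₀ ℕ) :
    MvPowerSeries.coeff m (stateGF s₁ s₂ st o e P) =
      if m e = 0 then treeCount s₁ s₂ st P (m 3) (m 0) (m o) else 0 := rfl

theorem treeCount_eq_zero {P : ℕ → Prop} {n i j : ℕ} (h : ∀ a, ¬ P (st n a)) :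
    treeCount s₁ s₂ st P n i j = 0 := by
  have : {a | s₁ n a = i ∧ s₂ n a = j ∧ P (st n a)} = ∅ :=
    Set.eq_empty_of_forall_notMem fun a ha => h a ha.2.2
  rw [treeCount, this, Set.ncard_empty, Nat.cast_zero]

theorem ncard_add_eq_sub {α : Type*} (f : α → ℕ) (P : α → Prop) (w i : ℕ) :
    ({a | f a + w = i ∧ P a}.ncard : ℚ) =
      if w ≤ i then ({a | f a = i - w ∧ P a}.ncard : ℚ) else 0 := by
  split_ifs with hw
  · congr 2
    ext a
    have : f a + w = i ↔ f a = i - w := by omega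
    simp [this]
  · rw [Nat.cast_eq_zero]
    have : {a | f a + w = i ∧ P a} = ∅ := by
      ext a
      simp
      omega
    rw [this, Set.ncard_empty]

theorem treeCount_state_succ (h : CatalanTree A s₁ s₂ st u v) {n k : ℕ} (hn : n ≠ 0)
    (hk : 1 ≤ k) (i j : ℕ) :
    treeCount s₁ s₂ st (· = k + 1) (n + 1) i j =
      (if u ≤ i then treeCount s₁ s₂ st (· = k) n (i - u) j else 0) +
        if v ≤ i then treeCount s₁ s₂ st (k + 1 ≤ ·) n (i - v) j else 0 := by
  simp only [treeCount]
  rw [h.ncard_state_succ hn hk, Nat.cast_add,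
    ncard_add_eq_sub (s₁ n) (fun a => s₂ n a = j ∧ st n a = k),
    ncard_add_eq_sub (s₁ n) (fun a => s₂ n a = j ∧ k + 1 ≤ st n a)]

theorem treeCount_state_one (h : CatalanTree A s₁ s₂ st u v) {n : ℕ} (hn : n ≠ 0) (i j : ℕ) :
    treeCount s₁ s₂ st (· = 1) (n + 1) i j =
      if 1 ≤ j then (if v ≤ i then treeCount s₁ s₂ st (1 ≤ ·) n (i - v) (j - 1) else 0)
      else 0 := by
  simp only [treeCount]
  rw [h.ncard_state_one hn,
    ncard_add_eq_sub (s₁ n) (fun a => s₂ n a + 1 = j ∧ 1 ≤ st n a)]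
  have := ncard_add_eq_sub (s₂ n) (fun a => s₁ n a = i - v ∧ 1 ≤ st n a) 1 j
  simp only [and_left_comm (a := s₂ n _ + 1 = j),
    and_left_comm (a := s₂ n _ = j - 1)] at this
  rw [this]
  split_ifs <;> rfl

theorem stateGF_ge_eq (h : CatalanTree A s₁ s₂ st u v) (k : ℕ) :
    stateGF s₁ s₂ st o e (k ≤ ·) =
      stateGF s₁ s₂ st o e (· = k) + stateGF s₁ s₂ st o e (k + 1 ≤ ·) := by
  ext m
  have := h.finite (m 3)
  rw [map_add, coeff_stateGF, coeff_stateGF, coeff_stateGF]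
  split_ifs
  · simp only [treeCount]
    rw [← Nat.cast_add, ← Set.ncard_union_eq]
    · congr 2
      ext a
      have : k ≤ st (m 3) a ↔ st (m 3) a = k ∨ k + 1 ≤ st (m 3) a := by omega
      simp only [Set.mem_ofPred_eq, Set.mem_union, this]
      tauto
    · rw [Set.disjoint_left]
      rintro a ⟨-, -, ha⟩ ⟨-, -, ha'⟩
      omega
  · simp

/-- The state never exceeds the size. This smallness in `t` replaces a convergence argument when
tails are summed. -/
theorem X_pow_dvd_stateGF_ge (h : CatalanTree A s₁ s₂ st u v) (k : ℕ) :
    MvPowerSeries.X 3 ^ k ∣ stateGF s₁ s₂ st o e (k ≤ ·) := by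
  rw [MvPowerSeries.X_pow_dvd_iff]
  intro m hm
  rw [coeff_stateGF, treeCount_eq_zero, ite_self]
  intro a ha
  have := h.st_le_size (m 3) a
  omega

theorem stateGF_eq_zero (h : CatalanTree A s₁ s₂ st u v)
    (hoe : (o = 1 ∧ e = 2) ∨ (o = 2 ∧ e = 1)) : stateGF s₁ s₂ st o e (· = 0) = 1 := by
  classical
  ext m
  rw [coeff_stateGF, MvPowerSeries.coeff_one]
  simp only [finsupp_fin_four_eq_zero_iff]
  rcases h3 : m 3 with _ | n
  · rw [treeCount, h.ncard_size_zero]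
    rcases hoe with ⟨rfl, rfl⟩ | ⟨rfl, rfl⟩ <;> split_ifs <;> simp_all
  · rw [treeCount_eq_zero]
    · simp
    · intro a
      have := h.st_pos n a
      omega

/-- The isolated summand `X 0` is the object of size one, whose `s₁` is `1` whatever `u` and `v`
are; the other summand collects the objects with a nonempty parent. -/
theorem stateGF_eq_one (h : CatalanTree A s₁ s₂ st u v)
    (hoe : (o = 1 ∧ e = 2) ∨ (o = 2 ∧ e = 1)) :
    stateGF s₁ s₂ st o e (· = 1) = MvPowerSeries.X o * (MvPowerSeries.X 3 *
      (MvPowerSeries.X 0 + MvPowerSeries.X 0 ^ v * stateGF s₁ s₂ st o e (1 ≤ ·))) := by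
  classical
  have ho0 : o ≠ 0 := by rcases hoe with ⟨rfl, rfl⟩ | ⟨rfl, rfl⟩ <;> decide
  have ho3 : o ≠ 3 := by rcases hoe with ⟨rfl, rfl⟩ | ⟨rfl, rfl⟩ <;> decide
  have he0 : e ≠ 0 := by rcases hoe with ⟨rfl, rfl⟩ | ⟨rfl, rfl⟩ <;> decide
  have he3 : e ≠ 3 := by rcases hoe with ⟨rfl, rfl⟩ | ⟨rfl, rfl⟩ <;> decide
  have heo : e ≠ o := by rcases hoe with ⟨rfl, rfl⟩ | ⟨rfl, rfl⟩ <;> decide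
  have hX : ∀ m, MvPowerSeries.coeff m (MvPowerSeries.X 0 : MvPowerSeries (Fin 4) ℚ) =
      if m 0 = 1 ∧ m o = 0 ∧ m e = 0 ∧ m 3 = 0 then 1 else 0 := fun m => by
    rw [MvPowerSeries.coeff_X]
    congr 1
    rw [eq_iff_iff]
    constructor
    · rintro rfl
      simp [ho0, he0]
    · rintro ⟨h0, h1, h2, h3⟩
      ext i
      rcases hoe with ⟨rfl, rfl⟩ | ⟨rfl, rfl⟩ <;> fin_cases i <;> simp_all
  ext m
  rw [coeff_X_mul_eq, coeff_X_mul_eq, map_add, coeff_X_pow_mul_eq, coeff_stateGF,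
    coeff_stateGF, hX]
  rcases h3 : m 3 with _ | _ | n
  · rw [treeCount, h.ncard_size_zero]
    simp [ho3, h3]
  · rw [treeCount, h.ncard_size_one]
    have : ∀ i j, treeCount s₁ s₂ st (1 ≤ ·) 0 i j = 0 := fun i j => by
      refine treeCount_eq_zero fun a ha => ?_
      have := (h.zero a).2.2
      omega
    by_cases he : m e = 0 <;> by_cases h0 : m 0 = 1 <;> rcases hmo : m o with _ | _ | l <;>
      simp [*, ho0.symm, ho3.symm]
  · rw [treeCount_state_one h (Nat.succ_ne_zero n)]
    by_cases he : m e = 0 <;> by_cases h0 : v ≤ m 0 <;> by_cases hmo : 1 ≤ m o <;>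
      simp [*, ho0.symm, ho3.symm]

theorem stateGF_eq_succ (h : CatalanTree A s₁ s₂ st u v)
    (hoe : (o = 1 ∧ e = 2) ∨ (o = 2 ∧ e = 1)) {k : ℕ} (hk : 1 ≤ k) :
    stateGF s₁ s₂ st o e (· = k + 1) = MvPowerSeries.X 3 *
      (MvPowerSeries.X 0 ^ u * stateGF s₁ s₂ st o e (· = k) +
        MvPowerSeries.X 0 ^ v * stateGF s₁ s₂ st o e (k + 1 ≤ ·)) := by
  classical
  have ho0 : o ≠ 0 := by rcases hoe with ⟨rfl, rfl⟩ | ⟨rfl, rfl⟩ <;> decide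
  have ho3 : o ≠ 3 := by rcases hoe with ⟨rfl, rfl⟩ | ⟨rfl, rfl⟩ <;> decide
  have he0 : e ≠ 0 := by rcases hoe with ⟨rfl, rfl⟩ | ⟨rfl, rfl⟩ <;> decide
  have he3 : e ≠ 3 := by rcases hoe with ⟨rfl, rfl⟩ | ⟨rfl, rfl⟩ <;> decide
  ext m
  rw [coeff_X_mul_eq, map_add, coeff_X_pow_mul_eq, coeff_X_pow_mul_eq, coeff_stateGF,
    coeff_stateGF, coeff_stateGF]
  rcases h3 : m 3 with _ | _ | n
  · rw [treeCount, h.ncard_size_zero]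
    simp
  · rw [treeCount, h.ncard_size_one]
    have h1 : ∀ i j, treeCount s₁ s₂ st (k + 1 ≤ ·) 0 i j = 0 := fun i j => by
      refine treeCount_eq_zero fun a ha => ?_
      have := (h.zero a).2.2
      omega
    have h2 : ∀ i j, treeCount s₁ s₂ st (· = k) 0 i j = 0 := fun i j => by
      refine treeCount_eq_zero fun a ha => ?_
      have := (h.zero a).2.2
      omega
    have hk0 : k ≠ 0 := by omega
    simp only [Nat.add_one_le_iff] at h1
    simp [h1, h2, hk0, h3]
  · rw [treeCount_state_succ h (Nat.succ_ne_zero n) hk]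
    by_cases he : m e = 0 <;> simp [he, h3, ho0.symm, ho3.symm, he0.symm, he3.symm]

/-- The series in the two variables `X 0` and `X 3` determine the generating function. -/
theorem stateGF_closed_form (h : CatalanTree A s₁ s₂ st u v)
    (hoe : (o = 1 ∧ e = 2) ∨ (o = 2 ∧ e = 1)) {q V B W : MvPowerSeries (Fin 4) ℚ}
    (hdvd : MvPowerSeries.X 3 ∣ q) (hW : W * (1 - q) = 1) (hV : V = MvPowerSeries.X 0 ^ v * W)
    (hq : q = MvPowerSeries.X 3 * (MvPowerSeries.X 0 ^ u + q * V))
    (hB : B = MvPowerSeries.X o * (MvPowerSeries.X 3 * (MvPowerSeries.X 0 + B * V))) (k : ℕ) :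
    stateGF s₁ s₂ st o e (· = k + 1) = B * q ^ k := by
  set G : ℕ → MvPowerSeries (Fin 4) ℚ := fun k => stateGF s₁ s₂ st o e (· = k) with hG
  set T : ℕ → MvPowerSeries (Fin 4) ℚ := fun k => stateGF s₁ s₂ st o e (k ≤ ·) with hT
  have hGT : ∀ k, T k = G k + T (k + 1) := stateGF_ge_eq h
  have hG1 : G 1 = MvPowerSeries.X o * (MvPowerSeries.X 3 *
      (MvPowerSeries.X 0 + MvPowerSeries.X 0 ^ v * T 1)) := stateGF_eq_one h hoe
  have hG2 : ∀ k, G (k + 2) = MvPowerSeries.X 3 *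
      (MvPowerSeries.X 0 ^ u * G (k + 1) + MvPowerSeries.X 0 ^ v * T (k + 2)) :=
    fun k => stateGF_eq_succ h hoe (Nat.succ_le_succ (Nat.zero_le k))
  -- The equations for the proposed solution are subtracted from those of the tree. What remains are
  -- homogeneous linear relations between the errors of `G (k + 1)` against `B * q ^ k` and of the
  -- tails `T (k + 1)` against `B * q ^ k * W`.
  have hgt : ∀ k, T (k + 1) - B * q ^ k * W =
      (G (k + 1) - B * q ^ k) + (T (k + 2) - B * q ^ (k + 1) * W) := fun k => by
    rw [pow_succ]
    linear_combination hGT (k + 1) - B * q ^ k * hW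
  have hg0 : G 1 - B * q ^ 0 = MvPowerSeries.X 3 *
      (MvPowerSeries.X o * MvPowerSeries.X 0 ^ v * (T 1 - B * q ^ 0 * W)) := by
    rw [hV] at hB
    linear_combination hG1 - hB
  have hg : ∀ k, G (k + 2) - B * q ^ (k + 1) = MvPowerSeries.X 3 *
      (MvPowerSeries.X 0 ^ u * (G (k + 1) - B * q ^ k) +
        MvPowerSeries.X 0 ^ v * (T (k + 2) - B * q ^ (k + 1) * W)) := fun k => by
    rw [hV] at hq
    rw [pow_succ]
    linear_combination hG2 k - B * q ^ k * hq
  have hdT : ∀ k, MvPowerSeries.X 3 ^ k ∣ T (k + 1) - B * q ^ k * W := fun k =>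
    dvd_sub ((pow_dvd_pow _ (Nat.le_succ k)).trans (X_pow_dvd_stateGF_ge h (k + 1)))
      (((pow_dvd_pow_of_dvd hdvd k).mul_left B).mul_right W)
  -- Induction on the power of `t`. If `t ^ N` divides all tail errors, it divides their
  -- differences, the errors of `G`. The factor `t` in the recurrences improves the latter to `t ^
  -- (N + 1)`. Descending from a tail so far out that `hdT` applies, this carries over to every
  -- tail.
  have key : ∀ N k, MvPowerSeries.X 3 ^ N ∣ T (k + 1) - B * q ^ k * W := by
    intro N
    induction N with
    | zero => simp
    | succ N ih =>
      have ihg : ∀ k, MvPowerSeries.X 3 ^ N ∣ G (k + 1) - B * q ^ k := fun k => by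
        rw [← sub_eq_of_eq_add (hgt k)]
        exact dvd_sub (ih k) (ih (k + 1))
      have hgs : ∀ k, MvPowerSeries.X 3 ^ (N + 1) ∣ G (k + 1) - B * q ^ k := fun k => by
        rcases k with _ | k
        · rw [hg0, pow_succ']
          exact mul_dvd_mul_left _ ((ih 0).mul_left _)
        · rw [hg k, pow_succ']
          exact mul_dvd_mul_left _ (dvd_add ((ihg k).mul_left _) ((ih (k + 1)).mul_left _))
      have hdown : ∀ M k, MvPowerSeries.X 3 ^ (N + 1) ∣ T (k + M + 1) - B * q ^ (k + M) * W →
          MvPowerSeries.X 3 ^ (N + 1) ∣ T (k + 1) - B * q ^ k * W := by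
        intro M
        induction M with
        | zero => exact fun k hk => hk
        | succ M ihM =>
          intro k hk
          refine ihM k ?_
          rw [hgt (k + M)]
          exact dvd_add (hgs _) hk
      exact fun k => hdown (N + 1) k
        ((pow_dvd_pow _ (by omega)).trans (hdT (k + (N + 1))))
  rw [← sub_eq_zero]
  refine eq_zero_of_forall_X_pow_dvd (s := 3) fun N => ?_
  have := hgt k
  change _ ∣ G (k + 1) - B * q ^ k
  rw [← sub_eq_of_eq_add this]
  exact dvd_sub (key N k) (key N (k + 1))

/-- The generating function of a Catalan tree. -/
theorem treeGF_eq (h : CatalanTree A s₁ s₂ st u v)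
    (hoe : (o = 1 ∧ e = 2) ∨ (o = 2 ∧ e = 1)) {q V B W Z F : MvPowerSeries (Fin 4) ℚ}
    (hdvd : MvPowerSeries.X 3 ∣ q) (hW : W * (1 - q) = 1) (hV : V = MvPowerSeries.X 0 ^ v * W)
    (hq : q = MvPowerSeries.X 3 * (MvPowerSeries.X 0 ^ u + q * V))
    (hB : B = MvPowerSeries.X o * (MvPowerSeries.X 3 * (MvPowerSeries.X 0 + B * V)))
    (hZ : Z * (1 - MvPowerSeries.X e * q) = 1)
    (hF : ∀ m, MvPowerSeries.coeff m F = treeCount s₁ s₂ st (· = m e) (m 3) (m 0) (m o)) :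
    F = 1 + MvPowerSeries.X e * B * Z := by
  have ho0 : o ≠ 0 := by rcases hoe with ⟨rfl, rfl⟩ | ⟨rfl, rfl⟩ <;> decide
  have ho3 : o ≠ 3 := by rcases hoe with ⟨rfl, rfl⟩ | ⟨rfl, rfl⟩ <;> decide
  have he0 : e ≠ 0 := by rcases hoe with ⟨rfl, rfl⟩ | ⟨rfl, rfl⟩ <;> decide
  have he3 : e ≠ 3 := by rcases hoe with ⟨rfl, rfl⟩ | ⟨rfl, rfl⟩ <;> decide
  have heo : e ≠ o := by rcases hoe with ⟨rfl, rfl⟩ | ⟨rfl, rfl⟩ <;> decide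
  ext m
  -- The series of a state does not involve `X e`, so only the term with `k = m e` contributes to
  -- the coefficient at `m`.
  have h1 : MvPowerSeries.coeff m F = MvPowerSeries.coeff m (∑ k ∈ Finset.range (m e + 2),
      MvPowerSeries.X e ^ k * stateGF s₁ s₂ st o e (· = k)) := by
    rw [map_sum, Finset.sum_eq_single_of_mem (m e) (by simp), hF, coeff_X_pow_mul_eq,
      coeff_stateGF]
    · simp [he0, he3, heo]
    · intro k _ hk
      rw [coeff_X_pow_mul_eq, coeff_stateGF]
      split_ifs with h1 h2
      · simp at h2
        omega
      · rfl
      · rfl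
  -- The partial sums of the geometric series carry an explicit remainder divisible by `X e ^ (K +
  -- 1)`, which is invisible at `m` once `K ≥ m e`.
  have h2 : ∀ K, ∑ k ∈ Finset.range (K + 1), MvPowerSeries.X e ^ k *
      stateGF s₁ s₂ st o e (· = k) =
      1 + MvPowerSeries.X e * B * Z - MvPowerSeries.X e ^ (K + 1) * (q ^ K * B * Z) := by
    intro K
    induction K with
    | zero =>
      rw [Finset.sum_range_one, pow_zero, one_mul, stateGF_eq_zero h hoe]
      ring
    | succ K ih =>
      rw [Finset.sum_range_succ, ih, stateGF_closed_form h hoe hdvd hW hV hq hB]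
      simp only [pow_succ]
      linear_combination -MvPowerSeries.X e ^ K * MvPowerSeries.X e * q ^ K * B * hZ
  rw [h1, h2, map_sub, coeff_X_pow_mul_eq, if_neg (by omega), sub_zero]

/-- A rearrangement of the quadratic equation: it says that `x / (1 - tN) = N + x - 1`, which links
the kernels of the two kinds of trees. -/
theorem X_zero_eq_narayana : (MvPowerSeries.X 0 : MvPowerSeries (Fin 4) ℚ) =
    (narayanaGF + MvPowerSeries.X 0 - 1) * (1 - MvPowerSeries.X 3 * narayanaGF) := by
  linear_combination -narayanaGF_eq

theorem inv_mul_one_sub_cancel (f : MvPowerSeries (Fin 4) ℚ)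
    (hf : MvPowerSeries.constantCoeff f = 0) : (1 - f)⁻¹ * (1 - f) = 1 :=
  MvPowerSeries.inv_mul_cancel _ (by simp [hf])

end StateGF

/-- The right-hand side of the theorem. -/
noncomputable def catalanGF : MvPowerSeries (Fin 4) ℚ :=
  1 + MvPowerSeries.X 0 * MvPowerSeries.X 1 * MvPowerSeries.X 2 * MvPowerSeries.X 3 *
    ((1 - MvPowerSeries.X 1 * MvPowerSeries.X 3 * narayanaGF) *
      (1 - MvPowerSeries.X 2 * MvPowerSeries.X 3 *
        (narayanaGF + MvPowerSeries.X 0 - 1)))⁻¹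

/-- Here `u = 1`, `v = 0`, the state is marked by `z`, and `q = t(N + x - 1)`. The quadratic
equation says `N(1 - q) = 1`, hence `V = W = N` and `B = xyt / (1 - ytN)`. -/
theorem genFun_eq_catalanGF_of_tree_two {A : ℕ → Type} {s₁ s₂ s₃ : ∀ n, A n → ℕ}
    (h : CatalanTree A s₁ s₂ s₃ 1 0) :
    genFun A (fun {n} => s₁ n) (fun {n} => s₂ n) (fun {n} => s₃ n) = catalanGF := by
  have hX := X_zero_eq_narayana
  have hN := narayanaGF_eq
  have h1 := inv_mul_one_sub_cancel (MvPowerSeries.X 1 * MvPowerSeries.X 3 * narayanaGF)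
    (by simp)
  have h2 := inv_mul_one_sub_cancel (MvPowerSeries.X 2 * MvPowerSeries.X 3 *
    (narayanaGF + MvPowerSeries.X 0 - 1)) (by simp)
  set Y := (1 - MvPowerSeries.X 1 * MvPowerSeries.X 3 * narayanaGF)⁻¹
  refine (treeGF_eq (o := 1) (e := 2) (q := MvPowerSeries.X 3 * (narayanaGF + MvPowerSeries.X 0 - 1))
    (V := narayanaGF) (W := narayanaGF) (B := MvPowerSeries.X 0 * MvPowerSeries.X 1 *
      MvPowerSeries.X 3 * Y) (Z := (1 - MvPowerSeries.X 2 * MvPowerSeries.X 3 *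
    (narayanaGF + MvPowerSeries.X 0 - 1))⁻¹) h (Or.inl ⟨rfl, rfl⟩) (dvd_mul_right _ _)
      ?_ ?_ ?_ ?_ ?_ ?_).trans ?_
  · linear_combination hN
  · ring
  · linear_combination MvPowerSeries.X 3 * hN
  · linear_combination MvPowerSeries.X 0 * MvPowerSeries.X 1 * MvPowerSeries.X 3 * h1
  · rw [← mul_assoc]
    exact h2
  · intro m
    rw [treeCount]
    rfl
  · rw [catalanGF, MvPowerSeries.mul_inv_rev]
    ring

/-- Here `u = 0`, `v = 1`, the state is marked by `y`, and `q = tN`, so `V = x / (1 - tN) = N + x -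
1` and `B = xzt / (1 - zt(N + x - 1))`. The two factors of the final denominator arise in the
opposite order from the other tree. -/
theorem genFun_eq_catalanGF_of_tree_one {A : ℕ → Type} {s₁ s₂ s₃ : ∀ n, A n → ℕ}
    (h : CatalanTree A s₁ s₃ s₂ 0 1) :
    genFun A (fun {n} => s₁ n) (fun {n} => s₂ n) (fun {n} => s₃ n) = catalanGF := by
  have hX := X_zero_eq_narayana
  have hN := narayanaGF_eq
  have h0 := inv_mul_one_sub_cancel (MvPowerSeries.X 3 * narayanaGF) (by simp)
  have h1 := inv_mul_one_sub_cancel (MvPowerSeries.X 1 * (MvPowerSeries.X 3 * narayanaGF))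
    (by simp)
  have h2 := inv_mul_one_sub_cancel (MvPowerSeries.X 2 * MvPowerSeries.X 3 *
    (narayanaGF + MvPowerSeries.X 0 - 1)) (by simp)
  set Y := (1 - MvPowerSeries.X 2 * MvPowerSeries.X 3 *
    (narayanaGF + MvPowerSeries.X 0 - 1))⁻¹
  set W := (1 - MvPowerSeries.X 3 * narayanaGF)⁻¹
  refine (treeGF_eq (o := 2) (e := 1) (q := MvPowerSeries.X 3 * narayanaGF)
    (V := narayanaGF + MvPowerSeries.X 0 - 1) (W := W) (B := MvPowerSeries.X 0 * MvPowerSeries.X 2 *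
      MvPowerSeries.X 3 * Y) (Z := (1 - MvPowerSeries.X 1 * (MvPowerSeries.X 3 * narayanaGF))⁻¹)
      h (Or.inr ⟨rfl, rfl⟩) (dvd_mul_right _ _)
      ?_ ?_ ?_ ?_ ?_ ?_).trans ?_
  · exact h0
  · linear_combination (-(narayanaGF + MvPowerSeries.X 0 - 1)) * h0 - W * hX
  · linear_combination MvPowerSeries.X 3 * hN
  · linear_combination MvPowerSeries.X 0 * MvPowerSeries.X 2 * MvPowerSeries.X 3 * h2
  · exact h1
  · intro m
    rw [treeCount]
    change (Nat.card {a : A (m 3) // s₁ (m 3) a = m 0 ∧ s₂ (m 3) a = m 1 ∧ s₃ (m 3) a = m 2} : ℚ) =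
      (Nat.card {a : A (m 3) // s₁ (m 3) a = m 0 ∧ s₃ (m 3) a = m 2 ∧ s₂ (m 3) a = m 1} : ℚ)
    congr 1
    exact Nat.card_congr (Equiv.subtypeEquivRight fun a => by tauto)
  · rw [catalanGF, MvPowerSeries.mul_inv_rev, mul_assoc (MvPowerSeries.X 1)]
    simp only [Y]
    ring_nf

/-- Modulo `hX`, the last factor on the right is `2(1 - tN)(1 - zt(N + x - 1))` and the first factor
on the left is `2(1 - tN)(1 - y + yt(N + x - 1))`. Moreover `(1 - y + yt(N + x - 1))(1 - ytN)`
reduces to `1 + y(xt + yt - t - 1)`. Clearing denominators avoids dividing by the common factor. -/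
theorem narayana_cross_multiplication {K : Type*} [CommRing K] {x y z t N : K}
    (hX : x = (N + x - 1) * (1 - t * N)) :
    (1 - y + t * (x + y + x * y - 1) + (1 - y) * (1 + t * (1 - x) - 2 * t * N)) *
        ((1 - y * t * N) * (1 - z * t * (N + x - 1))) =
      (1 + y * (x * t + y * t - t - 1)) *
        (1 + t * (x - 2 * x * z - 1) + (1 + t * (1 - x) - 2 * t * N)) := by
  linear_combination 2 * (-y * (y - 1) * t * (1 - z * t * (N + x - 1)) +
    (1 + y * (x * t + y * t - t - 1)) * t * z) * hX

/-- The algebraic form of the right-hand side. -/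
theorem exists_sqrt_catalanGF :
    let x : MvPowerSeries (Fin 4) ℚ := MvPowerSeries.X 0
    let y : MvPowerSeries (Fin 4) ℚ := MvPowerSeries.X 1
    let z : MvPowerSeries (Fin 4) ℚ := MvPowerSeries.X 2
    let t : MvPowerSeries (Fin 4) ℚ := MvPowerSeries.X 3
    ∃ R : MvPowerSeries (Fin 4) ℚ, MvPowerSeries.constantCoeff R = 1 ∧
      R ^ 2 = 1 + t ^ 2 * (1 - x) ^ 2 - 2 * t * (1 + x) ∧
      catalanGF = 1 + x * y * z * t * (1 - y + t * (x + y + x * y - 1) + (1 - y) * R) *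
        ((1 + y * (x * t + y * t - t - 1)) * (1 + t * (x - 2 * x * z - 1) + R))⁻¹ := by
  intro x y z t
  have hN : narayanaGF = 1 + t * narayanaGF * (narayanaGF + x - 1) := narayanaGF_eq
  -- The quadratic formula for `tN² - (1 + t(1 - x))N + 1 = 0`, solved for the root of the
  -- discriminant.
  refine ⟨1 + t * (1 - x) - 2 * t * narayanaGF, by simp [t], ?_, ?_⟩
  · clear_value x t
    linear_combination (-4 * t) * hN
  · have hX : x = (narayanaGF + x - 1) * (1 - t * narayanaGF) := X_zero_eq_narayana
    have hc1 : MvPowerSeries.constantCoeff ((1 - y * t * narayanaGF) *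
        (1 - z * t * (narayanaGF + x - 1))) ≠ 0 := by simp [y, z]
    have hc2 : MvPowerSeries.constantCoeff ((1 + y * (x * t + y * t - t - 1)) *
        (1 + t * (x - 2 * x * z - 1) + (1 + t * (1 - x) - 2 * t * narayanaGF))) ≠ 0 := by
      simp [y, t]
    change 1 + x * y * z * t * ((1 - y * t * narayanaGF) *
        (1 - z * t * (narayanaGF + x - 1)))⁻¹ = _
    clear_value x y z t
    rw [mul_assoc (x * y * z * t)]
    congr 2
    rw [eq_comm, MvPowerSeries.eq_inv_iff_mul_eq_one hc1, mul_right_comm,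
      narayana_cross_multiplication hX, MvPowerSeries.mul_inv_cancel _ hc2]

end CatalanFishburn

/-! ### Staircase sequences -/

namespace CatalanFishburn

/-- The weakly increasing sequences `d` with `d i ≤ i`. -/
structure IsStaircase {n : ℕ} (d : Fin n → ℕ) : Prop where
  mono : Monotone d
  le : ∀ i, d i ≤ i

/-- The staircase sequences of length `n`. -/
abbrev Staircase (n : ℕ) : Type := {d : Fin n → ℕ // IsStaircase d}

/-- The number of distinct letters. -/
noncomputable def seqDistinct {n : ℕ} (d : Fin n → ℕ) : ℕ := (Set.range d).ncard

/-- The number of zeros. -/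
noncomputable def seqZeros {n : ℕ} (d : Fin n → ℕ) : ℕ := {i | d i = 0}.ncard

/-- The number of fixed points. -/
noncomputable def seqFixed {n : ℕ} (d : Fin n → ℕ) : ℕ := {i : Fin n | d i = i}.ncard

theorem ncard_setOf_lt {n k : ℕ} (hk : k ≤ n) : {i : Fin n | (i : ℕ) < k}.ncard = k := by
  rw [← Set.InjOn.ncard_image (f := fun i : Fin n => (i : ℕ))
    (fun i _ j _ h => Fin.ext h)]
  have : (fun i : Fin n => (i : ℕ)) '' {i | (i : ℕ) < k} = ↑(Finset.range k) := by
    ext j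
    simp only [Set.mem_image, Set.mem_ofPred_eq, Finset.coe_range, Set.mem_Iio]
    exact ⟨fun ⟨i, hi, h⟩ => h ▸ hi, fun h => ⟨⟨j, by omega⟩, h, rfl⟩⟩
  rw [this, Set.ncard_coe_finset, Finset.card_range]

/-- A lower set of `Fin n` is an initial segment, so its size decides membership. This is how counts
are turned into inequalities later on. -/
theorem mem_iff_lt_ncard {n : ℕ} {S : Set (Fin n)} (hS : IsLowerSet S) (i : Fin n) :
    i ∈ S ↔ (i : ℕ) < S.ncard := by
  constructor
  · intro hi
    have : {j : Fin n | (j : ℕ) < i + 1} ⊆ S := fun j hj =>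
      hS (Fin.le_def.2 (Nat.lt_succ_iff.1 hj)) hi
    have h1 := Set.ncard_le_ncard this
    rwa [ncard_setOf_lt i.2] at h1
  · intro hi
    by_contra hne
    have : S ⊆ {j : Fin n | (j : ℕ) < i} := fun j hj => by
      by_contra hji
      exact hne (hS (Fin.le_def.2 (not_lt.1 hji)) hj)
    have h1 := Set.ncard_le_ncard this
    rw [ncard_setOf_lt i.2.le] at h1
    exact absurd hi (not_lt.2 h1)

theorem IsStaircase.eq_zero_iff {n : ℕ} {d : Fin n → ℕ} (h : IsStaircase d) (i : Fin n) :
    d i = 0 ↔ (i : ℕ) < seqZeros d :=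
  mem_iff_lt_ncard (S := {i | d i = 0}) (fun j k (hkj : k ≤ j) (hj : d j = 0) =>
    Nat.eq_zero_of_le_zero (hj ▸ h.mono hkj)) i

theorem IsStaircase.zero_eq {n : ℕ} {d : Fin (n + 1) → ℕ} (h : IsStaircase d) : d 0 = 0 :=
  Nat.eq_zero_of_le_zero (h.le 0)

theorem IsStaircase.seqZeros_pos {n : ℕ} {d : Fin (n + 1) → ℕ} (h : IsStaircase d) :
    1 ≤ seqZeros d :=
  (h.eq_zero_iff 0).1 h.zero_eq

theorem seqZeros_le {n : ℕ} (d : Fin n → ℕ) : seqZeros d ≤ n := by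
  have := Set.ncard_le_ncard (Set.subset_univ {i | d i = 0})
  rwa [Set.ncard_univ, Nat.card_fin] at this

/-- Remove the first letter and decrease the other ones. -/
def Staircase.parent {n : ℕ} (d : Staircase (n + 1)) : Staircase n :=
  ⟨fun i => d.1 i.succ - 1,
    ⟨fun i j hij => Nat.sub_le_sub_right (d.2.mono (Fin.succ_le_succ_iff.2 hij)) 1,
      fun i => by have := d.2.le i.succ; rw [Fin.val_succ] at this; omega⟩⟩

theorem Staircase.parent_apply {n : ℕ} (d : Staircase (n + 1)) (i : Fin n) :
    d.parent.1 i = d.1 i.succ - 1 := rfl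

/-- A staircase sequence is recovered from its parent and its number of zeros; this makes the number
of zeros a valid state. -/
theorem Staircase.succ_eq {n : ℕ} (d : Staircase (n + 1)) (i : Fin n) :
    d.1 i.succ = if (i : ℕ) + 1 < seqZeros d.1 then 0 else d.parent.1 i + 1 := by
  have := d.2.eq_zero_iff i.succ
  rw [Fin.val_succ] at this
  split_ifs with h
  · exact this.2 h
  · rw [Staircase.parent_apply]
    have : d.1 i.succ ≠ 0 := fun h0 => h (this.1 h0)
    omega

theorem seqZeros_eq {n : ℕ} {d : Fin n → ℕ} {k : ℕ} (hk : k ≤ n)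
    (h : ∀ i, d i = 0 ↔ (i : ℕ) < k) : seqZeros d = k := by
  rw [seqZeros, ← ncard_setOf_lt hk]
  congr 1
  ext i
  exact h i

theorem Staircase.seqZeros_le_parent {n : ℕ} (d : Staircase (n + 1)) :
    seqZeros d.1 ≤ seqZeros d.parent.1 + 1 := by
  by_contra! hlt
  have hle := seqZeros_le d.1
  have h1 := (d.parent.2.eq_zero_iff ⟨seqZeros d.parent.1, by omega⟩).1 (by
    rw [Staircase.parent_apply, (d.2.eq_zero_iff _).2]
    simpa using hlt)
  exact lt_irrefl _ h1

/-- Add a letter to the front and increase the letters from position `j` on. -/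
def Staircase.child {n : ℕ} (d : Staircase n) (j : ℕ) (_ : j ≤ seqZeros d.1) :
    Staircase (n + 1) :=
  ⟨Fin.cons 0 fun i => if (i : ℕ) < j then 0 else d.1 i + 1, by
    constructor
    · intro a b
      refine Fin.cases (fun _ => Nat.zero_le _) (fun a => ?_) a
      refine Fin.cases (fun h => ?_) (fun b h => ?_) b
      · exact absurd h (by simp)
      · have h := Fin.succ_le_succ_iff.1 h
        have hd := d.2.mono h
        rw [Fin.le_def] at h
        simp only [Fin.cons_succ]
        split_ifs <;> omega
    · refine Fin.cases (Nat.zero_le _) fun i => ?_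
      have := d.2.le i
      simp only [Fin.cons_succ, Fin.val_succ]
      split_ifs <;> omega⟩

theorem Staircase.seqZeros_child {n : ℕ} (d : Staircase n) (j : ℕ) (hj : j ≤ seqZeros d.1) :
    seqZeros (d.child j hj).1 = j + 1 := by
  refine seqZeros_eq (by have := seqZeros_le d.1; omega) ?_
  refine Fin.cases (by simp [Staircase.child]) fun i => ?_
  simp [Staircase.child]

theorem Staircase.parent_child {n : ℕ} (d : Staircase n) (j : ℕ) (hj : j ≤ seqZeros d.1) :
    (d.child j hj).parent = d := by
  refine Subtype.ext (funext fun i => ?_)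
  have := d.2.eq_zero_iff i
  rw [Staircase.parent_apply]
  simp only [Staircase.child, Fin.cons_succ]
  split_ifs <;> omega

/-- Besides the fixed point `0`, the fixed points are the shifts of those of the parent that are not
overwritten by zeros. If there is a further zero, exactly the parent's fixed point `0` is lost: its
other fixed points carry nonzero letters, and these lie beyond the overwritten positions. -/
theorem Staircase.seqFixed_eq {n : ℕ} (d : Staircase (n + 1)) :
    seqFixed d.1 = seqFixed d.parent.1 + if seqZeros d.1 = 1 then 1 else 0 := by
  have hs := d.succ_eq
  have hz := d.2.seqZeros_pos
  have hfix : {i : Fin (n + 1) | d.1 i = i} =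
      insert 0 (Fin.succ '' {i : Fin n | ¬ (i : ℕ) + 1 < seqZeros d.1 ∧ d.parent.1 i = i}) := by
    ext i
    refine Fin.cases (by simp [d.2.zero_eq]) (fun i => ?_) i
    have := hs i
    simp only [Set.mem_ofPred_eq, Fin.val_succ, Set.mem_insert_iff, Fin.succ_ne_zero, false_or,
      Set.mem_image, Fin.succ_inj, exists_eq_right]
    rw [this]
    split_ifs with h <;> simp [h]
  rw [seqFixed, hfix, Set.ncard_insert_of_notMem (by simp [Fin.succ_ne_zero]),
    Set.ncard_image_of_injective _ (Fin.succ_injective n), seqFixed]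
  split_ifs with h1
  · congr 3
    ext i
    have : ¬ (i : ℕ) + 1 < 1 := by omega
    simp [h1]
  · rcases n with _ | n
    · have := seqZeros_le d.1
      omega
    have : {i : Fin (n + 1) | d.parent.1 i = i} = insert 0
        {i : Fin (n + 1) | ¬ (i : ℕ) + 1 < seqZeros d.1 ∧ d.parent.1 i = i} := by
      ext i
      refine Fin.cases (by simp [d.parent.2.zero_eq]) (fun i => ?_) i
      have := d.parent.2.eq_zero_iff i.succ
      have hle := d.seqZeros_le_parent
      simp only [Set.mem_ofPred_eq, Fin.val_succ, Set.mem_insert_iff, Fin.succ_ne_zero,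
        false_or] at this ⊢
      omega
    rw [this, Set.ncard_insert_of_notMem]
    simp only [Set.mem_ofPred_eq, Fin.val_zero]
    omega

/-- The letters are `0` and the successors of the parent's letters that are not overwritten. Only
the parent's letter `0` can disappear, and it does so exactly when all its zeros are overwritten,
that is, when the state grows. -/
theorem Staircase.seqDistinct_eq {n : ℕ} (d : Staircase (n + 1)) :
    seqDistinct d.1 = seqDistinct d.parent.1 +
      if n = 0 then 1 else if seqZeros d.1 = seqZeros d.parent.1 + 1 then 0 else 1 := by
  have hs := d.succ_eq
  have hle := d.seqZeros_le_parent
  have hz := d.2.seqZeros_pos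
  rcases n with _ | n
  · have : Set.range d.1 = {0} := Set.eq_singleton_iff_unique_mem.2 ⟨⟨0, d.2.zero_eq⟩, by
      rintro _ ⟨i, rfl⟩
      have := d.2.le i
      omega⟩
    rw [seqDistinct, seqDistinct, if_pos rfl, Set.range_eq_empty d.parent.1, Set.ncard_empty,
      this, Set.ncard_singleton]
  rw [if_neg (Nat.succ_ne_zero n)]
  have hr : Set.range d.1 = insert 0
      (Nat.succ '' (d.parent.1 '' {i | ¬ (i : ℕ) + 1 < seqZeros d.1})) := by
    ext v
    constructor
    · rintro ⟨i, rfl⟩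
      refine Fin.cases (Or.inl d.2.zero_eq) (fun i => ?_) i
      rw [hs i]
      split_ifs with h
      · exact Or.inl rfl
      · exact Or.inr ⟨_, ⟨i, h, rfl⟩, rfl⟩
    · rintro (rfl | ⟨_, ⟨i, hi, rfl⟩, rfl⟩)
      · exact ⟨0, d.2.zero_eq⟩
      · exact ⟨i.succ, by rw [hs i, if_neg hi]⟩
  rw [seqDistinct, hr, Set.ncard_insert_of_notMem (by simp),
    Set.ncard_image_of_injective _ Nat.succ_injective, seqDistinct]
  split_ifs with h
  · have : Set.range d.parent.1 = insert 0
        (d.parent.1 '' {i | ¬ (i : ℕ) + 1 < seqZeros d.1}) := by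
      ext v
      constructor
      · rintro ⟨i, rfl⟩
        have := d.parent.2.eq_zero_iff i
        by_cases hi : (i : ℕ) + 1 < seqZeros d.1
        · exact Or.inl (this.2 (by omega))
        · exact Or.inr ⟨i, hi, rfl⟩
      · rintro (rfl | ⟨i, hi, rfl⟩)
        · exact ⟨0, d.parent.2.zero_eq⟩
        · exact ⟨i, rfl⟩
    rw [this, Set.ncard_insert_of_notMem]
    rintro ⟨i, hi, h0⟩
    have := (d.parent.2.eq_zero_iff i).1 h0
    simp only [Set.mem_ofPred_eq] at hi
    omega
  · congr 2
    ext v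
    constructor
    · rintro ⟨i, -, rfl⟩
      exact ⟨i, rfl⟩
    · rintro ⟨i, rfl⟩
      by_cases hi : (i : ℕ) + 1 < seqZeros d.1
      · have hlt : seqZeros d.1 - 1 < n + 1 := by
          have := seqZeros_le d.parent.1
          omega
        -- The first position that is not overwritten still carries a zero of the parent.
        refine ⟨⟨seqZeros d.1 - 1, hlt⟩, ?_, ?_⟩
        · simp only [Set.mem_ofPred_eq]
          omega
        · rw [(d.parent.2.eq_zero_iff i).2 (by omega), d.parent.2.eq_zero_iff]
          change seqZeros d.1 - 1 < _
          omega
      · exact ⟨i, hi, rfl⟩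

/-- The generating tree of the staircase sequences. -/
def staircaseTree : CatalanTree Staircase (fun _ d => seqDistinct d.1) (fun _ d => seqFixed d.1)
    (fun _ d => seqZeros d.1) 0 1 where
  nonempty_zero := ⟨⟨fun i => i.elim0, ⟨fun i => i.elim0, fun i => i.elim0⟩⟩⟩
  subsingleton_zero := ⟨fun a b => Subtype.ext (funext fun i => i.elim0)⟩
  zero a := ⟨by simp [seqDistinct], by simp [seqFixed, Set.eq_empty_of_isEmpty],
    by simp [seqZeros, Set.eq_empty_of_isEmpty]⟩
  parent _ := Staircase.parent
  st_pos _ c := c.2.seqZeros_pos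
  st_le _ c := c.seqZeros_le_parent
  exists_child _ a j hj hle := ⟨a.child (j - 1) (by omega), a.parent_child _ _, by
    simp only [Staircase.seqZeros_child]; omega⟩
  child_unique _ c c' h1 h2 := by
    refine Subtype.ext (funext fun i => ?_)
    refine Fin.cases ?_ (fun i => ?_) i
    · rw [c.2.zero_eq, c'.2.zero_eq]
    · rw [c.succ_eq, c'.succ_eq, h1, h2]
  s₁_eq _ c := c.seqDistinct_eq
  s₂_eq _ c := c.seqFixed_eq

theorem genFun_staircase : genFun Staircase (fun {_} d => seqDistinct d.1)
    (fun {_} d => seqZeros d.1) (fun {_} d => seqFixed d.1) = catalanGF := by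
  have := genFun_eq_catalanGF_of_tree_one staircaseTree
  exact this

end CatalanFishburn

/-! ### Ascent sequences avoiding 101 -/

namespace CatalanFishburn

theorem containsPattern_101_iff {n : ℕ} (w : Fin n → ℕ) :
    ContainsPattern w ![1, 0, 1] ↔ ∃ i j k, i < j ∧ j < k ∧ w j < w i ∧ w i = w k := by
  constructor
  · rintro ⟨f, hf⟩
    refine ⟨f 0, f 1, f 2, f.lt_iff_lt.2 (by decide), f.lt_iff_lt.2 (by decide), ?_, ?_⟩
    · have := hf 0 1
      simp at this
      exact this
    · have h1 := hf 0 2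
      have h2 := hf 2 0
      simp at h1 h2
      exact le_antisymm h1 h2
  · rintro ⟨i, j, k, hij, hjk, h1, h2⟩
    have hm : StrictMono ![i, j, k] := by
      rw [Fin.strictMono_iff_lt_succ]
      intro a
      fin_cases a <;> simpa
    refine ⟨OrderEmbedding.ofStrictMono _ hm, fun a b => ?_⟩
    fin_cases a <;> fin_cases b <;> simp [OrderEmbedding.ofStrictMono, ← h2, h1, h1.le]

/-- The positions of the right-to-left minima. -/
def rminSet {n : ℕ} (w : Fin n → ℕ) : Set (Fin n) := {i | ∀ j, i < j → w i < w j}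

/-- The number of ascents. -/
noncomputable def ascTotal {n : ℕ} (w : Fin n → ℕ) : ℕ :=
  {j : Fin n | ∃ j' : Fin n, (j' : ℕ) = j + 1 ∧ w j < w j'}.ncard

/-! ### Appending a letter to a word. -/

section Append

variable {n : ℕ} (c : Fin (n + 1) → ℕ)

theorem ncard_fin_succ_last (P : Fin (n + 1) → Prop) [Decidable (P (Fin.last n))] :
    {i | P i}.ncard = {i : Fin n | P i.castSucc}.ncard + if P (Fin.last n) then 1 else 0 := by
  have himg : (Fin.castSucc '' {i : Fin n | P i.castSucc}).ncard =
      {i : Fin n | P i.castSucc}.ncard :=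
    Set.ncard_image_of_injective _ (Fin.castSucc_injective n)
  split_ifs with h
  · rw [← himg, ← Set.ncard_insert_of_notMem (a := Fin.last n)]
    · congr 1
      ext i
      refine Fin.lastCases (by simpa using h) (fun i => ?_) i
      simp [Fin.castSucc_ne_last]
    · rintro ⟨i, -, hi⟩
      exact Fin.castSucc_ne_last i hi
  · rw [← himg, add_zero]
    congr 1
    ext i
    refine Fin.lastCases ?_ (fun i => ?_) i
    · simp only [Set.mem_ofPred_eq, h, Set.mem_image, false_iff]
      rintro ⟨i, -, hi⟩
      exact Fin.castSucc_ne_last i hi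
    · simp

open Classical in
theorem wordLmax_append : wordLmax c = wordLmax (fun i : Fin n => c i.castSucc) +
    if ∀ i : Fin n, c i.castSucc < c (Fin.last n) then 1 else 0 := by
  rw [wordLmax, ncard_fin_succ_last, wordLmax]
  have : (∀ j, j < Fin.last n → c j < c (Fin.last n)) ↔
      ∀ i : Fin n, c i.castSucc < c (Fin.last n) :=
    ⟨fun h i => h _ (Fin.castSucc_lt_last i), fun h j =>
      Fin.lastCases (fun h => absurd h (lt_irrefl _)) (fun i _ => h i) j⟩
  simp only [this]
  congr 2
  ext i
  exact ⟨fun h j hj => h _ (Fin.castSucc_lt_castSucc_iff.2 hj), fun h j =>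
    Fin.lastCases (fun h => absurd h (not_lt.2 (Fin.le_last _)))
      (fun j hj => h j (Fin.castSucc_lt_castSucc_iff.1 hj)) j⟩

theorem wordZero_append : wordZero c = wordZero (fun i : Fin n => c i.castSucc) +
    if c (Fin.last n) = 0 then 1 else 0 :=
  ncard_fin_succ_last fun i => c i = 0

theorem wordRmin_append : wordRmin c =
    {i ∈ rminSet (fun i : Fin n => c i.castSucc) | c i.castSucc < c (Fin.last n)}.ncard + 1 := by
  classical
  rw [wordRmin, ncard_fin_succ_last, if_pos fun j hj => absurd hj (not_lt.2 (Fin.le_last _))]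
  congr 2
  ext i
  constructor
  · exact fun h => ⟨fun j hj => h _ (Fin.castSucc_lt_castSucc_iff.2 hj),
      h _ (Fin.castSucc_lt_last i)⟩
  · exact fun h j => Fin.lastCases (fun _ => h.2)
      (fun j hj => h.1 j (Fin.castSucc_lt_castSucc_iff.1 hj)) j

theorem ascBefore_castSucc (i : Fin n) :
    ascBefore c i.castSucc = ascBefore (fun i : Fin n => c i.castSucc) i := by
  classical
  rw [ascBefore, ncard_fin_succ_last, if_neg, add_zero, ascBefore]
  · congr 1
    ext j
    constructor
    · rintro ⟨j', h1, h2, h3⟩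
      obtain ⟨j', rfl⟩ := Fin.eq_castSucc_of_ne_last
        (h2.trans (Fin.castSucc_lt_last i)).ne
      exact ⟨j', h1, Fin.castSucc_lt_castSucc_iff.1 h2, h3⟩
    · rintro ⟨j', h1, h2, h3⟩
      exact ⟨j'.castSucc, h1, Fin.castSucc_lt_castSucc_iff.2 h2, h3⟩
  · rintro ⟨j', h1, -, -⟩
    have := j'.2
    rw [Fin.val_last] at h1
    omega

theorem ascBefore_last :
    ascBefore c (Fin.last n) = ascTotal (fun i : Fin n => c i.castSucc) := by
  classical
  rw [ascBefore, ncard_fin_succ_last, if_neg, add_zero, ascTotal]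
  · congr 1
    ext j
    constructor
    · rintro ⟨j', h1, h2, h3⟩
      obtain ⟨j', rfl⟩ := Fin.eq_castSucc_of_ne_last h2.ne
      exact ⟨j', h1, h3⟩
    · rintro ⟨j', h1, h3⟩
      exact ⟨j'.castSucc, h1, Fin.castSucc_lt_last _, h3⟩
  · rintro ⟨j', h1, -, -⟩
    have := j'.2
    rw [Fin.val_last] at h1
    omega

theorem ascTotal_append (c : Fin (n + 2) → ℕ) :
    ascTotal c = ascTotal (fun i : Fin (n + 1) => c i.castSucc) +
      if c (Fin.last n).castSucc < c (Fin.last (n + 1)) then 1 else 0 := by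
  classical
  -- A final position is never an ascent, which disposes of `e1` for the long word and of `e3` for
  -- its prefix. In between, `e2` isolates the only possible new ascent, at the position before the
  -- new letter.
  have e1 := ncard_fin_succ_last fun j : Fin (n + 2) =>
    ∃ j' : Fin (n + 2), (j' : ℕ) = j + 1 ∧ c j < c j'
  have e2 := ncard_fin_succ_last fun j : Fin (n + 1) =>
    ∃ j' : Fin (n + 2), (j' : ℕ) = j.castSucc + 1 ∧ c j.castSucc < c j'
  have e3 := ncard_fin_succ_last fun j : Fin (n + 1) =>
    ∃ j' : Fin (n + 1), (j' : ℕ) = j + 1 ∧ c j.castSucc < c j'.castSucc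
  rw [if_neg] at e1 e3
  · rw [ascTotal, ascTotal, e1, e2, e3, add_zero, add_zero]
    congr 1
    · congr 1
      ext j
      constructor
      · rintro ⟨j', h1, h2⟩
        rcases Fin.eq_castSucc_or_eq_last j' with ⟨j', rfl⟩ | rfl
        · exact ⟨j', h1, h2⟩
        · have := j.2
          simp at h1
          omega
      · rintro ⟨j', h1, h2⟩
        exact ⟨j'.castSucc, h1, h2⟩
    · congr 1
      rw [eq_iff_iff]
      constructor
      · rintro ⟨j', h1, h2⟩
        have : j' = Fin.last (n + 1) := Fin.ext h1
        rwa [this] at h2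
      · exact fun h => ⟨Fin.last (n + 1), rfl, h⟩
  all_goals
    rintro ⟨j', h1, -⟩
    have := j'.2
    rw [Fin.val_last] at h1
    omega

theorem isAscentSequence_append_iff : IsAscentSequence c ↔
    IsAscentSequence (fun i : Fin n => c i.castSucc) ∧
      c (Fin.last n) ≤ if n = 0 then 0 else 1 + ascTotal fun i : Fin n => c i.castSucc := by
  constructor
  · rintro ⟨h1, h2⟩
    refine ⟨⟨fun i hi => h1 i.castSucc hi, fun i hi => ?_⟩, ?_⟩
    · rw [← ascBefore_castSucc]
      exact h2 i.castSucc hi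
    · split_ifs with hn
      · exact (h1 _ hn).le
      · rw [← ascBefore_last]
        exact h2 _ (Nat.pos_of_ne_zero hn)
  · rintro ⟨⟨h1, h2⟩, h3⟩
    constructor
    · refine Fin.lastCases (fun hn => ?_) (fun i hi => h1 i hi)
      rw [if_pos (show n = 0 from hn)] at h3
      exact Nat.eq_zero_of_le_zero h3
    · refine Fin.lastCases (fun hn => ?_) (fun i hi => ?_)
      · rw [if_neg (show n ≠ 0 from Nat.ne_of_gt hn)] at h3
        rwa [ascBefore_last]
      · rw [ascBefore_castSucc]
        exact h2 i hi

end Append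

/-- The ascent sequences avoiding 101. -/
def IsAscent101 {n : ℕ} (w : Fin n → ℕ) : Prop :=
  IsAscentSequence w ∧ ¬ ContainsPattern w ![1, 0, 1]

section Avoiding

variable {n : ℕ}

theorem IsAscent101.init {c : Fin (n + 1) → ℕ} (h : IsAscent101 c) :
    IsAscent101 (fun i : Fin n => c i.castSucc) := by
  refine ⟨((isAscentSequence_append_iff c).1 h.1).1, fun h' => h.2 ?_⟩
  rw [containsPattern_101_iff] at h' ⊢
  obtain ⟨i, j, k, h1, h2, h3⟩ := h'
  exact ⟨i.castSucc, j.castSucc, k.castSucc, h1, h2, h3⟩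

/-- A letter that occurs again at the end was a right-to-left minimum. -/
theorem IsAscent101.exists_rminSet {c : Fin (n + 1) → ℕ} (h : IsAscent101 c)
    (hc : c (Fin.last n) ∈ Set.range fun i : Fin n => c i.castSucc) :
    ∃ i ∈ rminSet (fun i : Fin n => c i.castSucc), c i.castSucc = c (Fin.last n) := by
  classical
  have hne : (Finset.univ.filter fun i : Fin n => c i.castSucc = c (Fin.last n)).Nonempty := by
    obtain ⟨i, hi⟩ := hc
    exact ⟨i, by simpa using hi⟩
  have hmax := Finset.max'_mem _ hne
  have hle := fun j => Finset.le_max' (Finset.univ.filter fun i : Fin n =>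
    c i.castSucc = c (Fin.last n)) j
  set i := Finset.max' _ hne
  simp only [Finset.mem_filter, Finset.mem_univ, true_and] at hmax hle
  refine ⟨i, fun j hij => ?_, hmax⟩
  rcases lt_trichotomy (c i.castSucc) (c j.castSucc) with hlt | heq | hgt
  · exact hlt
  · exact absurd (hle j (heq.symm.trans hmax)) (not_le.2 hij)
  · exact absurd ((containsPattern_101_iff c).2 ⟨i.castSucc, j.castSucc, Fin.last n, hij,
      Fin.castSucc_lt_last j, hgt, hmax⟩) h.2

/-- A repeated last letter equals an earlier right-to-left minimum, so it does not exceed its left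
neighbour and creates no ascent. A new letter lies above all previous ones, and the bound for ascent
sequences forces it to be the next integer, with one new ascent. Hence the letters have no gaps and
the number of ascents is the largest letter. -/
theorem IsAscent101.range_eq {c : Fin (n + 1) → ℕ} (h : IsAscent101 c) :
    Set.range c = Set.Iic (ascTotal c) := by
  induction n with
  | zero =>
    have h0 : c 0 = 0 := h.1.1 0 rfl
    have h1 : ascTotal c = 0 := by
      rw [ascTotal, Set.ncard_eq_zero]
      refine Set.eq_empty_of_forall_notMem ?_
      rintro j ⟨j', hj, -⟩
      omega
    rw [h1]
    ext v
    constructor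
    · rintro ⟨i, rfl⟩
      rw [show i = 0 from Subsingleton.elim (α := Fin 1) i 0, h0]
      exact Nat.zero_le _
    · intro hv
      exact ⟨0, h0.trans (Nat.eq_zero_of_le_zero hv).symm⟩
  | succ n ih =>
    have hi := ih h.init
    have hr : Set.range c = insert (c (Fin.last (n + 1)))
        (Set.range fun i : Fin (n + 1) => c i.castSucc) := by
      ext v
      constructor
      · rintro ⟨i, rfl⟩
        exact Fin.lastCases (Or.inl rfl) (fun i => Or.inr ⟨i, rfl⟩) i
      · rintro (rfl | ⟨i, rfl⟩)
        · exact ⟨_, rfl⟩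
        · exact ⟨_, rfl⟩
    rw [hr, hi, ascTotal_append]
    set a := ascTotal fun i : Fin (n + 1) => c i.castSucc
    by_cases hc : c (Fin.last (n + 1)) ∈ Set.range fun i : Fin (n + 1) => c i.castSucc
    · obtain ⟨i, hi1, hi2⟩ := h.exists_rminSet hc
      rw [if_neg, add_zero]
      · rw [hi] at hc
        exact Set.insert_eq_of_mem hc
      · rw [← hi2, not_lt]
        rcases (Fin.le_last i).eq_or_lt with rfl | hlt
        · exact le_rfl
        · exact (hi1 _ hlt).le
    · have h1 := ((isAscentSequence_append_iff c).1 h.1).2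
      rw [if_neg (Nat.succ_ne_zero n)] at h1
      rw [hi, Set.mem_Iic, not_le] at hc
      have h2 : c (Fin.last n).castSucc ≤ a := by
        have : c (Fin.last n).castSucc ∈ Set.range fun i : Fin (n + 1) => c i.castSucc :=
          ⟨_, rfl⟩
        rwa [hi] at this
      rw [if_pos (by omega)]
      ext v
      simp only [Set.mem_insert_iff, Set.mem_Iic]
      omega

theorem IsAscent101.range_eq_or {c : Fin (n + 1) → ℕ} (h : IsAscent101 c) :
    (c (Fin.last n) ∈ Set.range fun i : Fin n => c i.castSucc) ∨
      (∀ i : Fin n, c i.castSucc < c (Fin.last n)) ∧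
        c (Fin.last n) = if n = 0 then 0 else 1 + ascTotal fun i : Fin n => c i.castSucc := by
  by_cases hc : c (Fin.last n) ∈ Set.range fun i : Fin n => c i.castSucc
  · exact Or.inl hc
  right
  rcases n with _ | n
  · exact ⟨fun i => i.elim0, h.1.1 _ rfl⟩
  have h1 := ((isAscentSequence_append_iff c).1 h.1).2
  have hr := h.init.range_eq
  rw [if_neg (Nat.succ_ne_zero n)] at h1 ⊢
  rw [hr, Set.mem_Iic, not_le] at hc
  refine ⟨fun i => ?_, by omega⟩
  have : c i.castSucc ∈ Set.range fun i : Fin (n + 1) => c i.castSucc := ⟨i, rfl⟩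
  rw [hr] at this
  exact lt_of_le_of_lt this hc

/-- The new letter exceeds all others, so it cannot be the final `1` of a pattern 101. -/
theorem IsAscent101.snoc_new {a : Fin n → ℕ} (h : IsAscent101 a) :
    IsAscent101 (Fin.snoc a (if n = 0 then 0 else 1 + ascTotal a) : Fin (n + 1) → ℕ) := by
  constructor
  · rw [isAscentSequence_append_iff]
    simpa using h.1
  · rw [containsPattern_101_iff]
    rintro ⟨i, j, k, hij, hjk, h1, h2⟩
    obtain ⟨i, rfl⟩ := Fin.eq_castSucc_of_ne_last ((hij.trans hjk).trans_le (Fin.le_last k)).ne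
    obtain ⟨j, rfl⟩ := Fin.eq_castSucc_of_ne_last (hjk.trans_le (Fin.le_last k)).ne
    rcases n with _ | n
    · exact i.elim0
    rcases Fin.eq_castSucc_or_eq_last k with ⟨k, rfl⟩ | rfl
    · refine h.2 ((containsPattern_101_iff a).2 ⟨i, j, k, hij, hjk, ?_⟩)
      simpa using And.intro h1 h2
    · have : a i ∈ Set.range a := ⟨i, rfl⟩
      rw [h.range_eq, Set.mem_Iic] at this
      simp at h2
      omega

/-- A pattern 101 ending in the new letter could end at `l` instead: its middle letter is smaller
than `a l`, and all letters after the right-to-left minimum `l` are larger. -/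
theorem IsAscent101.snoc_old {a : Fin n → ℕ} (h : IsAscent101 a) {l : Fin n}
    (hl : l ∈ rminSet a) : IsAscent101 (Fin.snoc a (a l) : Fin (n + 1) → ℕ) := by
  rcases n with _ | n
  · exact l.elim0
  constructor
  · rw [isAscentSequence_append_iff]
    have : a l ∈ Set.range a := ⟨l, rfl⟩
    rw [h.range_eq, Set.mem_Iic] at this
    refine ⟨by simpa using h.1, ?_⟩
    simp only [Fin.snoc_castSucc, Fin.snoc_last]
    rw [if_neg (Nat.succ_ne_zero n)]
    exact this.trans (Nat.le_add_left _ _)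
  · rw [containsPattern_101_iff]
    rintro ⟨i, j, k, hij, hjk, h1, h2⟩
    obtain ⟨i, rfl⟩ := Fin.eq_castSucc_of_ne_last ((hij.trans hjk).trans_le (Fin.le_last k)).ne
    obtain ⟨j, rfl⟩ := Fin.eq_castSucc_of_ne_last (hjk.trans_le (Fin.le_last k)).ne
    have hij' : i < j := hij
    rcases Fin.eq_castSucc_or_eq_last k with ⟨k, rfl⟩ | rfl
    · refine h.2 ((containsPattern_101_iff a).2 ⟨i, j, k, hij, hjk, ?_⟩)
      simpa using And.intro h1 h2
    · simp at h1 h2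
      have hjl : j < l := by
        rcases lt_trichotomy j l with hlt | rfl | hgt
        · exact hlt
        · omega
        · have := hl j hgt
          omega
      exact h.2 ((containsPattern_101_iff a).2 ⟨i, j, l, hij', hjl, h1, h2⟩)

theorem rminSet_lt_iff {a : Fin n → ℕ} {i j : Fin n} (hi : i ∈ rminSet a) (hj : j ∈ rminSet a) :
    a i < a j ↔ i < j := by
  refine ⟨fun h => ?_, fun h => hi j h⟩
  rcases lt_trichotomy i j with hlt | rfl | hgt
  · exact hlt
  · omega
  · have := hj i hgt
    omega

/-- Picks the element with a prescribed number of predecessors; in both trees of words this selects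
the child with a prescribed state. -/
theorem exists_mem_ncard_lt {S : Set (Fin n)} {m : ℕ} (hm : m < S.ncard) :
    ∃ i ∈ S, {j ∈ S | j < i}.ncard = m := by
  classical
  obtain ⟨s, rfl⟩ := S.toFinite.exists_finset_coe
  rw [Set.ncard_coe_finset] at hm
  refine ⟨s.orderEmbOfFin rfl ⟨m, hm⟩, by simp, ?_⟩
  have : {j ∈ (s : Set (Fin n)) | j < s.orderEmbOfFin rfl ⟨m, hm⟩} =
      s.orderEmbOfFin rfl '' {i | (i : ℕ) < m} := by
    ext j
    constructor
    · rintro ⟨hj, hlt⟩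
      rw [← Finset.range_orderEmbOfFin s rfl] at hj
      obtain ⟨i, rfl⟩ := hj
      exact ⟨i, (s.orderEmbOfFin rfl).lt_iff_lt.1 hlt, rfl⟩
    · rintro ⟨i, hi, rfl⟩
      exact ⟨by simp, (s.orderEmbOfFin rfl).lt_iff_lt.2 hi⟩
  rw [this, Set.ncard_image_of_injective _ (s.orderEmbOfFin rfl).injective,
    ncard_setOf_lt hm.le]

theorem wordRmin_eq_ncard (w : Fin n → ℕ) : wordRmin w = (rminSet w).ncard := rfl

/-- A repeated letter destroys the right-to-left minimum that has the same value, so the count grows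
only when the new letter is a strict maximum. -/
theorem IsAscent101.wordRmin_eq_iff {c : Fin (n + 1) → ℕ} (h : IsAscent101 c) :
    wordRmin c = wordRmin (fun i : Fin n => c i.castSucc) + 1 ↔
      ∀ i : Fin n, c i.castSucc < c (Fin.last n) := by
  rw [wordRmin_append, wordRmin_eq_ncard, Nat.add_right_cancel_iff]
  constructor
  · intro he
    rcases h.range_eq_or with hc | hc
    · obtain ⟨i, hi, hi'⟩ := h.exists_rminSet hc
      have hs := Set.eq_of_subset_of_ncard_le (Set.sep_subset _ _) he.ge
      rw [← hs] at hi
      exact absurd hi.2 (by omega)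
    · exact hc.1
  · intro hc
    congr 1
    ext i
    exact ⟨fun hi => hi.1, fun hi => ⟨hi, hc i⟩⟩

/-- If the last letter is nonzero, the last zero is a second right-to-left minimum. -/
theorem IsAscent101.wordRmin_eq_one_iff {c : Fin (n + 1) → ℕ} (h : IsAscent101 c) :
    wordRmin c = 1 ↔ c (Fin.last n) = 0 := by
  rw [wordRmin_append, Nat.add_eq_right, Set.ncard_eq_zero]
  constructor
  · intro he
    by_contra hne
    rcases n with _ | n
    · exact hne (h.1.1 _ rfl)
    have h0 : (Finset.univ.filter fun i : Fin (n + 1) => c i.castSucc = 0).Nonempty :=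
      ⟨0, by simpa using h.1.1 0 rfl⟩
    have hmax := Finset.max'_mem _ h0
    have hle := fun j => Finset.le_max' (Finset.univ.filter fun i : Fin (n + 1) =>
      c i.castSucc = 0) j
    set i := Finset.max' _ h0
    simp only [Finset.mem_filter, Finset.mem_univ, true_and] at hmax hle
    have : i ∈ {i ∈ rminSet (fun i : Fin (n + 1) => c i.castSucc) |
        c i.castSucc < c (Fin.last (n + 1))} := by
      refine ⟨fun j hj => ?_, by omega⟩
      change c i.castSucc < c j.castSucc
      rw [hmax]
      exact Nat.pos_of_ne_zero fun h0 => absurd (hle j h0) (not_le.2 hj)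
    rw [he] at this
    exact this
  · intro h0
    refine Set.eq_empty_of_forall_notMem fun i hi => ?_
    have := hi.2
    omega

/-- If the last letter of `c` were smaller, it could not be the forced new maximum, so it would
repeat an old right-to-left minimum. That minimum survives in `c'` but not in `c`, and everything
surviving in `c` survives in `c'`; the counts would differ. -/
theorem IsAscent101.last_le {c c' : Fin (n + 1) → ℕ} (h : IsAscent101 c) (h' : IsAscent101 c')
    (hi : ∀ i : Fin n, c i.castSucc = c' i.castSucc) (hr : wordRmin c = wordRmin c') :
    c' (Fin.last n) ≤ c (Fin.last n) := by
  by_contra! hlt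
  have hi' : (fun i : Fin n => c i.castSucc) = fun i : Fin n => c' i.castSucc := funext hi
  have hc : c (Fin.last n) ∈ Set.range fun i : Fin n => c i.castSucc := by
    rcases h.range_eq_or with hc | ⟨-, hc⟩
    · exact hc
    · have h1 := ((isAscentSequence_append_iff c').1 h'.1).2
      rw [← hi', ← hc] at h1
      omega
  obtain ⟨i, h1, h2⟩ := h.exists_rminSet hc
  rw [wordRmin_append, wordRmin_append, ← hi', Nat.add_right_cancel_iff] at hr
  have hs := Set.eq_of_subset_of_ncard_le (s := {i ∈ rminSet (fun i : Fin n => c i.castSucc) |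
    c i.castSucc < c (Fin.last n)}) (t := {i ∈ rminSet (fun i : Fin n => c i.castSucc) |
    c' i.castSucc < c' (Fin.last n)}) (fun j hj => ⟨hj.1, by rw [← hi]; exact hj.2.trans hlt⟩)
    hr.ge
  have : i ∈ {i ∈ rminSet (fun i : Fin n => c i.castSucc) |
    c' i.castSucc < c' (Fin.last n)} := ⟨h1, by rw [← hi, h2]; exact hlt⟩
  rw [← hs] at this
  have := this.2
  omega

end Avoiding

/-- The generating tree of the ascent sequences avoiding 101. -/
def ascentTree : CatalanTree (AscentAvoiding ![1, 0, 1]) (fun _ a => wordLmax a.1)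
    (fun _ a => wordZero a.1) (fun _ a => wordRmin a.1) 1 0 where
  nonempty_zero := ⟨⟨fun i => i.elim0, ⟨fun i => i.elim0, fun i => i.elim0⟩,
    fun h => (containsPattern_101_iff _).1 h |>.elim fun i => i.elim0⟩⟩
  subsingleton_zero := ⟨fun a b => Subtype.ext (funext fun i => i.elim0)⟩
  zero a := ⟨by simp [wordLmax, Set.eq_empty_of_isEmpty],
    by simp [wordZero, Set.eq_empty_of_isEmpty], by simp [wordRmin, Set.eq_empty_of_isEmpty]⟩
  parent n c := ⟨fun i => c.1 i.castSucc, IsAscent101.init c.2⟩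
  st_pos n c := by
    rw [wordRmin_append]
    omega
  st_le n c := by
    rw [wordRmin_append]
    exact Nat.succ_le_succ (Set.ncard_le_ncard (Set.sep_subset _ _))
  exists_child n a j hj hle := by
    -- State `j` requires that `j - 1` old right-to-left minima survive: repeat the one that has `j
    -- - 1` predecessors, or, if all are to survive, append a new maximum.
    rcases Nat.lt_or_ge (j - 1) (rminSet a.1).ncard with hlt | hge
    · obtain ⟨l, hl, hl'⟩ := exists_mem_ncard_lt hlt
      refine ⟨⟨_, IsAscent101.snoc_old a.2 hl⟩, Subtype.ext (funext fun i => by simp), ?_⟩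
      rw [wordRmin_append]
      simp only [Fin.snoc_castSucc, Fin.snoc_last]
      have : {i ∈ rminSet a.1 | a.1 i < a.1 l} = {i ∈ rminSet a.1 | i < l} := by
        ext i
        exact and_congr_right fun hi => rminSet_lt_iff hi hl
      rw [this, hl']
      omega
    · refine ⟨⟨_, IsAscent101.snoc_new a.2⟩, Subtype.ext (funext fun i => by simp), ?_⟩
      have h1 := (IsAscent101.wordRmin_eq_iff (IsAscent101.snoc_new a.2)).2 (by
        intro i
        rcases n with _ | n
        · exact i.elim0
        have : a.1 i ∈ Set.range a.1 := ⟨i, rfl⟩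
        rw [IsAscent101.range_eq a.2, Set.mem_Iic] at this
        simp
        omega)
      simp only [Fin.snoc_castSucc] at h1
      rw [h1]
      change j ≤ (rminSet a.1).ncard + 1 at hle
      change (rminSet a.1).ncard + 1 = j
      omega
  child_unique n c c' h1 h2 := by
    have hi : ∀ i : Fin n, c.1 i.castSucc = c'.1 i.castSucc := fun i =>
      congrFun (congrArg Subtype.val h1) i
    refine Subtype.ext (funext fun i => Fin.lastCases ?_ hi i)
    exact le_antisymm (IsAscent101.last_le c'.2 c.2 (fun i => (hi i).symm) h2.symm)
      (IsAscent101.last_le c.2 c'.2 hi h2)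
  s₁_eq n c := by
    classical
    rw [wordLmax_append]
    congr 1
    have := IsAscent101.wordRmin_eq_iff c.2
    rcases n with _ | n
    · rw [if_pos (fun i => i.elim0), if_pos rfl]
    · rw [if_neg (Nat.succ_ne_zero n)]
      simp only [← this]
  s₂_eq n c := by
    rw [wordZero_append]
    simp only [IsAscent101.wordRmin_eq_one_iff c.2]

theorem genFun_ascent : genFun (AscentAvoiding ![1, 0, 1]) (fun {_} a => wordLmax a.1)
    (fun {_} a => wordZero a.1) (fun {_} a => wordRmin a.1) = catalanGF := by
  have := genFun_eq_catalanGF_of_tree_two ascentTree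
  exact this

end CatalanFishburn

/-! ### Fishburn permutations avoiding 3142 -/

namespace CatalanFishburn

theorem containsPattern_3142_iff {n m : ℕ} (w : Fin n → Fin m) :
    ContainsPattern w ![3, 1, 4, 2] ↔
      ∃ i j k l, i < j ∧ j < k ∧ k < l ∧ w j < w l ∧ w l < w i ∧ w i < w k := by
  constructor
  · rintro ⟨f, hf⟩
    have key : ∀ a b : Fin 4, w (f a) < w (f b) ↔
        (![3, 1, 4, 2] : Fin 4 → ℕ) a < (![3, 1, 4, 2] : Fin 4 → ℕ) b := fun a b => by
      rw [← not_le, ← not_le, hf]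
    exact ⟨f 0, f 1, f 2, f 3, f.lt_iff_lt.2 (by decide), f.lt_iff_lt.2 (by decide),
      f.lt_iff_lt.2 (by decide), (key 1 3).2 (by decide), (key 3 0).2 (by decide),
      (key 0 2).2 (by decide)⟩
  · rintro ⟨i, j, k, l, hij, hjk, hkl, h1, h2, h3⟩
    have hm : StrictMono ![i, j, k, l] := by
      rw [Fin.strictMono_iff_lt_succ]
      intro a
      fin_cases a <;> simpa
    -- The positions `j, l, i, k` are listed by increasing value. The vector `![2, 0, 3, 1]` below
    -- is the pattern 3142 counted from zero, so it translates between order of position and order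
    -- of value.
    have hv : StrictMono fun a => w ((![j, l, i, k] : Fin 4 → Fin n) a) := by
      rw [Fin.strictMono_iff_lt_succ]
      intro a
      fin_cases a <;> assumption
    have hf : ∀ a, OrderEmbedding.ofStrictMono _ hm a =
        (![j, l, i, k] : Fin 4 → Fin n) ((![2, 0, 3, 1] : Fin 4 → Fin 4) a) := fun a => by
      fin_cases a <;> rfl
    refine ⟨OrderEmbedding.ofStrictMono _ hm, fun a b => ?_⟩
    rw [hf, hf]
    exact hv.le_iff_le.trans (by revert a b; decide)

/-- The Fishburn permutations avoiding 3142. -/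
def IsFishburn3142 {n : ℕ} (π : Equiv.Perm (Fin n)) : Prop :=
  IsFishburn π ∧ ¬ ContainsPattern π ![3, 1, 4, 2]

/-- The positions of the left-to-right maxima. -/
def lmaxSet {n : ℕ} (π : Equiv.Perm (Fin n)) : Set (Fin n) := {i | ∀ j, j < i → π j < π i}

/-- The letters before the site `p` are smaller than the letters after it. -/
def IsSplit {n : ℕ} (π : Equiv.Perm (Fin n)) (p : Fin (n + 1)) : Prop :=
  ∀ i j : Fin n, i.castSucc < p → p ≤ j.castSucc → π i < π j

section Insert

variable {n : ℕ}

/-- Suppose a letter after `l` is smaller than `π i`, and let `π b` be the largest such letter. By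
maximality the value `π b + 1` stands at a position `q` before `l`, and the Fishburn condition
forces a descent at `q`. If `q + 1 = l`, this contradicts that `l` is a left-to-right maximum;
otherwise `q, q + 1, l, b` form a 3142. -/
theorem IsFishburn3142.lt_of_mem_lmaxSet {π : Equiv.Perm (Fin n)} (h : IsFishburn3142 π)
    {l : Fin n} (hl : l ∈ lmaxSet π) {i j : Fin n} (hi : i < l) (hj : l < j) : π i < π j := by
  by_contra hlt
  have hij : π j < π i := lt_of_le_of_ne (not_lt.1 hlt) fun e =>
    absurd (π.injective e) (hi.trans hj).ne'
  have hne : (Finset.univ.filter fun j : Fin n => l < j ∧ π j < π i).Nonempty :=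
    ⟨j, by simpa using ⟨hj, hij⟩⟩
  obtain ⟨b, hb, hmax⟩ := Finset.exists_max_image _ (fun j => π j) hne
  simp only [Finset.mem_filter, Finset.mem_univ, true_and] at hb hmax
  obtain ⟨hlb, hbi⟩ := hb
  have hlm := hl i hi
  rw [Fin.lt_def] at hbi hlm
  have hlt : (π b : ℕ) + 1 < n := by omega
  obtain ⟨q, hq⟩ := π.surjective ⟨(π b : ℕ) + 1, hlt⟩
  have hqv : (π q : ℕ) = π b + 1 := congrArg Fin.val hq
  have hql : q < l := by
    rcases lt_trichotomy q l with h1 | rfl | h1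
    · exact h1
    · omega
    · by_cases hqi : q = i
      · rw [hqi] at h1
        exact absurd h1 (not_lt.2 hi.le)
      · have hne : (π q : ℕ) ≠ π i := fun e => hqi (π.injective (Fin.ext e))
        have := hmax q ⟨h1, Fin.lt_def.2 (by omega)⟩
        rw [Fin.le_def] at this
        omega
  have hql' := Fin.lt_def.1 hql
  have hlb' := Fin.lt_def.1 hlb
  have hq1 : (q : ℕ) + 1 < n := by omega
  have hfish : ¬ π q < π ⟨(q : ℕ) + 1, hq1⟩ := fun hlt =>
    h.1 ⟨q, ⟨(q : ℕ) + 1, hq1⟩, b, rfl, Fin.lt_def.2 (by simp only; omega), hqv.symm, hlt⟩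
  rcases Nat.lt_or_ge (q + 1) l with hlt | hge
  · have hne : (π ⟨(q : ℕ) + 1, hq1⟩ : ℕ) ≠ π b := fun e => by
      have := Fin.val_eq_of_eq (π.injective (Fin.ext e))
      simp only at this
      omega
    have hne' : (π ⟨(q : ℕ) + 1, hq1⟩ : ℕ) ≠ π q := fun e => by
      have := Fin.val_eq_of_eq (π.injective (Fin.ext e))
      simp only at this
      omega
    rw [Fin.lt_def] at hfish
    refine h.2 ((containsPattern_3142_iff _).2 ⟨q, ⟨(q : ℕ) + 1, hq1⟩, l, b,
      Fin.lt_def.2 (Nat.lt_succ_self _), Fin.lt_def.2 hlt, hlb, ?_, ?_, ?_⟩) <;>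
      rw [Fin.lt_def] <;> omega
  · have : (⟨(q : ℕ) + 1, hq1⟩ : Fin n) = l := Fin.ext (by simp only; omega)
    rw [this] at hfish
    exact hfish (hl q hql)

/-- With its converse `IsSplit.mem_lmaxSet`, this identifies the sites where a new maximum may be
inserted: in front of a left-to-right maximum, or at the end. -/
theorem IsFishburn3142.isSplit_of_mem_lmaxSet {π : Equiv.Perm (Fin n)} (h : IsFishburn3142 π)
    {l : Fin n} (hl : l ∈ lmaxSet π) : IsSplit π l.castSucc := by
  intro i j hi hj
  have hi' : i < l := hi
  rcases (show l ≤ j from hj).eq_or_lt with rfl | hlt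
  · exact hl i hi'
  · exact h.lt_of_mem_lmaxSet hl hi' hlt

theorem IsSplit.mem_lmaxSet {π : Equiv.Perm (Fin n)} {l : Fin n} (h : IsSplit π l.castSucc) :
    l ∈ lmaxSet π := fun j hj => h j l hj le_rfl

theorem isSplit_last (π : Equiv.Perm (Fin n)) : IsSplit π (Fin.last n) := fun _ j _ hj =>
  absurd hj (not_le.2 (Fin.castSucc_lt_last j))

/-- `c` arises from `a` by inserting a maximal letter at position `p`. -/
structure IsMaxInsertion (a : Equiv.Perm (Fin n)) (p : Fin (n + 1))
    (c : Equiv.Perm (Fin (n + 1))) : Prop where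
  apply_self : c p = Fin.last n
  apply_succAbove : ∀ i, c (p.succAbove i) = (a i).castSucc

theorem exists_isMaxInsertion_parent (c : Equiv.Perm (Fin (n + 1))) :
    ∃ a : Equiv.Perm (Fin n), IsMaxInsertion a (c.symm (Fin.last n)) c := by
  have hne : ∀ i, c ((c.symm (Fin.last n)).succAbove i) ≠ Fin.last n := fun i e => by
    rw [← c.eq_symm_apply] at e
    exact Fin.succAbove_ne _ _ e
  have hinj : Function.Injective fun i : Fin n =>
      (c ((c.symm (Fin.last n)).succAbove i)).castPred (hne i) := fun i j hij =>
    Fin.succAbove_right_injective (c.injective (Fin.castPred_inj.1 hij))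
  exact ⟨Equiv.ofBijective _ (Finite.injective_iff_bijective.1 hinj), by simp, fun i => by simp⟩

theorem exists_isMaxInsertion_child (a : Equiv.Perm (Fin n)) (p : Fin (n + 1)) :
    ∃ c : Equiv.Perm (Fin (n + 1)), IsMaxInsertion a p c := by
  have hinj : Function.Injective
      (Fin.insertNth (α := fun _ => Fin (n + 1)) p (Fin.last n) fun i => (a i).castSucc) := by
    intro i j
    refine Fin.succAboveCases p ?_ (fun i => ?_) i <;>
      refine Fin.succAboveCases p ?_ (fun j => ?_) j
    · exact fun _ => rfl
    · simp only [Fin.insertNth_apply_same, Fin.insertNth_apply_succAbove]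
      exact fun e => absurd e.symm (Fin.castSucc_ne_last _)
    · simp only [Fin.insertNth_apply_same, Fin.insertNth_apply_succAbove]
      exact fun e => absurd e (Fin.castSucc_ne_last _)
    · simp only [Fin.insertNth_apply_succAbove]
      exact fun e => congrArg _ (a.injective (Fin.castSucc_injective _ e))
  exact ⟨Equiv.ofBijective _ (Finite.injective_iff_bijective.1 hinj), by simp, fun i => by simp⟩

namespace IsMaxInsertion

variable {a a' : Equiv.Perm (Fin n)} {p p' : Fin (n + 1)} {c c' : Equiv.Perm (Fin (n + 1))}

theorem eq_left (h : IsMaxInsertion a p c) (h' : IsMaxInsertion a' p' c) : a = a' := by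
  have hp : p = p' := c.injective (h.apply_self.trans h'.apply_self.symm)
  subst hp
  ext i
  have := (h.apply_succAbove i).symm.trans (h'.apply_succAbove i)
  exact congrArg Fin.val (Fin.castSucc_injective _ this)

theorem eq_right (h : IsMaxInsertion a p c) (h' : IsMaxInsertion a p c') : c = c' := by
  ext i
  refine Fin.succAboveCases p ?_ (fun i => ?_) i
  · rw [h.apply_self, h'.apply_self]
  · rw [h.apply_succAbove, h'.apply_succAbove]

theorem mem_lmaxSet (h : IsMaxInsertion a p c) : p ∈ lmaxSet c := fun j hj => by
  rw [h.apply_self]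
  exact lt_of_le_of_ne (Fin.le_last _) fun e =>
    hj.ne (c.injective (e.trans h.apply_self.symm))

theorem isSplit (h : IsMaxInsertion a p c) (hc : IsFishburn3142 c) : IsSplit a p := by
  intro i j hi hj
  have h1 := hc.lt_of_mem_lmaxSet h.mem_lmaxSet (Fin.succAbove_lt_iff_castSucc_lt p i |>.2 hi)
    (Fin.lt_succAbove_iff_le_castSucc p j |>.2 hj)
  rwa [h.apply_succAbove, h.apply_succAbove, Fin.castSucc_lt_castSucc_iff] at h1

theorem lt_iff (h : IsMaxInsertion a p c) (i j : Fin n) :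
    c (p.succAbove i) < c (p.succAbove j) ↔ a i < a j := by
  rw [h.apply_succAbove, h.apply_succAbove, Fin.castSucc_lt_castSucc_iff]

/-- Deleting the maximum creates no forbidden occurrence: if it stood between the two neighbouring
positions of an occurrence in `a`, it takes over the role of the larger neighbour in `c`; otherwise
the neighbours stay neighbours. -/
theorem isFishburn3142_left (h : IsMaxInsertion a p c) (hc : IsFishburn3142 c) :
    IsFishburn3142 a := by
  constructor
  · rintro ⟨i, i', j, h1, h2, h3, h4⟩
    have hj : (c (p.succAbove j) : ℕ) + 1 = c (p.succAbove i) := by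
      rw [h.apply_succAbove, h.apply_succAbove]
      exact h3
    have hs := Fin.strictMono_succAbove p
    by_cases hp : (p : ℕ) = i + 1
    · have e1 : (p.succAbove i : ℕ) = i := by
        rw [Fin.succAbove_of_castSucc_lt _ _ (Fin.lt_def.2 (by simp [hp]))]
        rfl
      refine hc.1 ⟨p.succAbove i, p, p.succAbove j, by omega, ?_, hj, ?_⟩
      · rw [Fin.lt_succAbove_iff_le_castSucc, Fin.le_def, Fin.val_castSucc]
        have := Fin.lt_def.1 h2
        omega
      · rw [h.apply_self, h.apply_succAbove]
        exact Fin.castSucc_lt_last _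
    · refine hc.1 ⟨p.succAbove i, p.succAbove i', p.succAbove j, ?_, hs h2, hj, ?_⟩
      · rcases lt_or_ge i.castSucc p with hlt | hge
        · rw [Fin.succAbove_of_castSucc_lt _ _ hlt, Fin.succAbove_of_castSucc_lt, Fin.val_castSucc,
            Fin.val_castSucc, h1]
          rw [Fin.lt_def, Fin.val_castSucc] at hlt ⊢
          omega
        · rw [Fin.succAbove_of_le_castSucc _ _ hge, Fin.succAbove_of_le_castSucc, Fin.val_succ,
            Fin.val_succ, h1]
          rw [Fin.le_def, Fin.val_castSucc] at hge ⊢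
          omega
      · rwa [h.lt_iff]
  · intro hp
    obtain ⟨i, j, k, l, h1, h2, h3, h4, h5, h6⟩ := (containsPattern_3142_iff _).1 hp
    have hs := Fin.strictMono_succAbove p
    exact hc.2 ((containsPattern_3142_iff _).2 ⟨_, _, _, _, hs h1, hs h2, hs h3,
      (h.lt_iff _ _).2 h4, (h.lt_iff _ _).2 h5, (h.lt_iff _ _).2 h6⟩)

/-- In a new occurrence the maximum could only be the ascent top or the letter `4`. Either way some
letter before the site would exceed one after it, contrary to the split. -/
theorem isFishburn3142_right (h : IsMaxInsertion a p c) (ha : IsFishburn3142 a)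
    (hs : IsSplit a p) : IsFishburn3142 c := by
  have hlt : ∀ i j, i < p → p < j → c i < c j := by
    intro i j hi hj
    obtain ⟨i, rfl⟩ := Fin.exists_succAbove_eq hi.ne
    obtain ⟨j, rfl⟩ := Fin.exists_succAbove_eq hj.ne'
    rw [h.lt_iff]
    exact hs i j ((Fin.succAbove_lt_iff_castSucc_lt p i).1 hi)
      ((Fin.lt_succAbove_iff_le_castSucc p j).1 hj)
  have hmax : ∀ i, c i ≤ c p := fun i => by rw [h.apply_self]; exact Fin.le_last _
  have hmono := Fin.strictMono_succAbove p
  constructor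
  · rintro ⟨i, i', j, h1, h2, h3, h4⟩
    have hip : i ≠ p := fun e => absurd (e ▸ h4) (not_lt.2 (hmax i'))
    have hjp : j ≠ p := fun e => by
      have := Fin.le_def.1 (hmax i)
      rw [e] at h3
      omega
    have hi'p : i' ≠ p := fun e => by
      have hi : i < p := by rw [← e, Fin.lt_def]; omega
      have := Fin.lt_def.1 (hlt i j hi (e ▸ h2))
      omega
    obtain ⟨i, rfl⟩ := Fin.exists_succAbove_eq hip
    obtain ⟨i', rfl⟩ := Fin.exists_succAbove_eq hi'p
    obtain ⟨j, rfl⟩ := Fin.exists_succAbove_eq hjp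
    refine ha.1 ⟨i, i', j, ?_, hmono.lt_iff_lt.1 h2, ?_, (h.lt_iff _ _).1 h4⟩
    · have hi : i < i' := hmono.lt_iff_lt.1 (by rw [Fin.lt_def]; omega)
      rw [Fin.lt_def] at hi
      rcases lt_or_ge i.castSucc p with ha | ha <;> rcases lt_or_ge i'.castSucc p with hb | hb
      · rwa [Fin.succAbove_of_castSucc_lt _ _ ha, Fin.succAbove_of_castSucc_lt _ _ hb] at h1
      · rw [Fin.succAbove_of_castSucc_lt _ _ ha, Fin.succAbove_of_le_castSucc _ _ hb,
          Fin.val_succ, Fin.val_castSucc] at h1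
        omega
      · rw [Fin.le_def, Fin.val_castSucc] at ha
        rw [Fin.lt_def, Fin.val_castSucc] at hb
        omega
      · rw [Fin.succAbove_of_le_castSucc _ _ ha, Fin.succAbove_of_le_castSucc _ _ hb,
          Fin.val_succ, Fin.val_succ] at h1
        omega
    · rw [h.apply_succAbove, h.apply_succAbove] at h3
      exact h3
  · intro hp
    obtain ⟨i, j, k, l, h1, h2, h3, h4, h5, h6⟩ := (containsPattern_3142_iff _).1 hp
    have hip : i ≠ p := fun e => absurd (e ▸ h6) (not_lt.2 (hmax _))
    have hjp : j ≠ p := fun e => absurd (e ▸ h4) (not_lt.2 (hmax _))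
    have hlp : l ≠ p := fun e => absurd (e ▸ h5) (not_lt.2 (hmax _))
    by_cases hkp : k = p
    · subst hkp
      exact absurd (hlt i l (h1.trans h2) h3) (not_lt.2 h5.le)
    obtain ⟨i, rfl⟩ := Fin.exists_succAbove_eq hip
    obtain ⟨j, rfl⟩ := Fin.exists_succAbove_eq hjp
    obtain ⟨k, rfl⟩ := Fin.exists_succAbove_eq hkp
    obtain ⟨l, rfl⟩ := Fin.exists_succAbove_eq hlp
    rw [h.lt_iff] at h4 h5 h6
    exact ha.2 ((containsPattern_3142_iff _).2 ⟨i, j, k, l, hmono.lt_iff_lt.1 h1,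
      hmono.lt_iff_lt.1 h2, hmono.lt_iff_lt.1 h3, h4, h5, h6⟩)

theorem ncard_setOf (P : Fin (n + 1) → Prop) [Decidable (P p)] :
    {i | P i}.ncard = {i : Fin n | P (p.succAbove i)}.ncard + if P p then 1 else 0 := by
  have himg : (p.succAbove '' {i : Fin n | P (p.succAbove i)}).ncard =
      {i : Fin n | P (p.succAbove i)}.ncard :=
    Set.ncard_image_of_injective _ Fin.succAbove_right_injective
  split_ifs with h
  · rw [← himg, ← Set.ncard_insert_of_notMem (a := p)]
    · congr 1
      ext i
      refine Fin.succAboveCases p (by simpa using h) (fun i => ?_) i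
      simp [Fin.succAbove_ne]
    · rintro ⟨i, -, hi⟩
      exact Fin.succAbove_ne p i hi
  · rw [← himg, add_zero]
    congr 1
    ext i
    refine Fin.succAboveCases p ?_ (fun i => ?_) i
    · simp only [Set.mem_ofPred_eq, h, Set.mem_image, false_iff]
      rintro ⟨i, -, hi⟩
      exact Fin.succAbove_ne p i hi
    · simp

theorem wordLmax_eq (h : IsMaxInsertion a p c) :
    wordLmax c = {i ∈ lmaxSet a | i.castSucc < p}.ncard + 1 := by
  classical
  rw [wordLmax, ncard_setOf (p := p), if_pos (show ∀ j < p, c j < c p from h.mem_lmaxSet)]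
  congr 2
  ext i
  constructor
  · intro hi
    refine ⟨fun j hj => (h.lt_iff j i).1 (hi _ (Fin.strictMono_succAbove p hj)), ?_⟩
    by_contra hp
    have := hi p ((Fin.lt_succAbove_iff_le_castSucc p i).2 (not_lt.1 hp))
    rw [h.apply_self] at this
    exact absurd this (not_lt.2 (Fin.le_last _))
  · rintro ⟨hi, hp⟩ j hj
    rw [← Fin.succAbove_lt_iff_castSucc_lt] at hp
    obtain ⟨j, rfl⟩ := Fin.exists_succAbove_eq (hj.trans hp).ne
    exact (h.lt_iff j i).2 (hi j ((Fin.strictMono_succAbove p).lt_iff_lt.1 hj))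

theorem wordRmin_eq (h : IsMaxInsertion a p c) :
    wordRmin c = wordRmin a + if p = Fin.last n then 1 else 0 := by
  classical
  rw [wordRmin, ncard_setOf (p := p), wordRmin]
  congr 2
  · ext i
    constructor
    · exact fun hi j hj => (h.lt_iff i j).1 (hi _ (Fin.strictMono_succAbove p hj))
    · intro hi j hj
      by_cases hjp : j = p
      · rw [hjp, h.apply_self, h.apply_succAbove]
        exact Fin.castSucc_lt_last _
      · obtain ⟨j, rfl⟩ := Fin.exists_succAbove_eq hjp
        exact (h.lt_iff i j).2 (hi j ((Fin.strictMono_succAbove p).lt_iff_lt.1 hj))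
  · rw [eq_iff_iff]
    constructor
    · intro hp
      by_contra hne
      have := hp (Fin.last n) (lt_of_le_of_ne (Fin.le_last _) hne)
      rw [h.apply_self] at this
      exact absurd this (not_lt.2 (Fin.le_last _))
    · rintro rfl j hj
      exact absurd hj (not_lt.2 (Fin.le_last _))

/-- The first `k` letters are decreasing. -/
def IsDescendingPrefix {m : ℕ} (w : Fin n → Fin m) (k : ℕ) : Prop :=
  k ≤ n ∧ ∀ i j : Fin n, i < j → (j : ℕ) < k → w j < w i

theorem wordIdr_spec {m : ℕ} (w : Fin n → Fin m) : IsDescendingPrefix w (wordIdr w) :=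
  Nat.sSup_mem (s := {k | IsDescendingPrefix w k})
    ⟨0, Nat.zero_le _, fun _ _ _ h => absurd h (Nat.not_lt_zero _)⟩ ⟨n, fun _ hk => hk.1⟩

theorem IsDescendingPrefix.le_wordIdr {m : ℕ} {w : Fin n → Fin m} {k : ℕ}
    (h : IsDescendingPrefix w k) : k ≤ wordIdr w :=
  le_csSup (s := {k | IsDescendingPrefix w k}) ⟨n, fun _ hk => hk.1⟩ h

theorem wordIdr_eq_zero (h : IsMaxInsertion a 0 c) : wordIdr c = wordIdr a + 1 := by
  apply le_antisymm
  · rcases hk : wordIdr c with _ | k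
    · exact Nat.zero_le _
    · have hc := wordIdr_spec c
      rw [hk] at hc
      refine Nat.succ_le_succ (IsDescendingPrefix.le_wordIdr
        ⟨Nat.le_of_succ_le_succ hc.1, fun i j hij hj => ?_⟩)
      have := hc.2 i.succ j.succ (Fin.succ_lt_succ_iff.2 hij)
        (by rw [Fin.val_succ]; omega)
      rwa [← Fin.succAbove_zero, h.lt_iff] at this
  · have ha := wordIdr_spec a
    refine IsDescendingPrefix.le_wordIdr ⟨Nat.succ_le_succ ha.1, fun i j hij hj => ?_⟩
    obtain ⟨j, rfl⟩ := Fin.exists_succ_eq.2 (Fin.pos_iff_ne_zero.1 (lt_of_le_of_lt (Fin.zero_le i) hij))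
    revert hij
    refine Fin.cases (fun _ => ?_) (fun i hij => ?_) i
    · rw [h.apply_self, ← Fin.succAbove_zero, h.apply_succAbove]
      exact Fin.castSucc_lt_last _
    · rw [← Fin.succAbove_zero, h.lt_iff]
      exact ha.2 i j (Fin.succ_lt_succ_iff.1 hij) (by rw [Fin.val_succ] at hj; omega)

/-- Both descending runs stop before the site: in `c` because the maximum cannot follow another
letter of the run, in `a` because its first letter is smaller than any letter after the site. -/
theorem wordIdr_eq_of_ne_zero (h : IsMaxInsertion a p c) (hs : IsSplit a p) (hp : p ≠ 0) :
    wordIdr c = wordIdr a := by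
  have hp0 : 0 < (p : ℕ) := Nat.pos_of_ne_zero fun e => hp (Fin.ext e)
  have hcast : ∀ i : Fin n, (i : ℕ) < p → p.succAbove i = i.castSucc := fun i hi =>
    Fin.succAbove_of_castSucc_lt _ _ (Fin.lt_def.2 hi)
  apply le_antisymm
  · have hc := wordIdr_spec c
    have hk : wordIdr c ≤ p := by
      by_contra! hlt
      have h1 := hc.2 0 p (Fin.pos_iff_ne_zero.2 hp) hlt
      rw [h.apply_self] at h1
      exact absurd h1 (not_lt.2 (Fin.le_last _))
    refine IsDescendingPrefix.le_wordIdr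
      ⟨hk.trans (Nat.lt_succ_iff.1 p.2), fun i j hij hj => ?_⟩
    rw [Fin.lt_def] at hij
    have := hc.2 i.castSucc j.castSucc hij hj
    rwa [← hcast i (by omega), ← hcast j (by omega), h.lt_iff] at this
  · have ha := wordIdr_spec a
    have hk : wordIdr a ≤ p := by
      by_contra! hlt
      have hpn : (p : ℕ) < n := hlt.trans_le ha.1
      have h1 := ha.2 ⟨0, by omega⟩ ⟨p, hpn⟩ (Fin.lt_def.2 hp0) hlt
      exact absurd h1 (not_lt.2 (hs ⟨0, by omega⟩ ⟨p, hpn⟩ (Fin.lt_def.2 hp0) le_rfl).le)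
    refine IsDescendingPrefix.le_wordIdr ⟨ha.1.trans (Nat.le_succ n), fun i j hij hj => ?_⟩
    rw [Fin.lt_def] at hij
    have hj' := hj.trans_le hk
    have hjp := Fin.lt_def.2 hj'
    obtain ⟨i, rfl⟩ := Fin.exists_succAbove_eq (Fin.lt_def.2 (hij.trans hj')).ne
    obtain ⟨j, rfl⟩ := Fin.exists_succAbove_eq hjp.ne
    have hij' := (Fin.strictMono_succAbove p).lt_iff_lt.1 (Fin.lt_def.2 hij)
    rw [h.lt_iff]
    rw [hcast j ((Fin.succAbove_lt_iff_castSucc_lt p j).1 hjp)] at hj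
    exact ha.2 i j hij' hj

/-- A split site other than the end is itself the position of a left-to-right maximum, so the count
jumps when it is passed. Hence the state determines the site. -/
theorem ncard_lmaxSet_lt (h : IsSplit a p) (hlt : p < p') :
    {i ∈ lmaxSet a | i.castSucc < p}.ncard < {i ∈ lmaxSet a | i.castSucc < p'}.ncard := by
  obtain ⟨l, rfl⟩ := Fin.eq_castSucc_of_ne_last (hlt.trans_le (Fin.le_last p')).ne
  exact Set.ncard_lt_ncard ⟨fun i hi => ⟨hi.1, hi.2.trans hlt⟩,
    fun hsub => lt_irrefl _ (hsub ⟨h.mem_lmaxSet, hlt⟩).2⟩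

theorem eq_of_ncard_lmaxSet_eq (h : IsSplit a p) (h' : IsSplit a p')
    (he : {i ∈ lmaxSet a | i.castSucc < p}.ncard = {i ∈ lmaxSet a | i.castSucc < p'}.ncard) :
    p = p' := by
  rcases lt_trichotomy p p' with hlt | heq | hgt
  · exact absurd he (ncard_lmaxSet_lt h hlt).ne
  · exact heq
  · exact absurd he (ncard_lmaxSet_lt h' hgt).ne'

theorem setOf_lt_last (a : Equiv.Perm (Fin n)) :
    {i ∈ lmaxSet a | i.castSucc < Fin.last n} = lmaxSet a :=
  Set.ext fun i => ⟨fun hi => hi.1, fun hi => ⟨hi, Fin.castSucc_lt_last i⟩⟩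

theorem isSplit_zero (a : Equiv.Perm (Fin n)) : IsSplit a 0 := fun _ _ hi _ =>
  absurd hi (Fin.not_lt_zero _)

end IsMaxInsertion

end Insert

open IsMaxInsertion in
/-- The generating tree of the Fishburn permutations avoiding 3142. -/
noncomputable def fishburnTree : CatalanTree (FishburnAvoiding ![3, 1, 4, 2])
    (fun _ a => wordRmin a.1) (fun _ a => wordIdr a.1) (fun _ a => wordLmax a.1) 1 0 where
  nonempty_zero := ⟨⟨1, fun ⟨i, _⟩ => i.elim0,
    fun h => (containsPattern_3142_iff _).1 h |>.elim fun i => i.elim0⟩⟩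
  subsingleton_zero := ⟨fun a b => Subtype.ext (Subsingleton.elim _ _)⟩
  zero a := ⟨by simp [wordRmin, Set.eq_empty_of_isEmpty],
    Nat.eq_zero_of_le_zero (wordIdr_spec a.1).1,
    by simp [wordLmax, Set.eq_empty_of_isEmpty]⟩
  parent n c := ⟨(exists_isMaxInsertion_parent c.1).choose,
    isFishburn3142_left (exists_isMaxInsertion_parent c.1).choose_spec c.2⟩
  st_pos n c := by
    have h := (exists_isMaxInsertion_parent c.1).choose_spec
    rw [h.wordLmax_eq]
    omega
  st_le n c := by
    have h := (exists_isMaxInsertion_parent c.1).choose_spec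
    rw [h.wordLmax_eq]
    exact Nat.succ_le_succ (Set.ncard_le_ncard (Set.sep_subset _ _))
  exists_child n a j hj hle := by
    -- Inserting at a site keeps exactly the left-to-right maxima before it and adds the new letter,
    -- so `j - 1` of them must precede the site.
    have hsite : ∃ p, IsSplit a.1 p ∧ {i ∈ lmaxSet a.1 | i.castSucc < p}.ncard = j - 1 := by
      rcases Nat.lt_or_ge (j - 1) (lmaxSet a.1).ncard with hlt | hge
      · obtain ⟨l, hl, hl'⟩ := exists_mem_ncard_lt hlt
        exact ⟨l.castSucc, IsFishburn3142.isSplit_of_mem_lmaxSet a.2 hl, hl'⟩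
      · refine ⟨Fin.last n, isSplit_last _, ?_⟩
        rw [setOf_lt_last]
        change j ≤ (lmaxSet a.1).ncard + 1 at hle
        omega
    obtain ⟨p, hp, hp'⟩ := hsite
    obtain ⟨c, hc⟩ := exists_isMaxInsertion_child a.1 p
    refine ⟨⟨c, isFishburn3142_right hc a.2 hp⟩, Subtype.ext ?_, ?_⟩
    · exact ((exists_isMaxInsertion_parent c).choose_spec).eq_left hc
    · rw [hc.wordLmax_eq]
      omega
  child_unique n c c' h1 h2 := by
    have h := (exists_isMaxInsertion_parent c.1).choose_spec
    have h' := (exists_isMaxInsertion_parent c'.1).choose_spec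
    have hs := h.isSplit c.2
    have hs' := h'.isSplit c'.2
    rw [h.wordLmax_eq, h'.wordLmax_eq, Nat.add_right_cancel_iff] at h2
    have he : (exists_isMaxInsertion_parent c.1).choose =
      (exists_isMaxInsertion_parent c'.1).choose := congrArg Subtype.val h1
    rw [← he] at h' hs' h2
    have hp := eq_of_ncard_lmaxSet_eq hs hs' h2
    rw [← hp] at h'
    exact Subtype.ext (h.eq_right h')
  s₁_eq n c := by
    have h := (exists_isMaxInsertion_parent c.1).choose_spec
    have hs := h.isSplit c.2
    set a := (exists_isMaxInsertion_parent c.1).choose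
    set p := c.1.symm (Fin.last n)
    rw [h.wordRmin_eq, h.wordLmax_eq]
    congr 1
    have h1 : p = Fin.last n ↔ {i ∈ lmaxSet a | i.castSucc < p}.ncard + 1 = wordLmax a + 1 := by
      have hl : wordLmax a = {i ∈ lmaxSet a | i.castSucc < Fin.last n}.ncard := by
        rw [setOf_lt_last]
        rfl
      rw [hl, Nat.add_right_cancel_iff]
      exact ⟨fun e => by rw [e], eq_of_ncard_lmaxSet_eq hs (isSplit_last a)⟩
    rcases n with _ | n
    · rw [if_pos (Subsingleton.elim (α := Fin 1) _ _), if_pos rfl]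
    · rw [if_neg (Nat.succ_ne_zero n)]
      simp only [h1]
      rfl
  s₂_eq n c := by
    have h := (exists_isMaxInsertion_parent c.1).choose_spec
    have hs := h.isSplit c.2
    set a := (exists_isMaxInsertion_parent c.1).choose
    set p := c.1.symm (Fin.last n)
    rw [h.wordLmax_eq]
    have h0 : {i ∈ lmaxSet a | i.castSucc < 0}.ncard = 0 := by
      simp
    by_cases hp : p = 0
    · rw [hp] at h ⊢
      rw [h0, if_pos rfl]
      exact h.wordIdr_eq_zero
    · rw [if_neg, add_zero]
      · exact h.wordIdr_eq_of_ne_zero hs hp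
      · rw [Nat.add_eq_right, ← h0]
        exact fun e => hp (eq_of_ncard_lmaxSet_eq hs (isSplit_zero a) e)

theorem genFun_fishburn : genFun (FishburnAvoiding ![3, 1, 4, 2]) (fun {_} a => wordRmin a.1)
    (fun {_} a => wordIdr a.1) (fun {_} a => wordLmax a.1) = catalanGF := by
  have := genFun_eq_catalanGF_of_tree_two fishburnTree
  exact this

end CatalanFishburn

/-! ### Pairs of a staircase sequence and a permutation -/

namespace CatalanFishburn

/-- The relation `τ i < d j`. If `d j` is the number of closers before the opener `j`, and the arc
with opener `i` has the closer `τ i`, this means that the arc `i` lies to the left of the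
arc `j`. -/
def ArcLT {n : ℕ} (d : Fin n → ℕ) (τ : Equiv.Perm (Fin n)) (i j : Fin n) : Prop :=
  (τ i : ℕ) < d j

/-- The pairs `(d, τ)` that describe the Stoimenow matchings. -/
structure IsStoimenowPair {n : ℕ} (d : Fin n → ℕ) (τ : Equiv.Perm (Fin n)) : Prop where
  mono : Monotone d
  le : ∀ i, d i ≤ τ i
  openers : ∀ i j, i < j → d i = d j → τ i < τ j
  closers : ∀ i j, τ i < τ j → (∀ k, (τ i : ℕ) < d k → (τ j : ℕ) < d k) → i < j

/-- A relation contains `3+1`. -/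
def HasThreePlusOne {α : Type} (r : α → α → Prop) : Prop :=
  ∃ x y z w, r x y ∧ r y z ∧ (¬ r x w ∧ ¬ r w x) ∧ (¬ r y w ∧ ¬ r w y) ∧ ¬ r z w ∧ ¬ r w z

/-- A relation contains `N`. -/
def HasN {α : Type} (r : α → α → Prop) : Prop :=
  ∃ a b c d, r a c ∧ r a d ∧ r b d ∧ (¬ r a b ∧ ¬ r b a) ∧ (¬ r b c ∧ ¬ r c b) ∧
    ¬ r c d ∧ ¬ r d c

/-- No two arcs cross in such a way that their openers and their closers lie in different runs. -/
def NoRunCrossing {n : ℕ} (d : Fin n → ℕ) (τ : Equiv.Perm (Fin n)) : Prop :=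
  ∀ x y v, d x < d y → d y ≤ τ x → (τ x : ℕ) < d v → (τ y : ℕ) < d v

section Pairs

variable {n : ℕ} {d : Fin n → ℕ} {τ τ' : Equiv.Perm (Fin n)}

theorem ncard_perm_lt (τ : Equiv.Perm (Fin n)) {v : ℕ} (hv : v ≤ n) :
    {i | (τ i : ℕ) < v}.ncard = v := by
  have : τ '' {i | (τ i : ℕ) < v} = {i : Fin n | (i : ℕ) < v} := by
    ext i
    exact ⟨fun ⟨j, hj, h⟩ => h ▸ hj, fun hi => ⟨τ.symm i, by simpa using hi, by simp⟩⟩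
  rw [← Set.ncard_image_of_injective _ τ.injective, this, ncard_setOf_lt hv]

theorem perm_eq_of_lt_iff (h : ∀ i j, τ i < τ j ↔ τ' i < τ' j) : τ = τ' := by
  ext i
  rw [← ncard_perm_lt τ (τ i).2.le, ← ncard_perm_lt τ' (τ' i).2.le]
  congr 1
  ext j
  exact h j i

theorem exists_perm_eq (τ : Equiv.Perm (Fin n)) {v : ℕ} (hv : v < n) : ∃ i, (τ i : ℕ) = v :=
  ⟨τ.symm ⟨v, hv⟩, by simp⟩

/-- The `d i` arcs that close before opener `i` also open before it, and only `i` openers precede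
it. -/
theorem IsStoimenowPair.isStaircase (h : IsStoimenowPair d τ) : IsStaircase d := by
  refine ⟨h.mono, fun i => ?_⟩
  rw [← ncard_perm_lt τ ((h.le i).trans (τ i).2.le), ← ncard_setOf_lt i.2.le]
  refine Set.ncard_le_ncard fun k hk => ?_
  by_contra hik
  have h1 := h.mono (Fin.le_def.2 (not_lt.1 hik))
  have h2 := h.le k
  have h3 : (τ k : ℕ) < d i := hk
  omega

theorem IsStaircase.isStoimenowPair (h : IsStaircase d) : IsStoimenowPair d 1 :=
  ⟨h.mono, h.le, fun _ _ hij _ => hij, fun _ _ hij _ => hij⟩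

theorem not_hasThreePlusOne_one (h : Monotone d) : ¬ HasThreePlusOne (ArcLT d 1) := by
  rintro ⟨x, y, z, w, hxy, hyz, ⟨hxw, -⟩, -, -, hwz⟩
  simp only [ArcLT, Equiv.Perm.one_apply, not_lt] at *
  have : d y ≤ d w := h (Fin.le_def.2 (by omega))
  omega

/-- Suppose arc `j` is nested in arc `i`. Their openers and their closers lie in different runs, so
an opener `k` separates the two closers. The arc `o` that closes right after the opener run of `i`
lies to the left of `j`. Then `o < j < k` is a chain incomparable with `i`. -/
theorem IsStoimenowPair.eq_one (h : IsStoimenowPair d τ) (h31 : ¬ HasThreePlusOne (ArcLT d τ)) :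
    τ = 1 := by
  have key : ∀ i j, i < j → τ i < τ j := by
    intro i j hij
    by_contra hlt
    have hji : τ j < τ i := lt_of_le_of_ne (not_lt.1 hlt) fun e => hij.ne' (τ.injective e)
    have hsep : ∃ k, (τ j : ℕ) < d k ∧ d k ≤ τ i := by
      by_contra! hno
      exact absurd (h.closers j i hji hno) (not_lt.2 hij.le)
    obtain ⟨k, hk1, hk2⟩ := hsep
    have hd : d i < d j := lt_of_le_of_ne (h.mono hij.le) fun e => hlt (h.openers i j hij e)
    obtain ⟨o, ho⟩ := exists_perm_eq τ ((h.le i).trans_lt (τ i).2)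
    have h1 := h.le i
    have h2 := h.le j
    have h3 := h.le k
    have h4 := h.le o
    rw [Fin.lt_def] at hji
    refine h31 ⟨o, j, k, i, ?_⟩
    simp only [ArcLT]
    omega
  refine perm_eq_of_lt_iff fun i j => ⟨fun hij => ?_, fun hij => key i j hij⟩
  rcases lt_trichotomy i j with h1 | rfl | h1
  · exact h1
  · exact absurd hij (lt_irrefl _)
  · exact absurd hij (key j i h1).asymm

/-- In `N` the incomparable `b` and `c` are arcs crossing across runs, with `d` separating their
closers. Conversely, the arc `o` that owns the first closer after the opener run of `x` supplies the
missing element `a`. -/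
theorem IsStoimenowPair.hasN_iff (h : IsStoimenowPair d τ) :
    HasN (ArcLT d τ) ↔ ¬ NoRunCrossing d τ := by
  constructor
  · rintro ⟨a, b, c, e, h1, h2, h3, h4, h5, h6⟩ hno
    simp only [ArcLT] at *
    have := hno b c e (by omega) (by omega) h3
    omega
  · intro hno
    simp only [NoRunCrossing, not_forall, not_lt, exists_prop] at hno
    obtain ⟨x, y, v, h1, h2, h3, h4⟩ := hno
    obtain ⟨o, ho⟩ := exists_perm_eq τ ((h.le x).trans_lt (τ x).2)
    have e1 := h.le x
    have e2 := h.le y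
    have e3 := h.le v
    have e4 := h.le o
    refine ⟨o, x, y, v, ?_⟩
    simp only [ArcLT]
    omega

/-- For increasing levels `v` of `d`, the set of arcs closed before `v` is forced. If `τ` closes `i`
but not `i'`, and `τ'` does the opposite, then the absence of run crossings gives `d i' ≤ d i` and,
by symmetry, equality. Arcs of one opener run close in a fixed order, which is a contradiction; both
sets have `v` elements, so they coincide. -/
theorem IsStoimenowPair.lt_iff_of_noRunCrossing (h : IsStoimenowPair d τ)
    (h' : IsStoimenowPair d τ') (hc : NoRunCrossing d τ) (hc' : NoRunCrossing d τ') (j i : Fin n) :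
    (τ i : ℕ) < d j ↔ (τ' i : ℕ) < d j := by
  suffices ∀ v, ∀ j, d j = v → ∀ i, (τ i : ℕ) < v ↔ (τ' i : ℕ) < v from this _ j rfl i
  intro v
  induction v using Nat.strong_induction_on with
  | _ v ih =>
  intro j hj
  have hv : v ≤ n := hj ▸ (h.le j).trans (τ j).2.le
  have hle : ∀ σ σ' : Equiv.Perm (Fin n), IsStoimenowPair d σ' → NoRunCrossing d σ →
      (∀ m < v, ∀ j, d j = m → ∀ i, (σ i : ℕ) < m ↔ (σ' i : ℕ) < m) →
      ∀ i i', (σ i : ℕ) < v → ¬ (σ' i : ℕ) < v → (σ' i' : ℕ) < v → ¬ (σ i' : ℕ) < v →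
      d i' ≤ d i := by
    intro σ σ' hσ' hcσ ihσ i i' h1 h2 h3 h4
    by_contra! hlt
    have h5 := hσ'.le i'
    have h6 : d i' ≤ σ i := by
      by_contra! h6
      have := (ihσ (d i') (by omega) i' rfl i).1 h6
      omega
    exact h4 (hj ▸ hcσ i i' j hlt h6 (hj ▸ h1))
  have hdiff : ∀ i i', (τ i : ℕ) < v → ¬ (τ' i : ℕ) < v → (τ' i' : ℕ) < v →
      ¬ (τ i' : ℕ) < v → False := by
    intro i i' h1 h2 h3 h4
    have e1 := hle τ τ' h' hc ih i i' h1 h2 h3 h4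
    have e2 := hle τ' τ h hc' (fun m hm j hj i => (ih m hm j hj i).symm) i' i h3 h4 h1 h2
    rcases lt_trichotomy i i' with hlt | rfl | hgt
    · have := Fin.lt_def.1 (h'.openers i i' hlt (le_antisymm e2 e1))
      omega
    · exact h4 h1
    · have := Fin.lt_def.1 (h.openers i' i hgt (le_antisymm e1 e2))
      omega
  have hset : {i | (τ i : ℕ) < v} = {i | (τ' i : ℕ) < v} := by
    by_cases hsub : {i | (τ i : ℕ) < v} ⊆ {i | (τ' i : ℕ) < v}
    · exact Set.eq_of_subset_of_ncard_le hsub (by rw [ncard_perm_lt τ hv, ncard_perm_lt τ' hv])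
    · obtain ⟨i, hi, hi'⟩ := Set.not_subset.1 hsub
      refine (Set.eq_of_subset_of_ncard_le (fun i' h3 => ?_)
        (by rw [ncard_perm_lt τ hv, ncard_perm_lt τ' hv])).symm
      by_contra h4
      exact hdiff i i' hi hi' h3 h4
  exact fun i => Set.ext_iff.1 hset i

/-- Closers in different runs are compared through the opener between them; inside a run, the order
of the openers decides. -/
theorem IsStoimenowPair.lt_of_lt (h : IsStoimenowPair d τ) (h' : IsStoimenowPair d τ')
    (hiff : ∀ j i, (τ i : ℕ) < d j ↔ (τ' i : ℕ) < d j) {i j : Fin n} (hij : τ i < τ j) :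
    τ' i < τ' j := by
  by_cases hsep : ∃ k, (τ i : ℕ) < d k ∧ d k ≤ τ j
  · obtain ⟨k, h1, h2⟩ := hsep
    have h3 := (hiff k i).1 h1
    have h4 := mt (hiff k j).2 (not_lt.2 h2)
    rw [Fin.lt_def]
    omega
  · push Not at hsep
    have hlt := h.closers i j hij hsep
    by_contra hno
    have hji : τ' j < τ' i := lt_of_le_of_ne (not_lt.1 hno) fun e => hlt.ne' (τ'.injective e)
    refine absurd (h'.closers j i hji fun k hk => ?_) (not_lt.2 hlt.le)
    have := (hiff k j).2 hk
    exact (hiff k i).1 ((Fin.lt_def.1 hij).trans this)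

theorem IsStoimenowPair.eq_of_noRunCrossing (h : IsStoimenowPair d τ) (h' : IsStoimenowPair d τ')
    (hc : NoRunCrossing d τ) (hc' : NoRunCrossing d τ') : τ = τ' := by
  have hiff := h.lt_iff_of_noRunCrossing h' hc hc'
  exact perm_eq_of_lt_iff fun i j => ⟨h.lt_of_lt h' hiff,
    h'.lt_of_lt h fun j i => (hiff j i).symm⟩

theorem sum_mul_swap (f : Fin n → ℤ) (g : Fin n → ℤ) (τ : Equiv.Perm (Fin n)) {x y : Fin n}
    (hxy : x ≠ y) : ∑ i, f i * g ((τ * Equiv.swap x y) i) =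
      ∑ i, f i * g (τ i) + (f x - f y) * (g (τ y) - g (τ x)) := by
  rw [← sub_eq_iff_eq_add', ← Finset.sum_sub_distrib, Fintype.sum_eq_add x y hxy]
  · simp only [Equiv.Perm.mul_apply, Equiv.swap_apply_left, Equiv.swap_apply_right]
    ring
  · rintro i ⟨hx, hy⟩
    simp [Equiv.swap_apply_of_ne_of_ne hx hy]

/-- An extremal choice. Among the permutations with `d i ≤ τ i`, take one maximal for `(P, Q)`
lexicographically. Here `c` numbers the closers by how many openers precede them, hence is constant
on runs. Undoing a run crossing would increase `P`; undoing a nesting inside a run of openers or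
closers keeps `P` and increases `Q`. -/
theorem IsStaircase.exists_noRunCrossing (h : IsStaircase d) :
    ∃ τ, IsStoimenowPair d τ ∧ NoRunCrossing d τ := by
  classical
  let c : Fin n → ℤ := fun j => ((Finset.univ.filter fun k => d k ≤ j).card : ℤ)
  let P : Equiv.Perm (Fin n) → ℤ := fun τ => ∑ i, -(d i : ℤ) * c (τ i)
  let Q : Equiv.Perm (Fin n) → ℤ := fun τ => ∑ i : Fin n, ((i : ℕ) : ℤ) * ((τ i : ℕ) : ℤ)
  obtain ⟨τ, hτ, hmax⟩ := Finset.exists_max_image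
    (Finset.univ.filter fun τ : Equiv.Perm (Fin n) => ∀ i, d i ≤ τ i)
    (fun τ => toLex (P τ, Q τ)) ⟨1, by simpa using h.le⟩
  simp only [Finset.mem_filter, Finset.mem_univ, true_and] at hτ hmax
  have hswap : ∀ x y, x ≠ y → d x ≤ τ y → d y ≤ τ x →
      ¬ (0 < (-(d x : ℤ) - -(d y : ℤ)) * (c (τ y) - c (τ x)) ∨
        ((-(d x : ℤ) - -(d y : ℤ)) * (c (τ y) - c (τ x)) = 0 ∧
          0 < (((x : ℕ) : ℤ) - ((y : ℕ) : ℤ)) * (((τ y : ℕ) : ℤ) - ((τ x : ℕ) : ℤ)))) := by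
    intro x y hxy h1 h2 hlt
    have hle := hmax (τ * Equiv.swap x y) (fun i => by
      rw [Equiv.Perm.mul_apply]
      rcases eq_or_ne i x with rfl | hx
      · rwa [Equiv.swap_apply_left]
      rcases eq_or_ne i y with rfl | hy
      · rwa [Equiv.swap_apply_right]
      rw [Equiv.swap_apply_of_ne_of_ne hx hy]
      exact hτ i)
    rw [← not_lt, Prod.Lex.toLex_lt_toLex] at hle
    apply hle
    have e1 : P (τ * Equiv.swap x y) = _ := sum_mul_swap (fun i => -(d i : ℤ)) c τ hxy
    have e2 : Q (τ * Equiv.swap x y) = _ :=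
      sum_mul_swap (fun i => ((i : ℕ) : ℤ)) (fun i => ((i : ℕ) : ℤ)) τ hxy
    change P τ < P (τ * Equiv.swap x y) ∨ P τ = P (τ * Equiv.swap x y) ∧
      Q τ < Q (τ * Equiv.swap x y)
    rw [e1, e2]
    change P τ < P τ + _ ∨ P τ = P τ + _ ∧ Q τ < Q τ + _
    rcases hlt with hlt | ⟨h0, hlt⟩
    · exact Or.inl (by linarith)
    · exact Or.inr ⟨by linarith, by linarith⟩
  have hcle : ∀ a b : Fin n, a ≤ b → c a ≤ c b := fun a b hab => by
    have := Fin.le_def.1 hab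
    exact Nat.cast_le.2 (Finset.card_le_card (Finset.monotone_filter_right _
      fun k _ hk => le_trans hk this))
  have hclt : ∀ (a b : Fin n) k, (a : ℕ) < d k → d k ≤ b → c a < c b := fun a b k h1 h2 => by
    refine Nat.cast_lt.2 (Finset.card_lt_card (Finset.ssubset_iff_of_subset
      (Finset.monotone_filter_right _ fun l _ hl => ?_) |>.2 ⟨k, ?_, ?_⟩))
    · exact le_trans hl (by omega)
    · simpa using h2
    · simpa using h1
  have hceq : ∀ a b : Fin n, a ≤ b → (∀ k, (a : ℕ) < d k → (b : ℕ) < d k) → c a = c b :=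
    fun a b hab hno => by
      have := Fin.le_def.1 hab
      simp only [c]
      congr 2
      ext k
      simp only [Finset.mem_filter, Finset.mem_univ, true_and]
      refine ⟨fun hk => hk.trans this, fun hk => ?_⟩
      by_contra! hlt
      exact absurd (hno k hlt) (not_lt.2 hk)
  refine ⟨τ, ⟨h.mono, hτ, fun i j hij hd => ?_, fun i j hij hno => ?_⟩,
    fun x y v h1 h2 h3 => ?_⟩
  · by_contra hlt
    have hji := Fin.lt_def.1 (lt_of_le_of_ne (not_lt.1 hlt) fun e => hij.ne' (τ.injective e))
    refine hswap i j hij.ne (hd ▸ hτ j) (hd ▸ hτ i) (Or.inr ⟨by rw [hd]; ring, ?_⟩)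
    rw [Fin.lt_def] at hij
    exact mul_pos_of_neg_of_neg (by omega) (by omega)
  · by_contra hlt
    have hne : i ≠ j := fun e => by rw [e] at hij; exact lt_irrefl _ hij
    have hji : j < i := lt_of_le_of_ne (not_lt.1 hlt) hne.symm
    have h1 := hτ i
    have h2 := h.mono hji.le
    have h3 := hceq _ _ hij.le hno
    rw [Fin.lt_def] at hij hji
    refine hswap i j hne (by omega) (by omega) (Or.inr ⟨by rw [h3]; ring, ?_⟩)
    exact mul_pos (by omega) (by omega)
  · by_contra! h4
    have h5 := hclt _ _ v h3 h4
    refine hswap x y (fun e => by rw [e] at h1; exact lt_irrefl _ h1) (by omega) h2 (Or.inl ?_)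
    exact mul_pos (by omega) (by omega)

end Pairs

end CatalanFishburn

/-! ### Interval orders -/

namespace CatalanFishburn

theorem genFun_congr {A B : ℕ → Type} {s₁ s₂ s₃ : ∀ {n : ℕ}, A n → ℕ} {r₁ r₂ r₃ : ∀ {n : ℕ}, B n → ℕ}
    (f : ∀ n, A n → B n) (hf : ∀ n, (f n).Bijective) (h₁ : ∀ n a, r₁ (f n a) = s₁ a)
    (h₂ : ∀ n a, r₂ (f n a) = s₂ a) (h₃ : ∀ n a, r₃ (f n a) = s₃ a) :
    genFun B r₁ r₂ r₃ = genFun A s₁ s₂ s₃ := by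
  funext m
  simp only [genFun]
  congr 1
  refine (Nat.card_congr ((Equiv.ofBijective _ (hf (m 3))).subtypeEquiv fun a => ?_)).symm
  rw [Equiv.ofBijective_apply, h₁, h₂, h₃]

section Relations

variable {X : Type} [PartialOrder X]

theorem posetAvoids_threePlusOne_iff :
    PosetAvoids ThreePlusOne X ↔ ¬ HasThreePlusOne fun x y : X => x < y := by
  rw [← not_iff_not, not_not, PosetAvoids, not_isEmpty_iff]
  constructor
  · rintro ⟨f⟩
    refine ⟨f (.inl 0), f (.inl 1), f (.inl 2), f (.inr 0), ?_⟩
    simp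
  · rintro ⟨x, y, z, w, hxy, hyz, ⟨h1, h2⟩, ⟨h3, h4⟩, h5, h6⟩
    have e1 : ¬ x ≤ w := fun h => h.lt_or_eq.elim h1 (by rintro rfl; exact h4 hxy)
    have e2 : ¬ y ≤ w := fun h => e1 (hxy.le.trans h)
    have e3 : ¬ z ≤ w := fun h => e2 (hyz.le.trans h)
    have e4 : ¬ w ≤ z := fun h => h.lt_or_eq.elim h6 (by rintro rfl; exact h3 hyz)
    have e5 : ¬ w ≤ y := fun h => e4 (h.trans hyz.le)
    have e6 : ¬ w ≤ x := fun h => e5 (h.trans hxy.le)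
    refine ⟨OrderEmbedding.ofMapLEIff (Sum.elim ![x, y, z] fun _ => w) ?_⟩
    rintro (i | i) (j | j)
    · fin_cases i <;> fin_cases j <;>
        simp [hxy.le, hyz.le, hxy.not_ge, hyz.not_ge, (hxy.trans hyz).le, (hxy.trans hyz).not_ge]
    · fin_cases i <;> simp [e1, e2, e3]
    · fin_cases j <;> simp [e4, e5, e6]
    · simp [Subsingleton.elim (α := Fin 1) i j]

theorem posetAvoids_N_iff :
    PosetAvoids PosetN X ↔ ¬ HasN fun x y : X => x < y := by
  rw [← not_iff_not, not_not, PosetAvoids, not_isEmpty_iff]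
  have hle : ∀ u v : PosetN, u ≤ v ↔
      u = v ∨ (u = .a ∧ v = .c) ∨ (u = .a ∧ v = .d) ∨ (u = .b ∧ v = .d) := fun _ _ => Iff.rfl
  constructor
  · rintro ⟨f⟩
    refine ⟨f .a, f .b, f .c, f .d, ?_⟩
    simp [lt_iff_le_not_ge, hle]
  · rintro ⟨a, b, c, d, hac, had, hbd, ⟨h1, h2⟩, ⟨h3, h4⟩, h5, h6⟩
    have e1 : ¬ a ≤ b := fun h => h.lt_or_eq.elim h1 (by rintro rfl; exact h3 hac)
    have e2 : ¬ b ≤ a := fun h => h.lt_or_eq.elim h2 (by rintro rfl; exact h3 hac)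
    have e3 : ¬ b ≤ c := fun h => h.lt_or_eq.elim h3 (by rintro rfl; exact h1 hac)
    have e4 : ¬ c ≤ b := fun h => h.lt_or_eq.elim h4 (by rintro rfl; exact h1 hac)
    have e5 : ¬ c ≤ d := fun h => h.lt_or_eq.elim h5 (by rintro rfl; exact h3 hbd)
    have e6 : ¬ d ≤ c := fun h => h.lt_or_eq.elim h6 (by rintro rfl; exact h3 hbd)
    refine ⟨OrderEmbedding.ofMapLEIff (fun u => match u with
      | .a => a | .b => b | .c => c | .d => d) ?_⟩
    intro u v
    cases u <;> cases v <;> simp [hle, hac.le, had.le, hbd.le, hac.not_ge, had.not_ge, hbd.not_ge,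
      e1, e2, e3, e4, e5, e6]

theorem posetAvoids_twoPlusTwo_iff :
    PosetAvoids TwoPlusTwo X ↔ ∀ a b c d : X, a < b → c < d → a < d ∨ c < b := by
  constructor
  · intro h a b c d hab hcd
    by_contra! hno
    obtain ⟨h1, h2⟩ := hno
    have e1 : ¬ a ≤ c := fun h => h1 (h.trans_lt hcd)
    have e2 : ¬ c ≤ a := fun h => h2 (h.trans_lt hab)
    have e3 : ¬ b ≤ d := fun h => h1 (hab.trans_le h)
    have e4 : ¬ d ≤ b := fun h => h2 (hcd.trans_le h)
    have e5 : ¬ a ≤ d := fun h => h.lt_or_eq.elim h1 (by rintro rfl; exact e2 hcd.le)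
    have e6 : ¬ d ≤ a := fun h => e2 (hcd.le.trans h)
    have e7 : ¬ c ≤ b := fun h => h.lt_or_eq.elim h2 (by rintro rfl; exact e1 hab.le)
    have e8 : ¬ b ≤ c := fun h => e1 (hab.le.trans h)
    refine h.false (OrderEmbedding.ofMapLEIff (Sum.elim ![a, b] ![c, d]) ?_)
    rintro (i | i) (j | j) <;> fin_cases i <;> fin_cases j <;>
      simp [hab.le, hcd.le, hab.not_ge, hcd.not_ge, e1, e2, e3, e4, e5, e6, e7, e8]
  · refine fun h => ⟨fun f => ?_⟩
    have := h (f (.inl 0)) (f (.inl 1)) (f (.inr 0)) (f (.inr 1)) (by simp) (by simp)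
    simp at this

end Relations

theorem exists_perm_lt_iff {n : ℕ} {α : Type} [LinearOrder α] (f : Fin n → α)
    (hf : f.Injective) : ∃ τ : Equiv.Perm (Fin n), ∀ i j, τ i < τ j ↔ f i < f j := by
  have h : StrictMono (f ∘ Tuple.sort f) :=
    (Tuple.monotone_sort f).strictMono_of_injective (hf.comp (Tuple.sort f).injective)
  refine ⟨(Tuple.sort f)⁻¹, fun i j => ?_⟩
  rw [← h.lt_iff_lt]
  simp [Function.comp]

section Representation

variable {n : ℕ} {d : Fin n → ℕ} {τ : Equiv.Perm (Fin n)}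

/-- The order on the arcs of the matching of a pair `(d, τ)`. -/
abbrev arcOrder (h : ∀ i, d i ≤ τ i) : PartialOrder (Fin n) where
  le i j := i = j ∨ ArcLT d τ i j
  lt := ArcLT d τ
  le_refl i := Or.inl rfl
  le_trans i j k := by
    rintro (rfl | hij) (rfl | hjk)
    · exact Or.inl rfl
    · exact Or.inr hjk
    · exact Or.inr hij
    · exact Or.inr ((hij.trans_le (h j)).trans hjk)
  le_antisymm i j := by
    rintro (rfl | hij) (hji | hji)
    · rfl
    · rfl
    · exact hji.symm
    · exact absurd ((hij.trans_le (h j)).trans hji) (not_lt.2 (h i))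
  lt_iff_le_not_ge i j := by
    constructor
    · intro hij
      refine ⟨Or.inr hij, ?_⟩
      rintro (rfl | hji)
      · exact absurd hij (not_lt.2 (h _))
      · exact absurd ((hij.trans_le (h j)).trans hji) (not_lt.2 (h i))
    · rintro ⟨rfl | hij, h2⟩
      · exact absurd (Or.inl rfl) h2
      · exact hij

/-- The number of elements below `j` is `d j`, so `d` and `d'` agree up to a permutation; both are
weakly increasing. -/
theorem eq_of_arcLT_iff {d' : Fin n → ℕ} {τ' : Equiv.Perm (Fin n)} (h : IsStoimenowPair d τ)
    (h' : IsStoimenowPair d' τ') (e : Equiv.Perm (Fin n))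
    (he : ∀ i j, ArcLT d τ i j ↔ ArcLT d' τ' (e i) (e j)) : d = d' := by
  have hde : d = d' ∘ e := by
    funext j
    rw [Function.comp, ← ncard_perm_lt τ ((h.le j).trans (τ j).2.le),
      ← ncard_perm_lt (e.trans τ') ((h'.le (e j)).trans (τ' (e j)).2.le)]
    congr 1
    ext i
    exact he i j
  have hm : Monotone (d' ∘ e) := hde ▸ h.mono
  rw [hde]
  exact Tuple.unique_monotone (σ := e) (τ := Equiv.refl _) hm h'.mono

/-- The canonical interval representation. Openers are sorted by increasing strict down-set, closers
by decreasing strict up-set; the secondary keys prevent nestings inside a run. -/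
theorem exists_stoimenowPair {X : Type} [PartialOrder X] (g : Fin n ≃ X)
    (hX : PosetAvoids TwoPlusTwo X) : ∃ (d : Fin n → ℕ) (τ : Equiv.Perm (Fin n)) (e : X ≃ Fin n),
      IsStoimenowPair d τ ∧ ∀ x y, x < y ↔ ArcLT d τ (e x) (e y) := by
  rw [posetAvoids_twoPlusTwo_iff] at hX
  have : Finite X := Finite.of_equiv _ g
  let f : Fin n → ℕ ×ₗ ℕᵒᵈ := fun i =>
    toLex ((Set.Iio (g i)).ncard, OrderDual.toDual (Set.Ioi (g i)).ncard)
  let e : Fin n ≃ X := (Tuple.sort f).trans g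
  have hsort : ∀ i j, i ≤ j → (Set.Iio (e i)).ncard < (Set.Iio (e j)).ncard ∨
      (Set.Iio (e i)).ncard = (Set.Iio (e j)).ncard ∧
        (Set.Ioi (e j)).ncard ≤ (Set.Ioi (e i)).ncard := fun i j hij =>
    Prod.Lex.toLex_le_toLex.1 (Tuple.monotone_sort f hij)
  obtain ⟨τ, hτ⟩ := exists_perm_lt_iff
    (fun i => toLex (OrderDual.toDual (Set.Ioi (e i)).ncard, i))
    (fun i j hij => by simpa using congrArg (fun p => (ofLex p).2) hij)
  have hτ' : ∀ i j, τ i < τ j ↔ (Set.Ioi (e j)).ncard < (Set.Ioi (e i)).ncard ∨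
      (Set.Ioi (e i)).ncard = (Set.Ioi (e j)).ncard ∧ i < j := fun i j => by
    rw [hτ, Prod.Lex.toLex_lt_toLex]
    rfl
  -- Absence of `2+2` makes the strict up-sets a chain under inclusion. Hence the elements below a
  -- given one come first in the order of the closers, which gives `hlt`.
  have htot : ∀ x y : X, ∀ z, x < z → ¬ y < z → (Set.Ioi y).ncard < (Set.Ioi x).ncard :=
    fun x y z h1 h2 => Set.ncard_lt_ncard ⟨fun w hw => (hX x z y w h1 hw).resolve_right h2,
      fun hsub => h2 (hsub h1)⟩
  let d : Fin n → ℕ := fun i => (Set.Iio (e i)).ncard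
  have hd : ∀ j, d j = {i | e i < e j}.ncard := fun j => by
    rw [← Set.ncard_image_of_injective _ e.injective]
    refine congrArg Set.ncard (Set.ext fun x => ?_)
    exact ⟨fun hx => ⟨e.symm x, by simpa using hx, by simp⟩, fun ⟨i, hi, h⟩ => h ▸ hi⟩
  have hlt : ∀ i j, e i < e j ↔ (τ i : ℕ) < d j := by
    intro i j
    constructor
    · intro hij
      have hsub : {k | (τ k : ℕ) < τ i + 1} ⊆ {k | e k < e j} := fun k hk => by
        by_contra hkj
        have := htot (e i) (e k) (e j) hij hkj
        have h2 := (hτ' i k).2 (Or.inl this)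
        exact absurd (Fin.lt_def.1 h2) (not_lt.2 (Nat.lt_succ_iff.1 hk))
      have := Set.ncard_le_ncard hsub
      rwa [ncard_perm_lt τ (τ i).2, ← hd] at this
    · intro hij
      by_contra hno
      have hsub : {k | e k < e j} ⊆ {k | (τ k : ℕ) < τ i} := fun k hk =>
        Fin.lt_def.1 ((hτ' k i).2 (Or.inl (htot _ _ _ hk hno)))
      have := Set.ncard_le_ncard hsub
      rw [ncard_perm_lt τ (τ i).2.le, ← hd] at this
      omega
  refine ⟨d, τ, e.symm, ⟨fun i j hij => ?_, fun i => ?_, fun i j hij hdij => ?_,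
    fun i j hij hno => ?_⟩, fun x y => ?_⟩
  · rcases hsort i j hij with h | h
    exacts [h.le, h.1.le]
  · exact not_lt.1 fun h => lt_irrefl _ ((hlt i i).2 h)
  · rw [hτ']
    rcases hsort i j hij.le with h | h
    · exact absurd hdij h.ne
    · rcases h.2.lt_or_eq with h2 | h2
      · exact Or.inl h2
      · exact Or.inr ⟨h2.symm, hij⟩
  · have hsub : Set.Ioi (e i) ⊆ Set.Ioi (e j) := fun x hx => by
      have := (hlt j (e.symm x)).2 (hno _ ((hlt i (e.symm x)).1 (by simpa using hx)))
      simpa using this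
    have := Set.ncard_le_ncard hsub
    rcases (hτ' i j).1 hij with h | h
    · omega
    · exact h.2
  · have := hlt (e.symm x) (e.symm y)
    rwa [e.apply_symm_apply, e.apply_symm_apply] at this

end Representation

end CatalanFishburn

/-! ### Statistics of interval orders -/

namespace CatalanFishburn

section Fixed

variable {n : ℕ} {d : Fin n → ℕ} {τ : Equiv.Perm (Fin n)}

/-- The `v` arcs closed before opener `v` all open before it, and there are only `v` of those: the
matching splits there. -/
theorem IsStoimenowPair.lt_fixed_iff (h : IsStoimenowPair d τ) {v : Fin n} (hv : d v = v)
    (i : Fin n) : (τ i : ℕ) < v ↔ i < v := by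
  have hsub : {i | (τ i : ℕ) < v} ⊆ {i : Fin n | (i : ℕ) < v} := fun i hi => by
    by_contra hlt
    have h1 := h.mono (Fin.le_def.2 (not_lt.1 hlt))
    have h2 := h.le i
    have h3 : (τ i : ℕ) < v := hi
    omega
  have := Set.eq_of_subset_of_ncard_le hsub
    (by rw [ncard_perm_lt τ v.2.le, ncard_setOf_lt v.2.le])
  exact Set.ext_iff.1 this i

/-- Take the arc `x` of level `v` that closes last. The first opener `y` after its closer must be a
fixed point: an arc `i` still open at `y` either has level `v`, against the choice of `x`, or
crosses `x` across runs. -/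
theorem IsStoimenowPair.exists_last_of_level (h : IsStoimenowPair d τ) (hc : NoRunCrossing d τ)
    {v : Fin n} (hv : d v = v) :
    ∃ x, d x = v ∧ ∀ y, (τ x : ℕ) < d y → ∃ w, d w = w ∧ v < w ∧ w ≤ y := by
  obtain ⟨x, hx, hmax⟩ := (Finset.univ.filter fun x => d x = v).exists_max_image τ
    ⟨v, by simpa using hv⟩
  simp only [Finset.mem_filter, Finset.mem_univ, true_and] at hx hmax
  refine ⟨x, hx, fun y hy => ?_⟩
  induction y using WellFoundedLT.induction with
  | ind y ih =>
  by_cases hex : ∃ y' < y, (τ x : ℕ) < d y'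
  · obtain ⟨y', hlt, hy'⟩ := hex
    obtain ⟨w, hw, hvw, hwy⟩ := ih y' hlt hy'
    exact ⟨w, hw, hvw, hwy.trans hlt.le⟩
  · push Not at hex
    have hxle := h.le x
    have hvy : v < y := by
      by_contra hle
      have := h.mono (not_lt.1 hle)
      omega
    refine ⟨y, ?_, hvy, le_rfl⟩
    by_contra hne
    have hlt : d y < y := lt_of_le_of_ne (h.isStaircase.le y) hne
    have hex2 : ∃ i : Fin n, (i : ℕ) < y ∧ d y ≤ τ i := by
      by_contra! hno
      have := Set.ncard_le_ncard (s := {i : Fin n | (i : ℕ) < y}) (t := {i | (τ i : ℕ) < d y}) hno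
      rw [ncard_setOf_lt y.2.le, ncard_perm_lt τ (hlt.le.trans y.2.le)] at this
      omega
    obtain ⟨i, hiy, hi⟩ := hex2
    have h1 := hex i (Fin.lt_def.2 hiy)
    have hvi : v ≤ i := by
      by_contra hno
      have := (h.lt_fixed_iff hv i).2 (not_le.1 hno)
      omega
    rcases (h.mono hvi).lt_or_eq with h2 | h2
    · have := hc x i y (by omega) h1 hy
      omega
    · have := Fin.le_def.1 (hmax i (by omega))
      omega

end Fixed

section Stats

variable {n : ℕ} {d : Fin n → ℕ} {τ : Equiv.Perm (Fin n)} {X : Type} [PartialOrder X]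

theorem posetMag_eq (h : IsStoimenowPair d τ) (e : X ≃ Fin n)
    (he : ∀ x y, x < y ↔ ArcLT d τ (e x) (e y)) : posetMag X = seqDistinct d := by
  have hIio : ∀ x, Set.Iio x = e ⁻¹' {i | (τ i : ℕ) < d (e x)} := fun x => by
    ext y
    exact he y x
  have : (Set.range fun x : X => Set.Iio x) =
      (fun v => e ⁻¹' {i | (τ i : ℕ) < v}) '' Set.range d := by
    ext s
    constructor
    · rintro ⟨x, rfl⟩
      exact ⟨_, ⟨e x, rfl⟩, (hIio x).symm⟩
    · rintro ⟨_, ⟨i, rfl⟩, rfl⟩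
      exact ⟨e.symm i, by simp [hIio]⟩
  rw [posetMag, this, seqDistinct]
  refine Set.InjOn.ncard_image ?_
  rintro _ ⟨i, rfl⟩ _ ⟨j, rfl⟩ hij
  have := e.surjective.preimage_injective hij
  rw [← ncard_perm_lt τ ((h.le i).trans (τ i).2.le), this,
    ncard_perm_lt τ ((h.le j).trans (τ j).2.le)]

theorem posetMin_eq (e : X ≃ Fin n)
    (he : ∀ x y, x < y ↔ ArcLT d τ (e x) (e y)) : posetMin X = seqZeros d := by
  have : e '' {x : X | IsMin x} = {i | d i = 0} := by
    ext i
    rw [e.image_eq_preimage_symm, Set.mem_preimage, Set.mem_ofPred_eq, Set.mem_ofPred_eq,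
      isMin_iff_forall_not_lt]
    constructor
    · intro hmin
      by_contra hne
      obtain ⟨o, ho⟩ := exists_perm_eq τ (v := 0) (by have := i.2; omega)
      refine hmin (e.symm o) ((he _ _).2 ?_)
      rw [e.apply_symm_apply, e.apply_symm_apply, ArcLT]
      omega
    · intro h0 y hy
      have := (he _ _).1 hy
      rw [e.apply_symm_apply, ArcLT] at this
      omega
  rw [posetMin, seqZeros, ← this, Set.ncard_image_of_injective _ e.injective]

/-- The components start exactly at the fixed points. The supremum in the definition of `posetSsd`
is handled by showing that every decomposition has this number of components and that one exists. -/
theorem posetSsd_eq (h : IsStaircase d) (e : X ≃ Fin n)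
    (he : ∀ x y, x < y ↔ (e x : ℕ) < d (e y)) : posetSsd X = seqFixed d := by
  classical
  have hlt : ∀ x y, x < y → e x < e y := fun x y hxy =>
    Fin.lt_def.2 (((he x y).1 hxy).trans_le (h.le _))
  have hunique : ∀ k, (∃ f : X → Fin k, IsOrdinalDecomposition f) → k = seqFixed d := by
    rintro k ⟨f, hsurj, hord, hirr⟩
    have hmono : ∀ x y, e x ≤ e y → f x ≤ f y := fun x y hxy => by
      by_contra hno
      exact absurd (hlt _ _ (hord _ _ (not_le.1 hno))) (not_lt.2 hxy)
    have hfirst : ∀ x, d (e x) = e x ↔ ∀ y, e y < e x → f y < f x := by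
      intro x
      constructor
      · intro hx y hyx
        by_contra hno
        have hfy : f y = f x := le_antisymm (hmono _ _ hyx.le) (not_lt.1 hno)
        -- At a fixed point everything earlier lies below everything from there on, so a fibre
        -- reaching across it would split.
        refine hirr (f x) ⟨{z | f z = f x ∧ e z < e x}, {z | f z = f x ∧ e x ≤ e z}, ⟨y, hfy, hyx⟩,
          ⟨x, rfl, le_rfl⟩, ?_, ?_⟩
        · ext z
          simp only [Set.mem_union, Set.mem_ofPred_eq, Set.mem_preimage, Set.mem_singleton_iff,
            ← and_or_left, lt_or_ge, and_true]
        · rintro a ⟨-, ha⟩ b ⟨-, hb⟩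
          rw [he]
          have := h.mono hb
          rw [Fin.lt_def] at ha
          omega
      · intro hx
        refine le_antisymm (h.le _) ?_
        by_contra hno
        have h1 : (e x : ℕ) - 1 < n := by have := (e x).2; omega
        have h2 : e (e.symm ⟨(e x : ℕ) - 1, h1⟩) < e x := by
          rw [e.apply_symm_apply, Fin.lt_def]
          change (e x : ℕ) - 1 < e x
          omega
        have h3 := (he _ _).1 (hord _ _ (hx _ h2))
        rw [e.apply_symm_apply] at h3
        change (e x : ℕ) - 1 < _ at h3
        omega
    let φ : {i : Fin n | d i = i} → Fin k := fun i => f (e.symm i.1)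
    have hφ : φ.Bijective := by
      constructor
      · have key : ∀ i j : {i : Fin n | d i = i}, i.1 < j.1 → φ i < φ j := fun i j hij =>
          (hfirst (e.symm j.1)).1 (by rw [e.apply_symm_apply]; exact j.2) _ (by simpa using hij)
        intro i j hij
        rcases lt_trichotomy i.1 j.1 with h1 | h1 | h1
        · exact absurd hij (key i j h1).ne
        · exact Subtype.ext h1
        · exact absurd hij (key j i h1).ne'
      · intro s
        obtain ⟨x, hx⟩ := hsurj s
        obtain ⟨i, hi, hmin⟩ := (Finset.univ.filter fun i => f (e.symm i) = s).exists_min_image id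
          ⟨e x, by simpa using hx⟩
        simp only [Finset.mem_filter, Finset.mem_univ, true_and, id] at hi hmin
        refine ⟨⟨i, ?_⟩, hi⟩
        have := (hfirst (e.symm i)).2 fun y hy => by
          refine lt_of_le_of_ne (hmono _ _ hy.le) fun heq => ?_
          rw [e.apply_symm_apply] at hy
          have := hmin (e y) (by rw [e.symm_apply_apply, heq, hi])
          exact absurd hy (not_lt.2 this)
        rwa [e.apply_symm_apply] at this
    have := Nat.card_congr (Equiv.ofBijective φ hφ)
    rw [Nat.card_fin, Nat.card_coe_set_eq] at this
    exact this.symm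
  have hexists : ∃ f : X → Fin (seqFixed d), IsOrdinalDecomposition f := by
    -- The component of `i` is numbered by the fixed points up to `i`; one is subtracted below
    -- because index `0` is always fixed.
    let c : Fin n → ℕ := fun i => {j : Fin n | d j = j ∧ j ≤ i}.ncard
    have hc : ∀ i, c i - 1 < seqFixed d ∧ 0 < c i := fun i => by
      have h1 : 0 < c i := (Set.ncard_pos).2
        ⟨⟨0, i.pos⟩, Nat.eq_zero_of_le_zero (h.le ⟨0, i.pos⟩), Fin.le_def.2 (Nat.zero_le _)⟩
      have h2 : c i ≤ seqFixed d := Set.ncard_le_ncard fun j hj => hj.1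
      omega
    have hcm : ∀ i j, i ≤ j → c i ≤ c j := fun i j hij =>
      Set.ncard_le_ncard fun k hk => ⟨hk.1, hk.2.trans hij⟩
    have hcf : ∀ i j, i < j → d j = j → c i < c j := fun i j hij hj =>
      Set.ncard_lt_ncard ⟨fun k hk => ⟨hk.1, hk.2.trans hij.le⟩, fun hsub =>
        absurd (hsub (show j ∈ _ from ⟨hj, le_rfl⟩)).2 (not_le.2 hij)⟩
    have hcl : ∀ i j, c i < c j → (i : ℕ) < d j := fun i j hij => by
      by_contra hno
      refine absurd hij (not_lt.2 (Set.ncard_le_ncard fun k hk => ⟨hk.1, ?_⟩))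
      have h1 := h.mono hk.2
      have h2 : d k = k := hk.1
      exact Fin.le_def.2 (by omega)
    let g : Fin n → Fin (seqFixed d) := fun i => ⟨c i - 1, (hc i).1⟩
    have hg : ∀ i j, g i = g j ↔ c i = c j := fun i j => by
      have := (hc i).2
      have := (hc j).2
      rw [Fin.ext_iff]
      change c i - 1 = c j - 1 ↔ _
      omega
    refine ⟨fun x => g (e x), ?_, fun x y hxy => (he x y).2 (hcl _ _ ?_), fun s => ?_⟩
    · have hinj : (fun i : {i : Fin n | d i = i} => g i.1).Injective := by
        intro i j hij
        have hij' := (hg i.1 j.1).1 hij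
        rcases lt_trichotomy i.1 j.1 with h1 | h1 | h1
        · exact absurd hij' (hcf _ _ h1 j.2).ne
        · exact Subtype.ext h1
        · exact absurd hij' (hcf _ _ h1 i.2).ne'
      have hsurj := (hinj.bijective_of_nat_card_le
        (by rw [Nat.card_fin, Nat.card_coe_set_eq]; rfl)).2
      intro s
      obtain ⟨i, hi⟩ := hsurj s
      exact ⟨e.symm i.1, by simpa using hi⟩
    · have h1 := Fin.lt_def.1 hxy
      change c (e x) - 1 < c (e y) - 1 at h1
      omega
    · rintro ⟨A, B, ⟨a, ha⟩, ⟨b, hb⟩, hAB, hord⟩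
      have hfib : ∀ x, x ∈ A ∪ B ↔ g (e x) = s := fun x => by rw [hAB]; rfl
      obtain ⟨m, hm, hmin⟩ := (Finset.univ.filter fun i => e.symm i ∈ B).exists_min_image id
        ⟨e b, by simpa using hb⟩
      simp only [Finset.mem_filter, Finset.mem_univ, true_and, id] at hm hmin
      have hbelow : ∀ i, i < m → (i : ℕ) < d m := fun i hi => by
        rcases (hcm _ _ hi.le).lt_or_eq with h1 | h1
        · exact hcl _ _ h1
        · have h2 : e.symm i ∈ A ∪ B := by
            rw [hfib, e.apply_symm_apply, (hg i m).2 h1]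
            simpa using (hfib (e.symm m)).1 (Or.inr hm)
          rcases h2 with h2 | h2
          · simpa [he] using hord _ h2 _ hm
          · exact absurd hi (not_lt.2 (hmin i h2))
      -- The least index of the upper part `B` is a fixed point, but `A` contains an earlier element
      -- with the same component number.
      have hfix : d m = m := by
        refine le_antisymm (h.le m) ?_
        by_contra hno
        have h1 : (m : ℕ) - 1 < n := by have := m.2; omega
        have h3 := hbelow ⟨(m : ℕ) - 1, h1⟩ (Fin.lt_def.2 (by change (m : ℕ) - 1 < m; omega))
        change (m : ℕ) - 1 < _ at h3
        omega
      have ham := hlt _ _ (hord a ha _ hm)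
      rw [e.apply_symm_apply] at ham
      have h1 := (hfib a).1 (Or.inl ha)
      have h2 := (hfib _).1 (Or.inr hm)
      rw [e.apply_symm_apply] at h2
      exact absurd ((hg _ _).1 (h1.trans h2.symm)) (hcf _ _ ham hfix).ne
  have : {k : ℕ | ∃ f : X → Fin k, IsOrdinalDecomposition f} = {seqFixed d} := by
    ext k
    exact ⟨hunique k, fun hk => by rw [Set.mem_singleton_iff] at hk; rw [hk]; exact hexists⟩
  rw [posetSsd, this, csSup_singleton]

/-- A maximal chain meets every block between consecutive fixed points, because otherwise the arc at
the start of that block could be inserted. Choosing in each block the arc of the first level that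
closes last attains the bound: by `exists_last_of_level` nothing more fits in. -/
theorem posetSmc_eq (h : IsStoimenowPair d τ) (hc : NoRunCrossing d τ) (e : X ≃ Fin n)
    (he : ∀ x y, x < y ↔ ArcLT d τ (e x) (e y)) : posetSmc X = seqFixed d := by
  have : Finite X := Finite.of_equiv _ e.symm
  have hlower : ∀ c : Set X, IsMaxChain (· ≤ ·) c → seqFixed d ≤ c.ncard := by
    intro c hmax
    have hhit : ∀ v : {v : Fin n | d v = v}, ∃ x ∈ c, v.1 ≤ e x ∧
        ∀ w, d w = w → w ≤ e x → w ≤ v.1 := by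
      rintro ⟨v, hv⟩
      by_contra! hno
      have hins : IsChain (· ≤ ·) (insert (e.symm v) c) := by
        refine hmax.1.insert fun z hz _ => ?_
        rcases lt_or_ge (e z) v with hzv | hvz
        · refine Or.inr ((he _ _).2 ?_).le
          rw [e.apply_symm_apply, ArcLT, show d v = v from hv]
          exact (h.lt_fixed_iff hv _).2 hzv
        · obtain ⟨w, hw, hwz, hvw⟩ := hno z hz hvz
          refine Or.inl ((he _ _).2 ?_).le
          rw [e.apply_symm_apply, ArcLT]
          have h1 : (τ v : ℕ) < w := (h.lt_fixed_iff hw _).2 hvw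
          have h2 := h.mono hwz
          omega
      have hmem : e.symm v ∈ c := by
        rw [hmax.2 hins (Set.subset_insert _ _)]
        exact Set.mem_insert _ _
      obtain ⟨w, -, h1, h2⟩ := hno _ hmem (by simp)
      rw [e.apply_symm_apply] at h1
      exact absurd h2 (not_lt.2 h1)
    choose g hgc hg1 hg2 using hhit
    rw [seqFixed, ← Nat.card_coe_set_eq, ← Nat.card_coe_set_eq c]
    refine Nat.card_le_card_of_injective (fun v => (⟨g v, hgc v⟩ : c)) fun v w hvw => ?_
    have hvw' : g v = g w := congrArg Subtype.val hvw
    exact Subtype.ext (le_antisymm (hg2 w v.1 v.2 (hvw' ▸ hg1 v))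
      (hg2 v w.1 w.2 (hvw' ▸ hg1 w)))
  have hexists : ∃ c : Set X, IsMaxChain (· ≤ ·) c ∧ c.ncard = seqFixed d := by
    have hx : ∀ v : {v : Fin n | d v = v}, ∃ x, d x = (v.1 : ℕ) ∧
        ∀ y, (τ x : ℕ) < d y → ∃ w, d w = w ∧ v.1 < w ∧ w ≤ y := fun v =>
      h.exists_last_of_level hc v.2
    choose g hg1 hg2 using hx
    have hgv : ∀ v w, v.1 < w.1 → e.symm (g v) < e.symm (g w) := fun v w hvw => by
      rw [he, e.apply_symm_apply, e.apply_symm_apply, ArcLT, hg1, h.lt_fixed_iff w.2]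
      by_contra hno
      have h1 := h.mono (not_lt.1 hno)
      have h2 : d w.1 = w.1 := w.2
      rw [hg1, h2] at h1
      exact absurd hvw (not_lt.2 (Fin.le_def.2 h1))
    refine ⟨Set.range fun v => e.symm (g v), ⟨?_, fun t ht hsub => ?_⟩, ?_⟩
    · rintro _ ⟨v, rfl⟩ _ ⟨w, rfl⟩ hne
      rcases lt_trichotomy v.1 w.1 with h1 | h1 | h1
      · exact Or.inl (hgv v w h1).le
      · exact absurd (by rw [Subtype.ext h1]) hne
      · exact Or.inr (hgv w v h1).le
    · refine Set.Subset.antisymm hsub fun z hz => ?_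
      obtain ⟨v, hv, hmax⟩ := (Finset.univ.filter fun v => d v = v ∧ v ≤ e z).exists_max_image id
        ⟨⟨0, (e z).pos⟩, by
          simpa using ⟨Nat.eq_zero_of_le_zero (h.isStaircase.le ⟨0, (e z).pos⟩),
            Fin.le_def.2 (Nat.zero_le _)⟩⟩
      simp only [Finset.mem_filter, Finset.mem_univ, true_and, id] at hv hmax
      refine ⟨⟨v, hv.1⟩, ?_⟩
      by_contra hne
      rcases ht (hsub ⟨⟨v, hv.1⟩, rfl⟩) hz hne with h1 | h1
      · have h2 := (he _ _).1 (lt_of_le_of_ne h1 hne)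
        rw [e.apply_symm_apply] at h2
        obtain ⟨w, hw, hvw, hwz⟩ := hg2 _ _ h2
        exact absurd hvw (not_lt.2 (hmax w ⟨hw, hwz⟩))
      · have h2 := (he _ _).1 (lt_of_le_of_ne h1 (Ne.symm hne))
        rw [e.apply_symm_apply, ArcLT, hg1] at h2
        exact absurd ((h.lt_fixed_iff hv.1 _).1 h2) (not_lt.2 hv.2)
    · rw [seqFixed, ← Nat.card_coe_set_eq, ← Nat.card_coe_set_eq]
      refine (Nat.card_congr (Equiv.ofInjective _ fun v w hvw => ?_)).symm
      rcases lt_trichotomy v.1 w.1 with h1 | h1 | h1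
      · exact absurd hvw (hgv v w h1).ne
      · exact Subtype.ext h1
      · exact absurd hvw (hgv w v h1).ne'
  rw [posetSmc]
  obtain ⟨c, hc1, hc2⟩ := hexists
  refine le_antisymm (Nat.sInf_le ⟨c, hc1, hc2⟩) (le_csInf ⟨_, c, hc1, hc2⟩ ?_)
  rintro _ ⟨c', h1, rfl⟩
  exact hlower c' h1

end Stats

/-! ### From staircase sequences to isomorphism classes of posets. -/

section GenFun

variable {n : ℕ} {d : Fin n → ℕ} {τ : Equiv.Perm (Fin n)}

/-- The isomorphism class of the order of a pair `(d, τ)`. -/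
def arcPoset (h : IsStoimenowPair d τ) : UnlabeledPoset n :=
  Quotient.mk (posetSetoid n) (arcOrder h.le)

theorem arcPoset_avoids_twoPlusTwo (h : IsStoimenowPair d τ) :
    (arcPoset h).Avoids TwoPlusTwo := by
  refine (@posetAvoids_twoPlusTwo_iff (Fin n) (arcOrder h.le)).2 fun a b c e hab hce => ?_
  have h1 : (τ a : ℕ) < d b := hab
  have h2 : (τ c : ℕ) < d e := hce
  change (τ a : ℕ) < d e ∨ (τ c : ℕ) < d b
  omega

theorem arcPoset_avoids_threePlusOne_iff (h : IsStoimenowPair d τ) :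
    (arcPoset h).Avoids ThreePlusOne ↔ ¬ HasThreePlusOne (ArcLT d τ) :=
  @posetAvoids_threePlusOne_iff (Fin n) (arcOrder h.le)

theorem arcPoset_avoids_N_iff (h : IsStoimenowPair d τ) :
    (arcPoset h).Avoids PosetN ↔ NoRunCrossing d τ :=
  (@posetAvoids_N_iff (Fin n) (arcOrder h.le)).trans ((not_congr h.hasN_iff).trans not_not)

theorem arcPoset_mag (h : IsStoimenowPair d τ) : (arcPoset h).mag = seqDistinct d :=
  @posetMag_eq n d τ (Fin n) (arcOrder h.le) h (Equiv.refl _) fun _ _ => Iff.rfl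

theorem arcPoset_min (h : IsStoimenowPair d τ) : (arcPoset h).min = seqZeros d :=
  @posetMin_eq n d τ (Fin n) (arcOrder h.le) (Equiv.refl _) fun _ _ => Iff.rfl

theorem arcPoset_ssd (h : IsStoimenowPair d 1) : (arcPoset h).ssd = seqFixed d :=
  @posetSsd_eq n d (Fin n) (arcOrder h.le) h.isStaircase (Equiv.refl _) fun _ _ => Iff.rfl

theorem arcPoset_smc (h : IsStoimenowPair d τ) (hc : NoRunCrossing d τ) :
    (arcPoset h).smc = seqFixed d :=
  @posetSmc_eq n d τ (Fin n) (arcOrder h.le) h hc (Equiv.refl _) fun _ _ => Iff.rfl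

theorem eq_of_arcPoset_eq {d' : Fin n → ℕ} {τ' : Equiv.Perm (Fin n)} (h : IsStoimenowPair d τ)
    (h' : IsStoimenowPair d' τ') (heq : arcPoset h = arcPoset h') : d = d' := by
  obtain ⟨e⟩ := Quotient.exact (s := posetSetoid n) heq
  exact eq_of_arcLT_iff h h' e.toEquiv fun i j =>
    (@OrderIso.lt_iff_lt (Fin n) (Fin n) (arcOrder h.le).toPreorder (arcOrder h'.le).toPreorder
      e i j).symm

theorem exists_arcPoset_eq (P : UnlabeledPoset n) (hP : P.Avoids TwoPlusTwo) :
    ∃ (d : Fin n → ℕ) (τ : Equiv.Perm (Fin n)) (h : IsStoimenowPair d τ), P = arcPoset h := by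
  induction P using Quotient.ind with
  | _ p =>
  obtain ⟨d, τ, e, h, he⟩ := @exists_stoimenowPair n (Fin n) p (Equiv.refl _) hP
  refine ⟨d, τ, h, Quotient.sound (s := posetSetoid n) ⟨?_⟩⟩
  refine (⟨e, @fun a b => ?_⟩ : @OrderIso (Fin n) (Fin n) p.toLE (arcOrder h.le).toLE)
  rw [@le_iff_eq_or_lt (Fin n) p a b, he]
  change e a = e b ∨ _ ↔ _
  rw [e.injective.eq_iff]

/-- Since the isomorphism class determines `d`, a class of posets allowing exactly one `τ` for each
`d` is in bijection with the staircase sequences. -/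
theorem genFun_posets (Q : Type) [PartialOrder Q] (τ : ∀ {n : ℕ}, Staircase n → Equiv.Perm (Fin n))
    (hτ : ∀ {n : ℕ} (d : Staircase n), IsStoimenowPair d.1 (τ d))
    (hQ : ∀ {n : ℕ} (d : Staircase n), (arcPoset (hτ d)).Avoids Q)
    (huniq : ∀ {n : ℕ} (d : Staircase n) (σ : Equiv.Perm (Fin n)) (h : IsStoimenowPair d.1 σ),
      (arcPoset h).Avoids Q → σ = τ d)
    (s : ∀ {n : ℕ}, UnlabeledPoset n → ℕ)
    (hs : ∀ {n : ℕ} (d : Staircase n), s (arcPoset (hτ d)) = seqFixed d.1) :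
    genFun (PosetsAvoiding Q) (fun P => P.1.mag) (fun P => P.1.min) (fun P => s P.1) =
      catalanGF := by
  rw [← genFun_staircase]
  refine genFun_congr (fun n d => ⟨arcPoset (hτ d), arcPoset_avoids_twoPlusTwo _, hQ d⟩)
    (fun n => ⟨fun d d' hd => ?_, fun P => ?_⟩) (fun _ d => arcPoset_mag (hτ d))
    (fun _ d => arcPoset_min (hτ d)) (fun _ d => hs d)
  · exact Subtype.ext (eq_of_arcPoset_eq (hτ d) (hτ d') (congrArg Subtype.val hd))
  · obtain ⟨d, σ, h, hP⟩ := exists_arcPoset_eq P.1 P.2.1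
    refine ⟨⟨d, h.isStaircase⟩, Subtype.ext ?_⟩
    have key : ∀ σ' (h' : IsStoimenowPair d σ'), σ = σ' → arcPoset h' = P.1 := by
      rintro _ _ rfl
      exact hP.symm
    exact key _ (hτ ⟨d, h.isStaircase⟩) (huniq ⟨d, h.isStaircase⟩ σ h (hP ▸ P.2.2))

theorem genFun_threePlusOne :
    genFun (PosetsAvoiding ThreePlusOne) (fun P => P.1.mag) (fun P => P.1.min)
      (fun P => P.1.ssd) = catalanGF :=
  genFun_posets ThreePlusOne (fun _ => 1) (fun d => d.2.isStoimenowPair)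
    (fun d => (arcPoset_avoids_threePlusOne_iff _).2 (not_hasThreePlusOne_one d.2.mono))
    (fun _ _ h hQ => h.eq_one ((arcPoset_avoids_threePlusOne_iff h).1 hQ))
    (fun P => P.ssd) (fun d => arcPoset_ssd d.2.isStoimenowPair)

/-- The permutation without run crossings of a staircase sequence. -/
noncomputable def Staircase.perm (d : Staircase n) : Equiv.Perm (Fin n) :=
  d.2.exists_noRunCrossing.choose

theorem Staircase.isStoimenowPair_perm (d : Staircase n) : IsStoimenowPair d.1 d.perm :=
  d.2.exists_noRunCrossing.choose_spec.1

theorem Staircase.noRunCrossing_perm (d : Staircase n) : NoRunCrossing d.1 d.perm :=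
  d.2.exists_noRunCrossing.choose_spec.2

theorem genFun_N :
    genFun (PosetsAvoiding PosetN) (fun P => P.1.mag) (fun P => P.1.min)
      (fun P => P.1.smc) = catalanGF :=
  genFun_posets PosetN Staircase.perm Staircase.isStoimenowPair_perm
    (fun d => (arcPoset_avoids_N_iff _).2 d.noRunCrossing_perm)
    (fun d _ h hQ => h.eq_of_noRunCrossing d.isStoimenowPair_perm ((arcPoset_avoids_N_iff h).1 hQ)
      d.noRunCrossing_perm)
    (fun P => P.smc) (fun d => arcPoset_smc d.isStoimenowPair_perm d.noRunCrossing_perm)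

end GenFun

end CatalanFishburn

/-! ### Codes of matchings -/

namespace CatalanFishburn

/-- The points `p 0 < p 1 < ⋯` are the openers and the points `q 0 < q 1 < ⋯` the closers of `M`;
there are `d i` closers to the left of `p i`, and the arc of `p i` is `[p i, q (τ i)]`. -/
structure Matching.HasCode {n : ℕ} (M : Matching n) (d : Fin n → ℕ) (τ : Equiv.Perm (Fin n))
    (p q : Fin n → Fin (2 * n)) : Prop where
  p_mono : StrictMono p
  q_mono : StrictMono q
  cover : ∀ a, (∃ i, p i = a) ∨ ∃ j, q j = a
  partner_p : ∀ i, M.partner (p i) = q (τ i)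
  le : ∀ i, d i ≤ τ i
  lt_iff : ∀ i j, p i < q j ↔ d i ≤ j

namespace Matching.HasCode

variable {n : ℕ} {M : Matching n} {d : Fin n → ℕ} {τ : Equiv.Perm (Fin n)}
  {p q : Fin n → Fin (2 * n)}

theorem partner_q (h : M.HasCode d τ p q) (j : Fin n) : M.partner (q j) = p (τ.symm j) := by
  rw [← M.involutive (p (τ.symm j)), h.partner_p, τ.apply_symm_apply]

theorem isOpener (h : M.HasCode d τ p q) (i : Fin n) : M.IsOpener (p i) := by
  rw [Matching.IsOpener, h.partner_p, h.lt_iff]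
  exact h.le i

theorem isCloser (h : M.HasCode d τ p q) (j : Fin n) : M.IsCloser (q j) := by
  rw [Matching.IsCloser, h.partner_q, h.lt_iff]
  simpa using h.le (τ.symm j)

theorem ne (h : M.HasCode d τ p q) (i j : Fin n) : p i ≠ q j := fun hij =>
  lt_asymm (h.isOpener i) (by rw [hij]; exact h.isCloser j)

theorem isOpener_iff (h : M.HasCode d τ p q) (a : Fin (2 * n)) :
    M.IsOpener a ↔ ∃ i, p i = a := by
  constructor
  · intro ha
    rcases h.cover a with hi | ⟨j, rfl⟩
    · exact hi
    · exact absurd ha (lt_asymm (h.isCloser j))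
  · rintro ⟨i, rfl⟩
    exact h.isOpener i

theorem isCloser_iff (h : M.HasCode d τ p q) (a : Fin (2 * n)) :
    M.IsCloser a ↔ ∃ j, q j = a := by
  constructor
  · intro ha
    rcases h.cover a with ⟨i, rfl⟩ | hj
    · exact absurd ha (lt_asymm (h.isOpener i))
    · exact hj
  · rintro ⟨j, rfl⟩
    exact h.isCloser j

theorem q_lt_iff (h : M.HasCode d τ p q) (i j : Fin n) : q j < p i ↔ (j : ℕ) < d i := by
  rw [← not_le, ← not_le, not_iff_not, (h.ne i j).le_iff_lt, h.lt_iff]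

theorem mono (h : M.HasCode d τ p q) : Monotone d := fun i j hij => by
  have h1 := (h.lt_iff j ⟨d j, (h.le j).trans_lt (τ j).2⟩).2 le_rfl
  exact (h.lt_iff i _).1 ((h.p_mono.monotone hij).trans_lt h1)

/-- To the left of the opener `p i` stand `i` openers and `d i` closers. So `d` and the set of
openers determine each other. -/
theorem val_p (h : M.HasCode d τ p q) (i : Fin n) : (p i : ℕ) = i + d i := by
  have : {a : Fin (2 * n) | (a : ℕ) < p i} =
      p '' {k | (k : ℕ) < i} ∪ q '' {j | (j : ℕ) < d i} := by
    ext a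
    constructor
    · intro ha
      rcases h.cover a with ⟨k, rfl⟩ | ⟨j, rfl⟩
      · exact Or.inl ⟨k, h.p_mono.lt_iff_lt.1 (Fin.lt_def.2 ha), rfl⟩
      · exact Or.inr ⟨j, (h.q_lt_iff i j).1 ha, rfl⟩
    · rintro (⟨k, hk, rfl⟩ | ⟨j, hj, rfl⟩)
      · exact h.p_mono (Fin.lt_def.2 hk)
      · exact (h.q_lt_iff i j).2 hj
  rw [← ncard_setOf_lt (p i).2.le, this, Set.ncard_union_eq,
    Set.ncard_image_of_injective _ h.p_mono.injective,
    Set.ncard_image_of_injective _ h.q_mono.injective, ncard_setOf_lt i.2.le,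
    ncard_setOf_lt ((h.le i).trans (τ i).2.le)]
  rw [Set.disjoint_left]
  rintro _ ⟨k, -, rfl⟩ ⟨j, -, hj⟩
  exact h.ne k j hj.symm

theorem range_q (h : M.HasCode d τ p q) : Set.range q = (Set.range p)ᶜ := by
  ext a
  constructor
  · rintro ⟨j, rfl⟩ ⟨i, hi⟩
    exact h.ne i j hi
  · exact fun ha => (h.cover a).resolve_left ha

theorem matching_unique {M' : Matching n} {p' q' : Fin n → Fin (2 * n)} (h : M.HasCode d τ p q)
    (h' : M'.HasCode d τ p' q') : M = M' := by
  have hp : p = p' := by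
    funext i
    exact Fin.ext ((h.val_p i).trans (h'.val_p i).symm)
  subst hp
  have hq : q = q' := (h.q_mono.range_inj h'.q_mono).1 (h.range_q.trans h'.range_q.symm)
  subst hq
  ext a
  rcases h.cover a with ⟨i, rfl⟩ | ⟨j, rfl⟩
  · rw [h.partner_p, h'.partner_p]
  · rw [h.partner_q, h'.partner_q]

theorem code_unique {d' : Fin n → ℕ} {τ' : Equiv.Perm (Fin n)} {p' q' : Fin n → Fin (2 * n)}
    (h : M.HasCode d τ p q) (h' : M.HasCode d' τ' p' q') : d = d' := by
  have hp : p = p' := (h.p_mono.range_inj h'.p_mono).1 (Set.ext fun a =>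
    (h.isOpener_iff a).symm.trans (h'.isOpener_iff a))
  subst hp
  funext i
  have h1 := h.val_p i
  have h2 := h'.val_p i
  omega

theorem exists_matching (hd : Monotone d) (hle : ∀ i, d i ≤ τ i) :
    ∃ (M : Matching n) (p q : Fin n → Fin (2 * n)), M.HasCode d τ p q := by
  -- The number of openers before closer `j`, which puts this closer at position `j + c j`.
  let c : Fin n → ℕ := fun j => {i : Fin n | d i ≤ j}.ncard
  have hc : ∀ i j : Fin n, d i ≤ j ↔ (i : ℕ) < c j := fun i j =>
    mem_iff_lt_ncard (S := {i | d i ≤ j}) (fun _ _ hab ha => (hd hab).trans ha) i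
  have hcn : ∀ j, c j ≤ n := fun j => by
    have := Set.ncard_le_ncard (Set.subset_univ {i : Fin n | d i ≤ j})
    rwa [Set.ncard_univ, Nat.card_fin] at this
  have hcm : ∀ i j, i ≤ j → c i ≤ c j := fun i j hij =>
    Set.ncard_le_ncard fun k (hk : d k ≤ i) => hk.trans (Fin.le_def.1 hij)
  let p : Fin n → Fin (2 * n) := fun i => ⟨i + d i, by
    have := i.2; have := hle i; have := (τ i).2; omega⟩
  let q : Fin n → Fin (2 * n) := fun j => ⟨j + c j, by have := j.2; have := hcn j; omega⟩
  have hp : StrictMono p := fun i j hij => Fin.lt_def.2 (by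
    have := hd hij.le
    have := Fin.lt_def.1 hij
    change (i : ℕ) + d i < j + d j
    omega)
  have hq : StrictMono q := fun i j hij => Fin.lt_def.2 (by
    have := hcm i j hij.le
    have := Fin.lt_def.1 hij
    change (i : ℕ) + c i < j + c j
    omega)
  have hpq : ∀ i j, ((p i : ℕ) < q j ↔ d i ≤ j) ∧ (p i : ℕ) ≠ q j := fun i j => by
    have := hc i j
    change ((i : ℕ) + d i < j + c j ↔ d i ≤ j) ∧ (i : ℕ) + d i ≠ j + c j
    omega
  have hne : ∀ i j, p i ≠ q j := fun i j hij => (hpq i j).2 (congrArg Fin.val hij)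
  have hbij : (Sum.elim p q).Bijective := by
    rw [Fintype.bijective_iff_injective_and_card]
    exact ⟨hp.injective.sumElim hq.injective hne, by simp; omega⟩
  let E := Equiv.ofBijective _ hbij
  let T : Fin n ⊕ Fin n → Fin n ⊕ Fin n := Sum.elim (fun i => .inr (τ i)) fun j => .inl (τ.symm j)
  have hT : ∀ x, T (T x) = x := by rintro (i | j) <;> simp [T]
  have hT' : ∀ x, T x ≠ x := by rintro (i | j) <;> simp [T]
  refine ⟨⟨fun a => E (T (E.symm a)), fun a => ?_, fun a ha => ?_⟩, p, q, hp, hq, fun a => ?_,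
    fun i => ?_, hle, fun i j => (hpq i j).1⟩
  · simp only [Equiv.symm_apply_apply, hT, Equiv.apply_symm_apply]
  · exact hT' _ (E.injective (ha.trans (E.apply_symm_apply a).symm))
  · obtain ⟨i | j, hx⟩ := hbij.2 a
    exacts [Or.inl ⟨i, hx⟩, Or.inr ⟨j, hx⟩]
  · have : E.symm (p i) = .inl i := by
      rw [Equiv.symm_apply_eq]
      rfl
    simp only [this]
    rfl

theorem exists_code (M : Matching n) : ∃ (d : Fin n → ℕ) (τ : Equiv.Perm (Fin n))
    (p q : Fin n → Fin (2 * n)), M.HasCode d τ p q := by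
  classical
  let O := Finset.univ.filter M.IsOpener
  let C := Finset.univ.filter M.IsCloser
  have hOC : O.card = C.card := by
    refine Finset.card_nbij' M.partner M.partner (fun a ha => ?_) (fun a ha => ?_)
      (fun a _ => M.involutive a) (fun a _ => M.involutive a)
    · simpa [O, C, Matching.IsOpener, Matching.IsCloser, M.involutive a] using ha
    · simpa [O, C, Matching.IsOpener, Matching.IsCloser, M.involutive a] using ha
  have hcover : ∀ a, a ∈ O ∨ a ∈ C := fun a => by
    have := (M.partner_ne a).lt_or_gt
    simpa [O, C, Matching.IsOpener, Matching.IsCloser, or_comm] using this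
  have hdisj : Disjoint O C := by
    rw [Finset.disjoint_left]
    intro a ha hb
    simp only [O, C, Finset.mem_filter] at ha hb
    exact lt_asymm ha.2 hb.2
  have hsum : O.card + C.card = 2 * n := by
    rw [← Finset.card_union_of_disjoint hdisj,
      Finset.eq_univ_of_forall fun a => Finset.mem_union.2 (hcover a)]
    simp
  have hO : O.card = n := by omega
  have hC : C.card = n := by omega
  let p := O.orderEmbOfFin hO
  let q := C.orderEmbOfFin hC
  have hpO : ∀ a, a ∈ O ↔ ∃ i, p i = a := fun a => by
    rw [← Finset.mem_coe, ← Finset.range_orderEmbOfFin O hO]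
    rfl
  have hqC : ∀ a, a ∈ C ↔ ∃ j, q j = a := fun a => by
    rw [← Finset.mem_coe, ← Finset.range_orderEmbOfFin C hC]
    rfl
  have hne : ∀ i j, p i ≠ q j := fun i j hij =>
    Finset.disjoint_left.1 hdisj ((hpO _).2 ⟨i, rfl⟩) ((hqC _).2 ⟨j, hij.symm⟩)
  have hopen : ∀ i, p i < M.partner (p i) := fun i => by
    have := (hpO _).2 ⟨i, rfl⟩
    exact (Finset.mem_filter.1 this).2
  have ht : ∀ i, ∃ j, q j = M.partner (p i) := fun i => by
    rw [← hqC]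
    simpa [C, Matching.IsCloser, M.involutive (p i)] using hopen i
  choose t ht using ht
  have htinj : t.Injective := fun i j hij =>
    p.injective (M.involutive.injective ((ht i).symm.trans (hij ▸ ht j)))
  let d : Fin n → ℕ := fun i => {j | q j < p i}.ncard
  have hd : ∀ i j, q j < p i ↔ (j : ℕ) < d i := fun i j =>
    mem_iff_lt_ncard (S := {j | q j < p i}) (fun _ _ hab ha => (q.monotone hab).trans_lt ha) j
  have hlt : ∀ i j, p i < q j ↔ d i ≤ j := fun i j => by
    rw [← (hne i j).le_iff_lt, ← not_lt, ← not_lt, not_iff_not, hd]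
  refine ⟨d, Equiv.ofBijective t (Finite.injective_iff_bijective.1 htinj), p, q, p.strictMono,
    q.strictMono, fun a => ?_, fun i => (ht i).symm, fun i => ?_, hlt⟩
  · rw [← hpO, ← hqC]
    exact hcover a
  · rw [← hlt]
    change p i < q (t i)
    rw [ht]
    exact hopen i

/-- The matching condition compares neighbouring points, the pair condition arbitrary members of a
run; transitivity along the run bridges the two. -/
theorem isStoimenow_iff (h : M.HasCode d τ p q) : M.IsStoimenow ↔ IsStoimenowPair d τ := by
  constructor
  · rintro ⟨h1, h2⟩
    have adj1 : ∀ i j : Fin n, (j : ℕ) = i + 1 → d i = d j → τ i < τ j := fun i j hij hd => by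
      by_contra hno
      have hne : τ j ≠ τ i := fun e => by
        have := congrArg Fin.val (τ.injective e)
        omega
      refine h1 ⟨p i, p j, ?_, h.isOpener i, h.isOpener j, ?_⟩
      · rw [h.val_p, h.val_p]
        omega
      · rw [h.partner_p, h.partner_p]
        exact h.q_mono (lt_of_le_of_ne (not_lt.1 hno) hne)
    have adj2 : ∀ u v : Fin n, (v : ℕ) = u + 1 → (∀ k, (u : ℕ) < d k → (v : ℕ) < d k) →
        τ.symm u < τ.symm v := fun u v huv hk => by
      by_contra hno
      have hne : τ.symm v ≠ τ.symm u := fun e => by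
        have := congrArg Fin.val (τ.symm.injective e)
        omega
      have hlt : q u < q v := h.q_mono (Fin.lt_def.2 (by omega))
      refine h2 ⟨q u, q v, ?_, h.isCloser u, h.isCloser v, ?_⟩
      -- A point strictly between two consecutive closers would be an opener, excluded because they
      -- lie in one run, or another closer.
      · by_contra hval
        rw [Fin.lt_def] at hlt
        have hb : (q u : ℕ) + 1 < 2 * n := by have := (q v).2; omega
        have hb1 : q u < ⟨(q u : ℕ) + 1, hb⟩ := Fin.lt_def.2 (by simp)
        have hb2 : ⟨(q u : ℕ) + 1, hb⟩ < q v := Fin.lt_def.2 (by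
          change (q u : ℕ) + 1 < q v
          omega)
        rcases h.cover ⟨(q u : ℕ) + 1, hb⟩ with ⟨k, hk'⟩ | ⟨w, hw⟩
        · rw [← hk', h.q_lt_iff] at hb1
          rw [← hk', h.lt_iff] at hb2
          have := hk k hb1
          omega
        · rw [← hw, h.q_mono.lt_iff_lt, Fin.lt_def] at hb1 hb2
          omega
      · rw [h.partner_q, h.partner_q]
        exact h.p_mono (lt_of_le_of_ne (not_lt.1 hno) hne)
    have ind : ∀ (r : Fin n → Fin n → Prop), (∀ i j k, r i j → r j k → r i k) →
        ∀ (b : Fin n → Fin n → Prop), (∀ i j k, i < j → j < k → b i k → b i j ∧ b j k) →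
        (∀ i j : Fin n, (j : ℕ) = i + 1 → b i j → r i j) → ∀ i j, i < j → b i j → r i j := by
      intro r hr b hb hadj i j
      induction j using WellFoundedLT.induction with
      | ind j ih =>
      intro hij hbij
      rw [Fin.lt_def] at hij
      rcases (show (j : ℕ) = i + 1 ∨ (i : ℕ) + 1 < j by omega) with hj | hj
      · exact hadj i j hj hbij
      · have hj' : (j : ℕ) - 1 < n := by have := j.2; omega
        have e1 : i < ⟨(j : ℕ) - 1, hj'⟩ := Fin.lt_def.2 (by change _ < (j : ℕ) - 1; omega)
        have e2 : ⟨(j : ℕ) - 1, hj'⟩ < j := Fin.lt_def.2 (by change (j : ℕ) - 1 < _; omega)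
        obtain ⟨b1, b2⟩ := hb _ _ _ e1 e2 hbij
        refine hr _ _ _ (ih _ e2 e1 b1) (hadj _ _ ?_ b2)
        change (j : ℕ) = j - 1 + 1
        omega
    refine ⟨h.mono, h.le, ?_, ?_⟩
    · refine ind (fun i j => τ i < τ j) (fun _ _ _ => lt_trans) (fun i j => d i = d j)
        (fun i j k hij hjk hik => ?_) adj1
      have := h.mono hij.le
      have := h.mono hjk.le
      omega
    · intro i j hij hno
      have := ind (fun u v => τ.symm u < τ.symm v) (fun _ _ _ => lt_trans)
        (fun u v => ∀ k, (u : ℕ) < d k → (v : ℕ) < d k)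
        (fun u v w huv hvw huw => ?_) adj2 (τ i) (τ j) hij hno
      · simpa using this
      · rw [Fin.lt_def] at huv hvw
        exact ⟨fun k hk => by have := huw k hk; omega, fun k hk => huw k (by omega)⟩
  · intro hs
    constructor
    · rintro ⟨a, b, hab, ha, hb, hlt⟩
      obtain ⟨i, rfl⟩ := (h.isOpener_iff a).1 ha
      obtain ⟨j, rfl⟩ := (h.isOpener_iff b).1 hb
      rw [h.partner_p, h.partner_p, h.q_mono.lt_iff_lt] at hlt
      have hij : i < j := h.p_mono.lt_iff_lt.1 (Fin.lt_def.2 (by omega))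
      have h1 := h.mono hij.le
      rw [h.val_p, h.val_p] at hab
      rw [Fin.lt_def] at hij
      exact absurd (hs.openers i j (Fin.lt_def.2 hij) (by omega)) hlt.asymm
    · rintro ⟨a, b, hab, ha, hb, hlt⟩
      obtain ⟨u, rfl⟩ := (h.isCloser_iff a).1 ha
      obtain ⟨v, rfl⟩ := (h.isCloser_iff b).1 hb
      rw [h.partner_q, h.partner_q, h.p_mono.lt_iff_lt] at hlt
      have huv : u < v := h.q_mono.lt_iff_lt.1 (Fin.lt_def.2 (by omega))
      refine absurd (hs.closers (τ.symm u) (τ.symm v) (by simpa using huv) fun k hk => ?_) hlt.asymm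
      rw [τ.apply_symm_apply] at hk ⊢
      have h1 := (h.q_lt_iff k u).2 hk
      rw [← h.q_lt_iff]
      refine lt_of_le_of_ne ?_ (h.ne k v).symm
      rw [Fin.lt_def] at h1
      exact Fin.le_def.2 (by omega)

end Matching.HasCode

end CatalanFishburn

/-! ### Patterns and statistics of matchings -/

namespace CatalanFishburn

namespace IsStoimenowPair

variable {n : ℕ} {d : Fin n → ℕ} {τ : Equiv.Perm (Fin n)}

/-- The closer number `d i` is the first one after opener `i`. A later arc owning it would have the
same level as `i` and would have to close after `i`. -/
theorem le_of_perm_eq (h : IsStoimenowPair d τ) {i o : Fin n} (ho : (τ o : ℕ) = d i) : o ≤ i := by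
  by_contra hlt
  have h1 := h.mono (not_le.1 hlt).le
  have h2 := h.le o
  have h3 := Fin.lt_def.1 (h.openers i o (not_le.1 hlt) (by omega))
  have h4 := h.le i
  omega

/-- Supplies the arc `[1,3]` of both patterns: it crosses arc `i` from the left and closes as early
as possible. -/
theorem exists_first (h : IsStoimenowPair d τ) {i : Fin n} (hi : d i < τ i) :
    ∃ o < i, (τ o : ℕ) = d i := by
  obtain ⟨o, ho⟩ := exists_perm_eq τ (hi.trans (τ i).2)
  refine ⟨o, lt_of_le_of_ne (h.le_of_perm_eq ho) ?_, ho⟩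
  rintro rfl
  omega

theorem exists_last_le (h : IsStoimenowPair d τ) (v : Fin n) :
    ∃ e, d e ≤ v ∧ ∀ k, d k ≤ v → k ≤ e := by
  obtain ⟨e, he, hmax⟩ := (Finset.univ.filter fun k => d k ≤ v).exists_max_image id
    ⟨⟨0, v.pos⟩, by
      have := h.isStaircase.le ⟨0, v.pos⟩
      simp only [Finset.mem_filter, Finset.mem_univ, true_and]
      exact this.trans (Nat.zero_le _)⟩
  simp only [Finset.mem_filter, Finset.mem_univ, true_and, id] at he hmax
  exact ⟨e, he, hmax⟩

theorem perm_le_of_last (h : IsStoimenowPair d τ) {i e : Fin n} (he : ∀ k, d k ≤ τ i → k ≤ e)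
    (hie : i ≤ e) : τ i ≤ τ e := by
  by_contra hlt
  refine absurd (h.closers e i (not_le.1 hlt) fun k hk => ?_) (not_lt.2 hie)
  by_contra hno
  have := h.mono (he k (not_lt.1 hno))
  have := h.le e
  omega

/-- The mirror image of `exists_first`, supplying the arc `[6,8]`: the last opener before the closer
of `i` belongs to an arc that closes after `i`. -/
theorem exists_last (h : IsStoimenowPair d τ) {i k : Fin n} (hik : d i < d k) (hk : d k ≤ τ i) :
    ∃ e, d k ≤ d e ∧ d e ≤ τ i ∧ τ i < τ e := by
  obtain ⟨e, he, hmax⟩ := h.exists_last_le (τ i)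
  have hke := h.mono (hmax k hk)
  have hie : i ≤ e := by
    by_contra hno
    have := h.mono (not_le.1 hno).le
    omega
  refine ⟨e, hke, he, lt_of_le_of_ne (h.perm_le_of_last hmax hie) fun heq => ?_⟩
  rw [τ.injective heq] at hik
  omega

/-- The pattern `P₁` is a copy of `3+1` whose outer chain elements cross the single element. In any
copy of `3+1` they can be replaced by such arcs. -/
theorem eq_one_iff (h : IsStoimenowPair d τ) : (¬ ∃ a b c e, a < b ∧ d b ≤ τ a ∧
    (τ a : ℕ) < d c ∧ (τ c : ℕ) < d e ∧ d e ≤ τ b ∧ τ b < τ e) ↔ τ = 1 := by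
  constructor
  · intro hno
    refine h.eq_one ?_
    rintro ⟨x, y, z, w, hxy, hyz, ⟨hxw, -⟩, -, -, hwz⟩
    simp only [ArcLT, not_lt] at hxy hyz hxw hwz
    have := h.le y
    obtain ⟨o, how, ho⟩ := h.exists_first (i := w) (by omega)
    obtain ⟨e, he1, he2, he3⟩ := h.exists_last (i := w) (k := z) (by omega) hwz
    exact hno ⟨o, w, y, e, how, ho.ge, by omega, by omega, he2, he3⟩
  · rintro rfl ⟨a, b, c, e, h1, h2, h3, h4, h5, h6⟩
    exact not_hasThreePlusOne_one h.mono ⟨a, c, e, b, by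
      have := h.le c
      have := h.le e
      rw [Fin.lt_def] at h6
      simp only [ArcLT]
      have := h.mono h1.le
      have := h.le a
      omega⟩

/-- In `P₂` the arcs `[2,5]` and `[4,7]` cross, while `[1,3]` and `[6,8]` certify that their openers
and closers lie in different runs. -/
theorem noRunCrossing_iff (h : IsStoimenowPair d τ) : (¬ ∃ a b c e, a < b ∧ d b ≤ τ a ∧
    (τ a : ℕ) < d c ∧ d c ≤ τ b ∧ (τ b : ℕ) < d e ∧ d e ≤ τ c ∧ τ c < τ e) ↔
      NoRunCrossing d τ := by
  constructor
  · intro hno x y v h1 h2 h3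
    by_contra! h4
    obtain ⟨o, how, ho⟩ := h.exists_first (i := x) (by omega)
    obtain ⟨e, he1, he2, he3⟩ := h.exists_last (i := y) (k := v) (by omega) h4
    exact hno ⟨o, x, y, e, how, ho.ge, by omega, by omega, by omega, he2, he3⟩
  · rintro hc ⟨a, b, c, e, h1, h2, h3, h4, h5, h6, h7⟩
    have := hc b c e (by omega) h4 h5
    omega

end IsStoimenowPair

namespace Matching.HasCode

variable {n : ℕ} {M : Matching n} {d : Fin n → ℕ} {τ : Equiv.Perm (Fin n)}
  {p q : Fin n → Fin (2 * n)}

theorem exists_of_contains {k : ℕ} {Q : Matching k} (h : M.HasCode d τ p q)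
    {f : Fin (2 * k) ↪o Fin (2 * n)} (hf : ∀ i, M.partner (f i) = f (Q.partner i))
    (i : Fin (2 * k)) (hi : i < Q.partner i) : ∃ a, p a = f i ∧ q (τ a) = f (Q.partner i) := by
  obtain ⟨a, ha⟩ := (h.isOpener_iff (f i)).1 (by
    rw [Matching.IsOpener, hf]
    exact f.strictMono hi)
  exact ⟨a, ha, by rw [← h.partner_p, ha, hf]⟩

theorem contains_patternP1_iff (h : M.HasCode d τ p q) :
    M.Contains patternP1 ↔ ∃ a b c e, a < b ∧ d b ≤ τ a ∧ (τ a : ℕ) < d c ∧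
      (τ c : ℕ) < d e ∧ d e ≤ τ b ∧ τ b < τ e := by
  constructor
  · rintro ⟨f, hf⟩
    obtain ⟨a, ha1, ha2⟩ := h.exists_of_contains hf 0 (by decide)
    obtain ⟨b, hb1, hb2⟩ := h.exists_of_contains hf 1 (by decide)
    obtain ⟨c, hc1, hc2⟩ := h.exists_of_contains hf 3 (by decide)
    obtain ⟨e, he1, he2⟩ := h.exists_of_contains hf 5 (by decide)
    refine ⟨a, b, c, e, ?_, ?_, ?_, ?_, ?_, ?_⟩
    · rw [← h.p_mono.lt_iff_lt, ha1, hb1]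
      exact f.strictMono (by decide)
    · rw [← h.lt_iff, hb1, ha2]
      exact f.strictMono (by decide)
    · rw [← h.q_lt_iff, hc1, ha2]
      exact f.strictMono (by decide)
    · rw [← h.q_lt_iff, he1, hc2]
      exact f.strictMono (by decide)
    · rw [← h.lt_iff, he1, hb2]
      exact f.strictMono (by decide)
    · rw [← h.q_mono.lt_iff_lt, hb2, he2]
      exact f.strictMono (by decide)
  · rintro ⟨a, b, c, e, h1, h2, h3, h4, h5, h6⟩
    let f : Fin (7 + 1) → Fin (2 * n) :=
      ![p a, p b, q (τ a), p c, q (τ c), p e, q (τ b), q (τ e)]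
    have hf : StrictMono f := by
      rw [Fin.strictMono_iff_lt_succ]
      intro i
      fin_cases i
      exacts [h.p_mono h1, (h.lt_iff _ _).2 h2, (h.q_lt_iff _ _).2 h3, (h.lt_iff _ _).2 (h.le c),
        (h.q_lt_iff _ _).2 h4, (h.lt_iff _ _).2 h5, h.q_mono h6]
    refine ⟨OrderEmbedding.ofStrictMono f hf, fun i => ?_⟩
    fin_cases i <;> simp [f, patternP1, h.partner_p, h.partner_q]

theorem contains_patternP2_iff (h : M.HasCode d τ p q) :
    M.Contains patternP2 ↔ ∃ a b c e, a < b ∧ d b ≤ τ a ∧ (τ a : ℕ) < d c ∧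
      d c ≤ τ b ∧ (τ b : ℕ) < d e ∧ d e ≤ τ c ∧ τ c < τ e := by
  constructor
  · rintro ⟨f, hf⟩
    obtain ⟨a, ha1, ha2⟩ := h.exists_of_contains hf 0 (by decide)
    obtain ⟨b, hb1, hb2⟩ := h.exists_of_contains hf 1 (by decide)
    obtain ⟨c, hc1, hc2⟩ := h.exists_of_contains hf 3 (by decide)
    obtain ⟨e, he1, he2⟩ := h.exists_of_contains hf 5 (by decide)
    refine ⟨a, b, c, e, ?_, ?_, ?_, ?_, ?_, ?_, ?_⟩
    · rw [← h.p_mono.lt_iff_lt, ha1, hb1]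
      exact f.strictMono (by decide)
    · rw [← h.lt_iff, hb1, ha2]
      exact f.strictMono (by decide)
    · rw [← h.q_lt_iff, hc1, ha2]
      exact f.strictMono (by decide)
    · rw [← h.lt_iff, hc1, hb2]
      exact f.strictMono (by decide)
    · rw [← h.q_lt_iff, he1, hb2]
      exact f.strictMono (by decide)
    · rw [← h.lt_iff, he1, hc2]
      exact f.strictMono (by decide)
    · rw [← h.q_mono.lt_iff_lt, hc2, he2]
      exact f.strictMono (by decide)
  · rintro ⟨a, b, c, e, h1, h2, h3, h4, h5, h6, h7⟩
    let f : Fin (7 + 1) → Fin (2 * n) :=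
      ![p a, p b, q (τ a), p c, q (τ b), p e, q (τ c), q (τ e)]
    have hf : StrictMono f := by
      rw [Fin.strictMono_iff_lt_succ]
      intro i
      fin_cases i
      exacts [h.p_mono h1, (h.lt_iff _ _).2 h2, (h.q_lt_iff _ _).2 h3, (h.lt_iff _ _).2 h4,
        (h.q_lt_iff _ _).2 h5, (h.lt_iff _ _).2 h6, h.q_mono h7]
    refine ⟨OrderEmbedding.ofStrictMono f hf, fun i => ?_⟩
    fin_cases i <;> simp [f, patternP2, h.partner_p, h.partner_q]

/-- The first `2i` points contain at least `i` openers, since opener `i - 1` stands at `i - 1 + d (i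
- 1) ≤ 2i - 2`. Equality means that opener `i` lies beyond them, that is, `i ≤ d i`. At `i = n`
there is no further opener and the condition is empty. -/
theorem isBalanced_iff (h : M.HasCode d τ p q) (hd : IsStaircase d) {i : ℕ} (hi : i ≤ n) :
    M.IsBalanced i ↔ ∀ hin : i < n, d ⟨i, hin⟩ = i := by
  let S : Set (Fin n) := {k | (p k : ℕ) < 2 * i}
  have hS : ∀ k : Fin n, (k : ℕ) + d k < 2 * i ↔ (k : ℕ) < S.ncard := fun k => by
    rw [← h.val_p]
    exact mem_iff_lt_ncard (S := S)
      (fun a b hab ha => (Fin.le_def.1 (h.p_mono.monotone hab)).trans_lt ha) k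
  have h1 : {a : Fin (2 * n) | (a : ℕ) < 2 * i ∧ M.IsOpener a} = p '' S := by
    ext a
    constructor
    · rintro ⟨ha, ho⟩
      obtain ⟨k, rfl⟩ := (h.isOpener_iff a).1 ho
      exact ⟨k, ha, rfl⟩
    · rintro ⟨k, hk, rfl⟩
      exact ⟨hk, h.isOpener k⟩
  have hsum : {a : Fin (2 * n) | (a : ℕ) < 2 * i ∧ M.IsOpener a}.ncard +
      {b : Fin (2 * n) | (b : ℕ) < 2 * i ∧ M.IsCloser b}.ncard = 2 * i := by
    rw [← Set.ncard_union_eq]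
    · rw [← ncard_setOf_lt (n := 2 * n) (show 2 * i ≤ 2 * n by omega)]
      congr 1
      ext a
      simp only [Set.mem_union, Set.mem_ofPred_eq, ncard_setOf_lt (show 2 * i ≤ 2 * n by omega),
        ← and_or_left, Matching.IsOpener, Matching.IsCloser, and_iff_left_iff_imp]
      exact fun _ => (M.partner_ne a).symm.lt_or_gt
    · rw [Set.disjoint_left]
      exact fun a ha hb => lt_asymm ha.2 hb.2
  rw [h1, Set.ncard_image_of_injective _ h.p_mono.injective] at hsum
  rw [Matching.IsBalanced, h1, Set.ncard_image_of_injective _ h.p_mono.injective]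
  have hSn : S.ncard ≤ n := by
    have := Set.ncard_le_ncard (Set.subset_univ S)
    rwa [Set.ncard_univ, Nat.card_fin] at this
  have hiS : i ≤ S.ncard := by
    rcases Nat.eq_zero_or_pos i with h0 | h0
    · omega
    · have hlt : i - 1 < n := by omega
      have := (hS ⟨i - 1, hlt⟩).1 (by
        have := hd.le ⟨i - 1, hlt⟩
        change d ⟨i - 1, hlt⟩ ≤ i - 1 at this
        change i - 1 + d ⟨i - 1, hlt⟩ < 2 * i
        omega)
      change i - 1 < _ at this
      omega
  constructor
  · intro heq hin
    have h2 := hS ⟨i, hin⟩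
    have h3 := hd.le ⟨i, hin⟩
    change i + d ⟨i, hin⟩ < 2 * i ↔ i < _ at h2
    change d ⟨i, hin⟩ ≤ i at h3
    omega
  · intro hfix
    have : S.ncard ≤ i := by
      by_contra hlt
      have h2 := hS ⟨i, by omega⟩
      have h3 := hfix (by omega)
      change i + d ⟨i, _⟩ < 2 * i ↔ i < _ at h2
      omega
    omega

/-- A block is determined by its start, a fixed point; it ends at the next balanced position, which
exists because `n` is balanced. -/
theorem bl_eq (h : M.HasCode d τ p q) (hd : IsStaircase d) : M.bl = seqFixed d := by
  have himg : Prod.fst '' {b : ℕ × ℕ | M.IsIrreducibleBlock b.1 b.2} =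
      (fun i : Fin n => (i : ℕ)) '' {i | d i = i} := by
    ext i
    constructor
    · rintro ⟨⟨i, j⟩, ⟨hij, hjn, hi, -, -⟩, rfl⟩
      have hin : i < n := lt_of_lt_of_le hij hjn
      exact ⟨⟨i, hin⟩, (h.isBalanced_iff hd hin.le).1 hi hin, rfl⟩
    · rintro ⟨i, hi, rfl⟩
      have hb : M.IsBalanced i := (h.isBalanced_iff hd i.2.le).2 fun _ => hi
      have hex : ∃ j, (i : ℕ) < j ∧ M.IsBalanced j :=
        ⟨n, i.2, (h.isBalanced_iff hd le_rfl).2 fun hlt => absurd hlt (lt_irrefl _)⟩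
      classical
      have hle : Nat.find hex ≤ n := Nat.find_le
        ⟨i.2, (h.isBalanced_iff hd le_rfl).2 fun hlt => absurd hlt (lt_irrefl _)⟩
      obtain ⟨h1, h2⟩ := Nat.find_spec hex
      exact ⟨(i, Nat.find hex), ⟨h1, hle, hb, h2, fun k hk1 hk2 hk3 => Nat.find_min hex hk2 ⟨hk1, hk3⟩⟩, rfl⟩
  rw [Matching.bl, seqFixed, ← Set.ncard_image_of_injective _ Fin.val_injective, ← himg]
  refine (Set.InjOn.ncard_image ?_).symm
  rintro ⟨i, j⟩ ⟨h1, h2, h3, h4, h5⟩ ⟨i', j'⟩ ⟨h1', h2', h3', h4', h5'⟩ (rfl : i = i')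
  rcases lt_trichotomy j j' with hlt | rfl | hlt
  · exact absurd h4 (h5' j h1 hlt)
  · rfl
  · exact absurd h4' (h5 j' h1' hlt)

/-- The first arc owns the first closer, so the arcs crossing it have their openers in the initial
run; conversely, all arcs of this run cross each other. -/
theorem fcr_eq (h : M.HasCode d τ p q) (hs : IsStoimenowPair d τ) : M.fcr = seqZeros d := by
  classical
  rcases Nat.eq_zero_or_pos n with rfl | hn
  -- Without arcs there is no crossing, and the supremum of the empty set is `0`.
  · have : {k : ℕ | ∃ S, M.IsFirstMaximalCrossing S ∧ S.card = k} = ∅ := by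
      ext k
      simp only [Set.mem_ofPred_eq, Set.mem_empty_iff_false, iff_false]
      rintro ⟨S, ⟨-, a, -⟩, -⟩
      exact absurd a.2 (by omega)
    rw [Matching.fcr, this, csSup_empty]
    have := seqZeros_le d
    exact (Nat.le_zero.1 this).symm
  let z : Fin n := ⟨0, hn⟩
  have hz : d z = 0 := Nat.eq_zero_of_le_zero (hs.isStaircase.le z)
  have hτz : (τ z : ℕ) = 0 := by
    obtain ⟨o, ho⟩ := exists_perm_eq τ hn
    have := hs.le_of_perm_eq (i := z) (ho.trans hz.symm)
    have : o = z := le_antisymm this (Fin.le_def.2 (Nat.zero_le _))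
    rwa [this] at ho
  let K : Finset (Fin n) := Finset.univ.filter fun i => d i = 0
  have hK : ∀ i, i ∈ K ↔ d i = 0 := fun i => by simp [K]
  have hcr : M.IsCrossing (K.image p) := by
    refine ⟨⟨p z, Finset.mem_image_of_mem p ((hK z).2 hz)⟩, fun a ha => ?_, fun a ha b hb hab => ?_⟩
    · obtain ⟨i, -, rfl⟩ := Finset.mem_image.1 ha
      exact h.isOpener i
    · obtain ⟨i, hi, rfl⟩ := Finset.mem_image.1 ha
      obtain ⟨j, hj, rfl⟩ := Finset.mem_image.1 hb
      rw [hK] at hi hj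
      rw [h.partner_p, h.partner_p, h.lt_iff, hj]
      exact ⟨Nat.zero_le _, h.q_mono (hs.openers i j (h.p_mono.lt_iff_lt.1 hab) (hi.trans hj.symm))⟩
  have hfirst : M.IsFirstMaximalCrossing (K.image p) := by
    refine ⟨⟨hcr, fun T hT hKT a ha => ?_⟩, p z, Finset.mem_image_of_mem p ((hK z).2 hz), ?_⟩
    · obtain ⟨i, rfl⟩ := (h.isOpener_iff a).1 (hT.2.1 a ha)
      refine Finset.mem_image_of_mem p ((hK i).2 ?_)
      rcases eq_or_ne i z with rfl | hne
      · exact hz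
      · have hlt : z < i := lt_of_le_of_ne (Fin.le_def.2 (Nat.zero_le _)) hne.symm
        have := (hT.2.2 (p z) (hKT (Finset.mem_image_of_mem p ((hK z).2 hz))) (p i) ha
          (h.p_mono hlt)).1
        rw [h.partner_p, h.lt_iff, hτz] at this
        omega
    · rw [h.val_p, hz]
  have hset : {k : ℕ | ∃ S, M.IsFirstMaximalCrossing S ∧ S.card = k} = {(K.image p).card} := by
    ext k
    constructor
    · rintro ⟨S, hS, rfl⟩
      rw [(M.existsUnique_isFirstMaximalCrossing (h.isStoimenow_iff.2 hs) hn).unique hS hfirst]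
      rfl
    · rintro rfl
      exact ⟨_, hfirst, rfl⟩
  rw [Matching.fcr, hset, csSup_singleton, Finset.card_image_of_injective _ h.p_mono.injective,
    seqZeros, ← Set.ncard_coe_finset]
  congr 1
  ext i
  simp [K]

end Matching.HasCode

end CatalanFishburn

/-! ### Maximal crossings -/

namespace CatalanFishburn

/-- A crossing, as a set of indices of openers. -/
def IsIndexCrossing {n : ℕ} (d : Fin n → ℕ) (τ : Equiv.Perm (Fin n)) (K : Finset (Fin n)) : Prop :=
  K.Nonempty ∧ ∀ i ∈ K, ∀ j ∈ K, i < j → d j ≤ τ i ∧ τ i < τ j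

/-- The largest crossing whose last opener is `i`, if `i` is the last opener of its run and there
are no crossings of runs. -/
def levelCrossing {n : ℕ} (d : Fin n → ℕ) (τ : Equiv.Perm (Fin n)) (i : Fin n) : Finset (Fin n) :=
  {k | (∀ o, (τ o : ℕ) = d i → o ≤ k) ∧ k ≤ i ∧ d i ≤ τ k ∧ τ k ≤ τ i}

/-- `i` is the last index of its level. -/
def IsLastOfLevel {n : ℕ} (d : Fin n → ℕ) (i : Fin n) : Prop := ∀ k, d k = d i → k ≤ i

section Crossings

variable {n : ℕ} {d : Fin n → ℕ} {τ : Equiv.Perm (Fin n)}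

theorem mem_levelCrossing {i k : Fin n} : k ∈ levelCrossing d τ i ↔
    (∀ o, (τ o : ℕ) = d i → o ≤ k) ∧ k ≤ i ∧ d i ≤ τ k ∧ τ k ≤ τ i := by
  simp [levelCrossing]

theorem exists_isLastOfLevel (i : Fin n) : ∃ l, d l = d i ∧ IsLastOfLevel d l := by
  obtain ⟨l, hl, hmax⟩ := (Finset.univ.filter fun k => d k = d i).exists_max_image id
    ⟨i, by simp⟩
  simp only [Finset.mem_filter, Finset.mem_univ, true_and, id] at hl hmax
  exact ⟨l, hl, fun k hk => hmax k (hk.trans hl)⟩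

theorem ncard_isLastOfLevel : {i | IsLastOfLevel d i}.ncard = seqDistinct d := by
  have : Set.range d = d '' {i | IsLastOfLevel d i} := by
    ext v
    constructor
    · rintro ⟨i, rfl⟩
      obtain ⟨l, hl, hlast⟩ := exists_isLastOfLevel (d := d) i
      exact ⟨l, hlast, hl⟩
    · rintro ⟨i, -, rfl⟩
      exact ⟨i, rfl⟩
  rw [seqDistinct, this]
  exact (Set.InjOn.ncard_image fun i (hi : IsLastOfLevel d i) j (hj : IsLastOfLevel d j) hij =>
    le_antisymm (hj i hij) (hi j hij.symm)).symm

theorem IsStoimenowPair.self_mem_levelCrossing (h : IsStoimenowPair d τ) (i : Fin n) :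
    i ∈ levelCrossing d τ i :=
  mem_levelCrossing.2 ⟨fun _ ho => h.le_of_perm_eq ho, le_rfl, h.le i, le_rfl⟩

/-- The arc owning closer `d i` belongs to the crossing of `i`. Its membership in the crossing of
`j` gives `d j ≤ d i`, that of `i` gives `i ≤ j`. So distinct levels give incomparable crossings. -/
theorem IsStoimenowPair.eq_of_levelCrossing_subset (h : IsStoimenowPair d τ) {i j : Fin n}
    (hi : IsLastOfLevel d i) (hij : levelCrossing d τ i ⊆ levelCrossing d τ j) : i = j := by
  have h1 := (mem_levelCrossing.1 (hij (h.self_mem_levelCrossing i))).2.1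
  obtain ⟨o, ho⟩ := exists_perm_eq τ ((h.le i).trans_lt (τ i).2)
  have hoi : o ∈ levelCrossing d τ i := mem_levelCrossing.2
    ⟨fun o' ho' => (τ.injective (Fin.ext (ho'.trans ho.symm))).le, h.le_of_perm_eq ho, ho.ge,
      Fin.le_def.2 (ho ▸ h.le i)⟩
  have h2 := (mem_levelCrossing.1 (hij hoi)).2.2.1
  have h3 := h.mono h1
  exact le_antisymm h1 (hi j (by omega))

theorem IsStoimenowPair.exists_levelCrossing_of_noRunCrossing (h : IsStoimenowPair d τ)
    (hc : NoRunCrossing d τ) {K : Finset (Fin n)} (hK : IsIndexCrossing d τ K) :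
    ∃ i, IsLastOfLevel d i ∧ K ⊆ levelCrossing d τ i := by
  have hK0 := hK.1
  let l := K.min' hK0
  let m := K.max' hK0
  have hl : l ∈ K := K.min'_mem hK0
  have hm : m ∈ K := K.max'_mem hK0
  have hll : ∀ k ∈ K, l ≤ k := fun k hk => K.min'_le k hk
  have hmm : ∀ k ∈ K, k ≤ m := fun k hk => K.le_max' k hk
  have hτ : ∀ i ∈ K, ∀ j ∈ K, i ≤ j → τ i ≤ τ j := fun i hi j hj hij => by
    rcases hij.lt_or_eq with h1 | rfl
    · exact (hK.2 i hi j hj h1).2.le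
    · exact le_rfl
  have hdm : d m ≤ τ l := by
    rcases (hll m hm).lt_or_eq with h1 | h1
    · exact (hK.2 l hl m hm h1).1
    · rw [← h1]
      exact h.le l
  -- If the outermost openers lie in different runs, all closers of `K` share one run, and the last
  -- opener before that run serves. Otherwise all openers of `K` share a run, and its last opener
  -- serves.
  rcases (h.mono (hll m hm)).lt_or_eq with hlt | heq
  · obtain ⟨i, hi, hmax⟩ := h.exists_last_le (τ l)
    have hsep : ∀ v, (τ l : ℕ) < d v → (τ m : ℕ) < d v := fun v hv => hc l m v hlt hdm hv
    have hmi : m ≤ i := hmax m hdm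
    have hup : ∀ v, d i < d v → (τ l : ℕ) < d v := fun v hv => by
      by_contra hno
      have := h.mono (hmax v (not_lt.1 hno))
      omega
    refine ⟨i, fun k hk => hmax k (hk ▸ hi), fun k hk => mem_levelCrossing.2
      ⟨fun o ho => le_trans ?_ (hll k hk), (hmm k hk).trans hmi,
        hi.trans (Fin.le_def.1 (hτ l hl k hk (hll k hk))), (hτ k hk m hm (hmm k hk)).trans ?_⟩⟩
    · rcases (show τ o ≤ τ l from Fin.le_def.2 (ho ▸ hi)).lt_or_eq with h1 | h1
      · refine (h.closers o l h1 fun v hv => hup v (by omega)).le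
      · exact (τ.injective h1).le
    · by_contra hno
      refine absurd (h.closers i m (not_le.1 hno) fun v hv => hsep v (hup v ?_)) (not_lt.2 hmi)
      exact (h.le i).trans_lt hv
  · obtain ⟨i, hi, hlast⟩ := exists_isLastOfLevel (d := d) m
    have hmi : m ≤ i := hlast m hi.symm
    refine ⟨i, hlast, fun k hk => mem_levelCrossing.2
      ⟨fun o ho => (h.le_of_perm_eq (ho.trans (hi.trans heq.symm))).trans (hll k hk),
        (hmm k hk).trans hmi,
        (hi ▸ hdm).trans (Fin.le_def.1 (hτ l hl k hk (hll k hk))),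
        (hτ k hk m hm (hmm k hk)).trans ?_⟩⟩
    rcases hmi.lt_or_eq with h1 | h1
    · exact (h.openers m i h1 hi.symm).le
    · rw [h1]

/-- Two nested members would have their openers in different runs and an opener `v` between their
closers. Then the arc owning closer `d i` and the arc `i` cross across runs, with `v` separating
their closers. -/
theorem IsStoimenowPair.isIndexCrossing_of_noRunCrossing (h : IsStoimenowPair d τ)
    (hc : NoRunCrossing d τ) (i : Fin n) : IsIndexCrossing d τ (levelCrossing d τ i) := by
  refine ⟨⟨i, h.self_mem_levelCrossing i⟩, fun k hk l hl hkl => ?_⟩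
  obtain ⟨k1, k2, k3, k4⟩ := mem_levelCrossing.1 hk
  obtain ⟨-, l2, l3, l4⟩ := mem_levelCrossing.1 hl
  have hli := h.mono l2
  refine ⟨hli.trans k3, ?_⟩
  by_contra hno
  have hlt : τ l < τ k := lt_of_le_of_ne (not_lt.1 hno) fun e => hkl.ne' (τ.injective e)
  have hdlt : d k < d l := lt_of_le_of_ne (h.mono hkl.le) fun e => hno (h.openers k l hkl e)
  obtain ⟨v, hv1, hv2⟩ : ∃ v, (τ l : ℕ) < d v ∧ d v ≤ τ k := by
    by_contra! hv
    exact absurd (h.closers l k hlt hv) hkl.asymm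
  obtain ⟨o, ho⟩ := exists_perm_eq τ ((h.le i).trans_lt (τ i).2)
  have hok := h.mono (k1 o ho)
  have := hc o i v (by omega) ho.ge (by omega)
  rw [Fin.le_def] at k4
  omega

theorem IsStaircase.isIndexCrossing_one (h : IsStaircase d) (i : Fin n) :
    IsIndexCrossing d 1 (levelCrossing d 1 i) := by
  refine ⟨⟨i, h.isStoimenowPair.self_mem_levelCrossing i⟩, fun k hk l hl hkl => ⟨?_, hkl⟩⟩
  exact (h.mono (mem_levelCrossing.1 hl).2.1).trans (mem_levelCrossing.1 hk).2.2.1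

theorem IsStaircase.exists_levelCrossing_one (h : IsStaircase d) {K : Finset (Fin n)}
    (hK : IsIndexCrossing d 1 K) : ∃ i, IsLastOfLevel d i ∧ K ⊆ levelCrossing d 1 i := by
  have hm := K.max'_mem hK.1
  obtain ⟨i, hi, hlast⟩ := exists_isLastOfLevel (d := d) (K.max' hK.1)
  have hki : ∀ k ∈ K, k ≤ i := fun k hk => (K.le_max' k hk).trans (hlast _ hi.symm)
  have hdk : ∀ k ∈ K, d i ≤ k := fun k hk => by
    rw [hi]
    rcases (K.le_max' k hk).lt_or_eq with h1 | h1
    · exact (hK.2 k hk _ hm h1).1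
    · exact h1 ▸ h.le k
  exact ⟨i, hlast, fun k hk => mem_levelCrossing.2
    ⟨fun o ho => Fin.le_def.2 (ho.trans_le (hdk k hk)), hki k hk, hdk k hk, hki k hk⟩⟩

end Crossings

namespace Matching.HasCode

variable {n : ℕ} {M : Matching n} {d : Fin n → ℕ} {τ : Equiv.Perm (Fin n)}
  {p q : Fin n → Fin (2 * n)}

theorem isCrossing_iff (h : M.HasCode d τ p q) (S : Finset (Fin (2 * n))) :
    M.IsCrossing S ↔ ∃ K, IsIndexCrossing d τ K ∧ K.image p = S := by
  classical
  constructor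
  · rintro ⟨h0, h1, h2⟩
    have hS : (Finset.univ.filter fun i => p i ∈ S).image p = S := by
      ext a
      simp only [Finset.mem_image, Finset.mem_filter, Finset.mem_univ, true_and]
      constructor
      · rintro ⟨i, hi, rfl⟩
        exact hi
      · intro ha
        obtain ⟨i, rfl⟩ := (h.isOpener_iff a).1 (h1 a ha)
        exact ⟨i, ha, rfl⟩
    refine ⟨_, ⟨?_, fun i hi j hj hij => ?_⟩, hS⟩
    · rw [← hS] at h0
      exact h0.of_image
    · simp only [Finset.mem_filter, Finset.mem_univ, true_and] at hi hj
      have := h2 _ hi _ hj (h.p_mono hij)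
      rwa [h.partner_p, h.partner_p, h.lt_iff, h.q_mono.lt_iff_lt] at this
  · rintro ⟨K, ⟨h0, h1⟩, rfl⟩
    refine ⟨h0.image p, fun a ha => ?_, fun a ha b hb hab => ?_⟩
    · obtain ⟨i, -, rfl⟩ := Finset.mem_image.1 ha
      exact h.isOpener i
    · obtain ⟨i, hi, rfl⟩ := Finset.mem_image.1 ha
      obtain ⟨j, hj, rfl⟩ := Finset.mem_image.1 hb
      rw [h.partner_p, h.partner_p, h.lt_iff, h.q_mono.lt_iff_lt]
      exact h1 i hi j hj (h.p_mono.lt_iff_lt.1 hab)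

/-- Every crossing lies in a level crossing, and these form an antichain, so they are the maximal
crossings, one for each value of `d`. -/
theorem mcr_eq (h : M.HasCode d τ p q) (hs : IsStoimenowPair d τ)
    (hcr : ∀ i, IsIndexCrossing d τ (levelCrossing d τ i))
    (hex : ∀ K, IsIndexCrossing d τ K → ∃ i, IsLastOfLevel d i ∧ K ⊆ levelCrossing d τ i) :
    M.mcr = seqDistinct d := by
  have hinj := Finset.image_injective h.p_mono.injective
  have hsub : ∀ {K L : Finset (Fin n)}, K.image p ⊆ L.image p ↔ K ⊆ L :=
    Finset.image_subset_image_iff h.p_mono.injective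
  have : {S | M.IsMaximalCrossing S} =
      (fun i => (levelCrossing d τ i).image p) '' {i | IsLastOfLevel d i} := by
    ext S
    constructor
    · rintro ⟨hS, hmax⟩
      obtain ⟨K, hK, rfl⟩ := (h.isCrossing_iff S).1 hS
      obtain ⟨i, hi, hKi⟩ := hex K hK
      exact ⟨i, hi, le_antisymm (hmax ((h.isCrossing_iff _).2 ⟨_, hcr i, rfl⟩) (hsub.2 hKi))
        (hsub.2 hKi)⟩
    · rintro ⟨i, hi, rfl⟩
      refine ⟨(h.isCrossing_iff _).2 ⟨_, hcr i, rfl⟩, fun T hT hiT => ?_⟩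
      obtain ⟨K, hK, rfl⟩ := (h.isCrossing_iff T).1 hT
      obtain ⟨j, hj, hKj⟩ := hex K hK
      have hij := hs.eq_of_levelCrossing_subset hi ((hsub.1 hiT).trans hKj)
      subst hij
      exact hsub.2 hKj
  rw [Matching.mcr, this, ← ncard_isLastOfLevel]
  exact Set.InjOn.ncard_image fun i hi j _ hij =>
    hs.eq_of_levelCrossing_subset hi (hinj hij).le

end Matching.HasCode

/-- As for posets: `d` can be read off the matching, and avoidance of `Q` singles out one `τ` for
each `d`. The last two hypotheses enter only through the number of maximal crossings. -/
theorem genFun_matchings {k : ℕ} (Q : Matching k)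
    (τ : ∀ {n : ℕ}, Staircase n → Equiv.Perm (Fin n))
    (hτ : ∀ {n : ℕ} (d : Staircase n), IsStoimenowPair d.1 (τ d))
    (hQ : ∀ {n : ℕ} (d : Staircase n) (σ : Equiv.Perm (Fin n)) (M : Matching n)
      (p q : Fin n → Fin (2 * n)), IsStoimenowPair d.1 σ → M.HasCode d.1 σ p q →
      (¬ M.Contains Q ↔ σ = τ d))
    (hcr : ∀ {n : ℕ} (d : Staircase n) i, IsIndexCrossing d.1 (τ d) (levelCrossing d.1 (τ d) i))
    (hex : ∀ {n : ℕ} (d : Staircase n) K, IsIndexCrossing d.1 (τ d) K →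
      ∃ i, IsLastOfLevel d.1 i ∧ K ⊆ levelCrossing d.1 (τ d) i) :
    genFun (StoimenowAvoiding Q) (fun M => M.1.mcr) (fun M => M.1.fcr) (fun M => M.1.bl) =
      catalanGF := by
  rw [← genFun_staircase]
  choose M p q h using fun (n : ℕ) (d : Staircase n) =>
    Matching.HasCode.exists_matching d.2.mono (hτ d).le
  refine genFun_congr (fun n d => ⟨M n d, (h n d).isStoimenow_iff.2 (hτ d),
    (hQ d _ _ _ _ (hτ d) (h n d)).2 rfl⟩) (fun n => ⟨fun d d' hd => ?_, fun N => ?_⟩)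
    (fun n d => (h n d).mcr_eq (hτ d) (hcr d) (hex d)) (fun n d => (h n d).fcr_eq (hτ d))
    (fun n d => (h n d).bl_eq d.2)
  · have hM : M n d = M n d' := congrArg Subtype.val hd
    exact Subtype.ext ((h n d).code_unique (hM ▸ h n d'))
  · obtain ⟨d, σ, p', q', hN⟩ := Matching.HasCode.exists_code N.1
    have hs := hN.isStoimenow_iff.1 N.2.1
    refine ⟨⟨d, hs.isStaircase⟩, Subtype.ext ?_⟩
    have hσ := (hQ ⟨d, hs.isStaircase⟩ σ N.1 p' q' hs hN).1 N.2.2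
    exact (h n ⟨d, hs.isStaircase⟩).matching_unique (hσ ▸ hN)

theorem genFun_patternP1 :
    genFun (StoimenowAvoiding patternP1) (fun M => M.1.mcr) (fun M => M.1.fcr)
      (fun M => M.1.bl) = catalanGF :=
  genFun_matchings patternP1 (fun _ => 1) (fun d => d.2.isStoimenowPair)
    (fun _ _ _ _ _ hs hM => (not_congr hM.contains_patternP1_iff).trans hs.eq_one_iff)
    (fun d => d.2.isIndexCrossing_one) (fun d _ hK => d.2.exists_levelCrossing_one hK)

theorem genFun_patternP2 :
    genFun (StoimenowAvoiding patternP2) (fun M => M.1.mcr) (fun M => M.1.fcr)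
      (fun M => M.1.bl) = catalanGF :=
  genFun_matchings patternP2 Staircase.perm Staircase.isStoimenowPair_perm
    (fun d _ _ _ _ hs hM => by
      rw [hM.contains_patternP2_iff, hs.noRunCrossing_iff]
      constructor
      · exact fun hc => hs.eq_of_noRunCrossing d.isStoimenowPair_perm hc d.noRunCrossing_perm
      · rintro rfl
        exact d.noRunCrossing_perm)
    (fun d => d.isStoimenowPair_perm.isIndexCrossing_of_noRunCrossing d.noRunCrossing_perm)
    (fun d _ hK =>
      d.isStoimenowPair_perm.exists_levelCrossing_of_noRunCrossing d.noRunCrossing_perm hK)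

end CatalanFishburn

theorem mainTheorem3 :
    let x : MvPowerSeries (Fin 4) ℚ := MvPowerSeries.X 0
    let y : MvPowerSeries (Fin 4) ℚ := MvPowerSeries.X 1
    let z : MvPowerSeries (Fin 4) ℚ := MvPowerSeries.X 2
    let t : MvPowerSeries (Fin 4) ℚ := MvPowerSeries.X 3
    let N : MvPowerSeries (Fin 4) ℚ := narayanaGF
    let F : MvPowerSeries (Fin 4) ℚ := genFun (StoimenowAvoiding patternP1)
      (fun M => M.1.mcr) (fun M => M.1.fcr) (fun M => M.1.bl)
    F = genFun (StoimenowAvoiding patternP2)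
      (fun M => M.1.mcr) (fun M => M.1.fcr) (fun M => M.1.bl) ∧
    F = genFun (PosetsAvoiding ThreePlusOne)
      (fun P => P.1.mag) (fun P => P.1.min) (fun P => P.1.ssd) ∧
    F = genFun (PosetsAvoiding PosetN)
      (fun P => P.1.mag) (fun P => P.1.min) (fun P => P.1.smc) ∧
    F = genFun (AscentAvoiding ![1, 0, 1])
      (fun α => wordLmax α.1) (fun α => wordZero α.1) (fun α => wordRmin α.1) ∧
    F = genFun (FishburnAvoiding ![3, 1, 4, 2])
      (fun π => wordRmin π.1) (fun π => wordIdr π.1) (fun π => wordLmax π.1) ∧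
    (∃ R : MvPowerSeries (Fin 4) ℚ,
      MvPowerSeries.constantCoeff R = 1 ∧
      R ^ 2 = 1 + t ^ 2 * (1 - x) ^ 2 - 2 * t * (1 + x) ∧
      F = 1 + x * y * z * t * (1 - y + t * (x + y + x * y - 1) + (1 - y) * R) *
        ((1 + y * (x * t + y * t - t - 1)) * (1 + t * (x - 2 * x * z - 1) + R))⁻¹) ∧
    F = 1 + x * y * z * t * ((1 - y * t * N) * (1 - z * t * (N + x - 1)))⁻¹ := by
  intro x y z t N F
  have hF : F = catalanGF := genFun_patternP1
  rw [hF]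
  exact ⟨genFun_patternP2.symm, genFun_threePlusOne.symm, genFun_N.symm, genFun_ascent.symm,
    genFun_fishburn.symm, exists_sqrt_catalanGF, rfl⟩
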